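/- Let $X=H^1(\mathbb R;\mathbb C)\times L^2(\mathbb R;\mathbb C)\times L^2(\mathbb R;\mathbb R)\times L^2(\mathbb R;\mathbb R)$, with $\|\vec\varepsilon\|_X^2=\int|\partial_x\varepsilon_1|^2+|\varepsilon_1|^2+|\varepsilon_2|^2+\varepsilon_3^2+\varepsilon_4^2$, and $(f,g)=\Re\int f\bar g$. Let $\alpha>0$, $\beta\in\mathbb R$, $c_1<\dots<c_N$ and $\omega_1,\dots,\omega_N$ be real numbers with $1-c_j^2-\omega_j^2>0$ and $\alpha-\beta(1-c_j^2)>0$ for all $j$. Put $$\phi_{\omega,c}(x)=\sqrt{\tfrac{2(1-c^2-\omega^2)}{\alpha-\beta(1-c^2)}}\ \mathrm{sech}\Big(\tfrac{\sqrt{1-c^2-\omega^2}}{1-c^2}x\Big),\qquad \theta_j=\tfrac{\omega_jc_j}{1-c_j^2},\qquad s_j=\tfrac{\omega_j}{1-c_j^2},$$ and let $\Psi_j\in C^2\cap L^2(\mathbb R)$ be a real nonzero eigenfunction, for a strictly negative eigenvalue, of $$L_j=-(1-c_j^2)\partial_x^2+\tfrac{1-c_j^2-\omega_j^2}{1-c_j^2}-\tfrac{3(\alpha-\beta(1-c_j^2))}{1-c_j^2}\phi_{\omega_j,c_j}^2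 .$$ For real parameters $\tilde\omega_j,\tilde x_j,\tilde\gamma_j$ and a time $t$ let $e_j(x)=e^{i(\theta_jx-s_jt+\tilde\gamma_j)}$ and $$\tilde R_j^{(1)}=e_j\,\phi_{\tilde\omega_j,c_j}(x-c_jt-\tilde x_j),\qquad \tilde R_j^{(3)}=-\tfrac{1}{1-c_j^2}\phi_{\tilde\omega_j,c_j}^2(x-c_jt-\tilde x_j),\qquad \tilde\Psi_j=e_j\,\Psi_j(x-c_jt-\tilde x_j).$$ Let $\psi\in C^\infty(\mathbb R)$ with $\psi=0$ on $s<-1$, $\psi=1$ on $s>1$ and $0\le\psi\le1$; put $\psi_1=1$, $\psi_j(x,t)=\psi\big(t^{-1/2}(x-\tfrac{c_{j-1}+c_j}2t)\big)$ for $2\le j\le N$, $\phi_j=\psi_j-\psi_{j+1}$ for $j<N$ and $\phi_N=\psi_N$. Define $$\begin{aligned}\langle\mathcal H_{loc}\vec\varepsilon,\vec\varepsilon\rangle={}&\int|\partial_x\varepsilon_1|^2+|\varepsilon_1|^2+|\varepsilon_2|^2+\tfrac\alpha2\varepsilon_3^2+\tfrac\alpha2\varepsilon_4^2\\&+\sum_j\int\Big(\alpha\tilde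 R^{(3)}_j|\varepsilon_1|^2+2\alpha\Re(\tilde R_j^{(1)}\bar\varepsilon_1)\varepsilon_3+\beta|\tilde R_j^{(1)}|^2|\varepsilon_1|^2+2\beta\big(\Re(\tilde R_j^{(1)}\bar\varepsilon_1)\big)^2\Big)\\&+\sum_j\int\Big(\alpha c_j\varepsilon_3\varepsilon_4-2\tilde\omega_j\Im(\bar\varepsilon_1\varepsilon_2)-2c_j\Re(\partial_x\varepsilon_1\,\bar\varepsilon_2)\Big)\phi_j ,\end{aligned}$$ and $\mathcal H_{loc}(\vec\varepsilon)=\langle\mathcal H_{loc}\vec\varepsilon,\vec\varepsilon\rangle+\frac\beta2\int|\varepsilon_1|^4$. Then there exist $K>0$ and $\delta>0$, depending only on $\alpha,\beta$ and the $c_j,\omega_j,\Psi_j$, such that for every such $\psi$ and all $x_1,\dots,x_N\in\mathbb R$ there is $T_0$ with the following property. Let $t\ge T_0$, let $|\tilde\omega_j-\omega_j|\le\delta$, $|\tilde x_j-x_j|\le\delta$ and $\tilde\gamma_j\in\mathbb R$ for all $j$, and let $\vec\varepsilon\in X$ satisfy $$(\varepsilon_1,\partial_x\tilde R_j^{(1)})=(\varepsilon_1,i\tilde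 R_j^{(1)})=(\varepsilon_1,\tilde\Psi_j)=0\qquad(j=1,\dots,N).$$ Then $\langle\mathcal H_{loc}\vec\varepsilon,\vec\varepsilon\rangle\ge K\|\vec\varepsilon\|_X^2$. If moreover $\beta\ge0$ or $\|\vec\varepsilon\|_X\le\delta$, then also $\mathcal H_{loc}(\vec\varepsilon)\ge K\|\vec\varepsilon\|_X^2$. -/

import Mathlib

open MeasureTheory
open scoped ComplexConjugate

noncomputable section

namespace KGZ

/-- `u'` is the weak derivative of `u` on the line, tested against real `C_c^∞` functions. -/
def HasWeakDeriv (u u' : ℝ → ℂ) : Prop :=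
  ∀ χ : ℝ → ℝ, ContDiff ℝ (⊤ : ℕ∞) χ → HasCompactSupport χ →
    ∫ x, ((deriv χ x : ℝ) : ℂ) * u x = - ∫ x, ((χ x : ℝ) : ℂ) * u' x

/-- An element `(u, ρ, v, n)` of the energy space
`X = H¹(ℝ; ℂ) × L²(ℝ; ℂ) × L²(ℝ; ℝ) × L²(ℝ; ℝ)`; the field `ux` is the weak derivative of `u`
(determined by `u` almost everywhere). -/
structure Energy where
  u : ℝ → ℂ
  ux : ℝ → ℂ
  ρ : ℝ → ℂ
  v : ℝ → ℝ
  n : ℝ → ℝ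
  memLp_u : MemLp u 2
  memLp_ux : MemLp ux 2
  memLp_ρ : MemLp ρ 2
  memLp_v : MemLp v 2
  memLp_n : MemLp n 2
  weakDeriv : HasWeakDeriv u ux

/-- The square of the norm of `X`. -/
def Energy.normSq (ε : Energy) : ℝ :=
  ∫ x, (‖ε.ux x‖ ^ 2 + ‖ε.u x‖ ^ 2 + ‖ε.ρ x‖ ^ 2 + ε.v x ^ 2 + ε.n x ^ 2)

/-- The norm of `X`. -/
def Energy.norm (ε : Energy) : ℝ := Real.sqrt ε.normSq

/-- The real `L²` inner product `(f, g) = Re ∫ f ḡ` of complex-valued functions. -/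
def realInner (f g : ℝ → ℂ) : ℝ := (∫ x, f x * conj (g x)).re

/-- The profile `φ_{ω,c}(x) = √(2(1-c²-ω²)/(α-β(1-c²))) sech(√(1-c²-ω²)/(1-c²) x)`. -/
def profile (α β ω c : ℝ) (x : ℝ) : ℝ :=
  Real.sqrt (2 * (1 - c ^ 2 - ω ^ 2) / (α - β * (1 - c ^ 2))) /
    Real.cosh (Real.sqrt (1 - c ^ 2 - ω ^ 2) / (1 - c ^ 2) * x)

/-- The Schrödinger operator
`L = -(1-c²)∂² + (1-c²-ω²)/(1-c²) - 3(α-β(1-c²))/(1-c²) φ_{ω,c}²`. -/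
def linOp (α β ω c : ℝ) (f : ℝ → ℝ) (x : ℝ) : ℝ :=
  -(1 - c ^ 2) * deriv (deriv f) x + (1 - c ^ 2 - ω ^ 2) / (1 - c ^ 2) * f x
    - 3 * (α - β * (1 - c ^ 2)) / (1 - c ^ 2) * profile α β ω c x ^ 2 * f x

/-- `Ψ` is a (real, square integrable, nonzero) eigenfunction of `linOp` for a strictly negative
eigenvalue. -/
def IsNegEigenfunction (α β ω c : ℝ) (Ψ : ℝ → ℝ) : Prop :=
  ContDiff ℝ 2 Ψ ∧ MemLp Ψ 2 ∧ (∃ x, Ψ x ≠ 0) ∧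
    ∃ μ : ℝ, μ < 0 ∧ ∀ x, linOp α β ω c Ψ x = μ * Ψ x

/-- The phase factor `exp(i(θ x - s t + γ))` with `θ = ωc/(1-c²)`, `s = ω/(1-c²)`. -/
def phase (ω c γ t x : ℝ) : ℂ :=
  Complex.exp (Complex.I *
    ((ω * c / (1 - c ^ 2) * x - ω / (1 - c ^ 2) * t + γ : ℝ) : ℂ))

/-- First component of the modulated soliton: the phase is that of the frequency `ω`, the profile
that of the modulated frequency `ω'`, the centre is `c t + x'`, the phase shift is `γ'`. -/
def soliton₁ (α β ω c ω' x' γ' t x : ℝ) : ℂ :=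
  phase ω c γ' t x * (profile α β ω' c (x - c * t - x') : ℂ)

/-- Third component of the modulated soliton, `-φ²/(1-c²)`. -/
def soliton₃ (α β c ω' x' t x : ℝ) : ℝ :=
  -(profile α β ω' c (x - c * t - x') ^ 2 / (1 - c ^ 2))

/-- The negative direction carried by the modulated soliton. -/
def negDir (Ψ : ℝ → ℝ) (ω c x' γ' t x : ℝ) : ℂ :=
  phase ω c γ' t x * (Ψ (x - c * t - x') : ℂ)

/-- A smooth cutoff function: `0` on `s < -1`, `1` on `s > 1`, with values in `[0,1]`. -/
def IsCutoff (ψ : ℝ → ℝ) : Prop :=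
  ContDiff ℝ (⊤ : ℕ∞) ψ ∧ (∀ s, s < -1 → ψ s = 0) ∧ (∀ s ∈ Set.Icc (-1 : ℝ) 1, ψ s ∈ Set.Icc (0 : ℝ) 1) ∧
    ∀ s, 1 < s → ψ s = 1

/-- `ψ_j(x,t)`, indices starting at `0`: it is `1` for `j = 0`, and
`ψ((x - m_j t)/√t)` with `m_j = (c_{j-1} + c_j)/2` for `0 < j < N`. The value for `j ≥ N` is `0`,
so that `ψ_j - ψ_{j+1}` is `ψ_j` for the last index. -/
def step {N : ℕ} (ψ : ℝ → ℝ) (c : Fin N → ℝ) (j : ℕ) (t x : ℝ) : ℝ :=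
  if j = 0 then 1
  else if h : j < N then
    ψ ((x - (c ⟨j - 1, lt_of_le_of_lt (Nat.sub_le j 1) h⟩ + c ⟨j, h⟩) / 2 * t) / Real.sqrt t)
  else 0

/-- The localization function `φ_j = ψ_j - ψ_{j+1}` (and `φ_j = ψ_j` for the last index). -/
def loc {N : ℕ} (ψ : ℝ → ℝ) (c : Fin N → ℝ) (j : Fin N) (t x : ℝ) : ℝ :=
  step ψ c j t x - step ψ c (j + 1) t x

/-- Quadratic part of the localized form. It collects, for the functional
`∑_j (E_j - c_j Q_{1,j} - ω'_j Q_{2,j})` at the modulated multi-soliton, the terms of second order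
in `ε`, where products of two different solitons are left out. Here
`E = ∫ |u|² + |ρ|² + |u_x|² + α|u|²v + (β/2)|u|⁴ + (α/2)v² + (α/2)n²`,
`Q₁ = 2 Re ∫ u_x ρ̄ - α ∫ n v`, `Q₂ = 2 Im ∫ ū ρ`, and the index `j` marks
multiplication of the integrand by `φ_j`. -/
def quadForm {N : ℕ} (α β : ℝ) (ω c : Fin N → ℝ) (ψ : ℝ → ℝ) (ω' x' γ' : Fin N → ℝ) (t : ℝ)
    (ε : Energy) : ℝ :=
  (∫ x, (‖ε.ux x‖ ^ 2 + ‖ε.u x‖ ^ 2 + ‖ε.ρ x‖ ^ 2 + α / 2 * ε.v x ^ 2 + α / 2 * ε.n x ^ 2))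
  + ∑ j, (α * (∫ x, soliton₃ α β (c j) (ω' j) (x' j) t x * ‖ε.u x‖ ^ 2)
      + 2 * α * (∫ x,
          (soliton₁ α β (ω j) (c j) (ω' j) (x' j) (γ' j) t x * conj (ε.u x)).re * ε.v x)
      + β * (∫ x, ‖soliton₁ α β (ω j) (c j) (ω' j) (x' j) (γ' j) t x‖ ^ 2 * ‖ε.u x‖ ^ 2)
      + 2 * β * (∫ x,
          (soliton₁ α β (ω j) (c j) (ω' j) (x' j) (γ' j) t x * conj (ε.u x)).re ^ 2))
  + ∑ j, (α * c j * (∫ x, ε.v x * ε.n x * loc ψ c j t x)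
      - 2 * ω' j * (∫ x, (conj (ε.u x) * ε.ρ x).im * loc ψ c j t x)
      - 2 * c j * (∫ x, (ε.ux x * conj (ε.ρ x)).re * loc ψ c j t x))

/-- The localized form with its quartic term. -/
def locForm {N : ℕ} (α β : ℝ) (ω c : Fin N → ℝ) (ψ : ℝ → ℝ) (ω' x' γ' : Fin N → ℝ) (t : ℝ)
    (ε : Energy) : ℝ :=
  quadForm α β ω c ψ ω' x' γ' t ε + β / 2 * ∫ x, ‖ε.u x‖ ^ 4

/-- The orthogonality conditions on `ε`: for each `j`, its first component is orthogonal to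
`∂_x R_j`, to `i R_j` and to the negative direction `Ψ_j`, all three modulated. -/
def Orthogonal {N : ℕ} (α β : ℝ) (ω c : Fin N → ℝ) (Ψ : Fin N → ℝ → ℝ) (ω' x' γ' : Fin N → ℝ)
    (t : ℝ) (ε : Energy) : Prop :=
  ∀ j,
    realInner ε.u (deriv (soliton₁ α β (ω j) (c j) (ω' j) (x' j) (γ' j) t)) = 0 ∧
    realInner ε.u
      (fun x => Complex.I * soliton₁ α β (ω j) (c j) (ω' j) (x' j) (γ' j) t x) = 0 ∧
    realInner ε.u (negDir (Ψ j) (ω j) (c j) (x' j) (γ' j) t) = 0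

end KGZ

end

/-!
The quadratic form is minimized explicitly over the components `ρ`, `v`, `n`: completing squares in
the density leaves, for the first component `u` alone, the density `reducedForm`, which is
`|u_x|² + |u|² - |iΩu + Cu_x|²` plus potential terms, where `C` and `Ω` are the local averages of the
speeds and the frequencies (`reduced_le_density`). A convex combination of this bound with a cruder
one that keeps `|ρ|² + v² + n²` at the expense of `|u|² + |u_x|²` (`le_density`) gives the full norm.

For a time large enough the solitons are at distance of order `t` from each other. Cutoffs of size
`σ t` around the solitons, with disjoint supports on which the localization function of the soliton
equals one, split the reduced density into the densities `solitonForm` of one soliton each, and a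
remainder which is the density of the linear equation and is positive because averages of pairs
`(c, ω)` with `c² + ω² ≤ 1 - k₀` satisfy the same bound. The errors are tails of solitons and
derivatives of cutoffs, all below a small `τ` (`sum_solitonForm_le_reducedForm`).

For one soliton, removing the phase `exp(i(θx - st + γ))` diagonalizes the form: after scaling, the
real and imaginary parts of the first component see the operators `-∂² + 1 - 6 sech²` and
`-∂² + 1 - 2 sech²`. These Pöschl–Teller operators factorize, for instance
`∫ a'² + a² - 6 sech² a² = ∫ (a' + 2 tanh a)² - 3 a²`, and the factors turn functions orthogonal to
`sech²` (or `sech`) into functions of the same kind for a potential with one bound state less, down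
to the free operator. Hence the first form is coercive on the complement of `sech²` and
`sech · tanh`, and the second one on the complement of `sech`. This is proved for compactly
supported functions first; adding the squares of the inner products removes the orthogonality
conditions (`coercive_of_coercive_orthogonal`), and the resulting estimate passes to `H¹` by density
(`exists_test_approx`).

An eigenfunction for a negative eigenvalue has to be a multiple of `sech²(κ x)`, with `κ` the
inverse width of the soliton: after removal of its component along `sech²` it is still a solution
of the eigenvalue equation, orthogonal to `sech²`, and to `sech · tanh` because the eigenvalues
differ, so a nonzero remainder would contradict coercivity (`IsNegEigenfunction.eq_sech_sq`).
So the three orthogonality conditions are those that the coercivity needs, up to a change of the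
width from `ω` to the modulated frequency, which is a small perturbation. The quartic term is
controlled by `∫ |u|⁴ ≤ 2 ‖u‖²_{H¹} ‖u‖²_{L²}`.
-/

noncomputable section

namespace KGZ

open Filter Topology Set

/-! ### Density of test functions in `H¹` -/

/-- A compactly supported continuous function of integral zero has a compactly supported
primitive. -/
theorem exists_primitive_hasCompactSupport {E : Type*} [NormedAddCommGroup E] [NormedSpace ℝ E]
    [CompleteSpace E] {f : ℝ → E} (hf : Continuous f) (hs : HasCompactSupport f)
    (h0 : ∫ x, f x = 0) :
    ∃ G : ℝ → E, (∀ x, HasDerivAt G (f x) x) ∧ HasCompactSupport G := by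
  obtain ⟨R, hR⟩ := hs.isCompact.isBounded.subset_closedBall 0
  have hz : ∀ x, R < |x| → f x = 0 := by
    intro x hx
    by_contra h
    have := hR (subset_tsupport f h)
    rw [mem_closedBall_zero_iff, Real.norm_eq_abs] at this
    linarith
  refine ⟨fun x => ∫ y in (-(|R| + 1))..x, f y, fun x => ?_, ?_⟩
  · exact intervalIntegral.integral_hasDerivAt_right (hf.intervalIntegrable _ _)
      (hf.stronglyMeasurableAtFilter _ _) hf.continuousAt
  · refine HasCompactSupport.intro (isCompact_Icc (a := -(|R| + 1)) (b := |R| + 1)) fun x hx => ?_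
    have hRR := le_abs_self R
    rcases lt_or_ge x (-(|R| + 1)) with h | h
    · refine (intervalIntegral.integral_congr fun y hy => ?_).trans
        intervalIntegral.integral_zero
      rw [uIcc_of_ge h.le] at hy
      apply hz
      have := neg_le_abs y
      linarith [hy.2]
    · have hx' : |R| + 1 < x := by
        by_contra hc
        exact hx ⟨h, not_lt.1 hc⟩
      rw [← h0]
      refine intervalIntegral.integral_eq_integral_of_support_subset fun y hy => ?_
      have h1 : |y| ≤ R := by
        by_contra hc
        exact hy (hz y (not_le.1 hc))
      obtain ⟨h2, h3⟩ := abs_le.1 h1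
      constructor <;> linarith

theorem exists_test_integral_one : ∃ χ : ℝ → ℝ, ContDiff ℝ (⊤ : ℕ∞) χ ∧ HasCompactSupport χ ∧
    ∫ x, χ x = 1 := by
  let b : ContDiffBump (0 : ℝ) := ⟨1, 2, one_pos, one_lt_two⟩
  exact ⟨b.normed volume, b.contDiff_normed, b.hasCompactSupport_normed, b.integral_normed⟩

/-- The lemma of du Bois-Reymond: a function with vanishing weak derivative is constant. -/
theorem ae_eq_const_of_weakDeriv_zero {G : ℝ → ℂ} (hG : LocallyIntegrable G)
    (h : ∀ χ : ℝ → ℝ, ContDiff ℝ (⊤ : ℕ∞) χ → HasCompactSupport χ →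
      ∫ x, deriv χ x • G x = 0) : ∃ C : ℂ, ∀ᵐ x, G x = C := by
  obtain ⟨χ, hχ, hχs, hχ1⟩ := exists_test_integral_one
  refine ⟨∫ x, χ x • G x, ?_⟩
  set C := ∫ x, χ x • G x with hC
  have key : ∀ᵐ x, G x - C = 0 := by
    refine ae_eq_zero_of_integral_contDiff_smul_eq_zero (hG.sub (locallyIntegrable_const C)) ?_
    intro η hη hηs
    have hηi : Integrable η := hη.continuous.integrable_of_hasCompactSupport hηs
    have hχi : Integrable χ := hχ.continuous.integrable_of_hasCompactSupport hχs
    have hs : HasCompactSupport fun x => η x - (∫ y, η y) * χ x := hηs.sub (hχs.mul_left)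
    have hsm : ContDiff ℝ (⊤ : ℕ∞) fun x => η x - (∫ y, η y) * χ x :=
      hη.sub (contDiff_const.mul hχ)
    obtain ⟨H, hH, hHs⟩ := exists_primitive_hasCompactSupport hsm.continuous hs (by
      rw [integral_sub hηi (hχi.const_mul _), integral_const_mul, hχ1]; ring)
    have hd : deriv H = fun x => η x - (∫ y, η y) * χ x := funext fun x => (hH x).deriv
    have hHsm : ContDiff ℝ (⊤ : ℕ∞) H := by
      rw [contDiff_infty_iff_deriv]
      exact ⟨fun x => (hH x).differentiableAt, hd ▸ hsm⟩
    have := h H hHsm hHs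
    have e1 : Integrable fun x => η x • G x :=
      hG.integrable_smul_left_of_hasCompactSupport hη.continuous hηs
    have e2 : Integrable fun x => χ x • G x :=
      hG.integrable_smul_left_of_hasCompactSupport hχ.continuous hχs
    have e3 : Integrable fun x => η x • C := hηi.smul_const C
    simp only [hd, sub_smul, mul_smul] at this
    rw [integral_sub e1 (e2.fun_smul _), integral_smul] at this
    simp only [smul_sub]
    rw [integral_sub e1 e3, integral_smul_const]
    exact this
  filter_upwards [key] with x hx using sub_eq_zero.1 hx

/-- A square integrable function that solves `h' = s h` weakly, `s ≠ 0`, vanishes. -/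
theorem ae_eq_zero_of_weakDeriv_eq_mul {h : ℝ → ℂ} (hh : MemLp h 2) {s : ℝ}
    (H : ∀ χ : ℝ → ℝ, ContDiff ℝ (⊤ : ℕ∞) χ → HasCompactSupport χ →
      ∫ x, (deriv χ x + s * χ x) • h x = 0) : ∀ᵐ x, h x = 0 := by
  have hl : LocallyIntegrable h := hh.locallyIntegrable (by norm_num)
  have hce : Continuous fun x : ℝ => Real.exp (-(s * x)) := by fun_prop
  obtain ⟨C, hC⟩ := ae_eq_const_of_weakDeriv_zero
    (G := fun x => Real.exp (-(s * x)) • h x) (hl.continuous_smul hce) (by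
      intro χ hχ hχs
      have := H (fun x => Real.exp (-(s * x)) * χ x)
        ((Real.contDiff_exp.comp (contDiff_const.mul contDiff_id).neg).mul hχ) hχs.mul_left
      rw [← this]
      refine integral_congr_ae (ae_of_all _ fun x => ?_)
      have hd : HasDerivAt (fun x => Real.exp (-(s * x)) * χ x)
          (Real.exp (-(s * x)) * (-(s * 1)) * χ x + Real.exp (-(s * x)) * deriv χ x) x :=
        ((((hasDerivAt_id x).const_mul s).neg).exp).mul
          ((hχ.differentiable (by simp)) x).hasDerivAt
      simp only [hd.deriv, smul_smul]
      congr 1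
      ring)
  have h2 : ∀ᵐ x, h x = Real.exp (s * x) • C := by
    filter_upwards [hC] with x hx
    rw [← hx, smul_smul, ← Real.exp_add]
    simp
  have hi : Integrable fun x => ‖h x‖ ^ 2 := hh.integrable_norm_pow (by norm_num)
  by_cases hC0 : C = 0
  · filter_upwards [h2] with x hx
    simp [hx, hC0]
  exfalso
  -- the weight `exp (2 s x)` is at least `1` on a half line
  have hi2 : Integrable fun x : ℝ => Real.exp (s * x) ^ 2 * ‖C‖ ^ 2 := by
    refine hi.congr ?_
    filter_upwards [h2] with x hx
    rw [hx, norm_smul, mul_pow, Real.norm_eq_abs, sq_abs]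
  have hCp : 0 < ‖C‖ ^ 2 := by positivity
  have hbig : ∀ x : ℝ, 0 ≤ s * x → ‖C‖ ^ 2 ≤ Real.exp (s * x) ^ 2 * ‖C‖ ^ 2 := by
    intro x hx
    have := Real.one_le_exp hx
    nlinarith [one_le_pow₀ this (n := 2)]
  have hfin := (hi2.measure_ge_lt_top hCp)
  rcases le_total 0 s with hs | hs
  · have : volume (Ici (0 : ℝ)) ≤ _ := measure_mono
      (t := {x : ℝ | ‖C‖ ^ 2 ≤ Real.exp (s * x) ^ 2 * ‖C‖ ^ 2})
      fun x hx => mem_ofPred.2 (hbig x (mul_nonneg hs hx))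
    rw [Real.volume_Ici] at this
    exact absurd hfin (not_lt.2 this)
  · have : volume (Iic (0 : ℝ)) ≤ _ := measure_mono
      (t := {x : ℝ | ‖C‖ ^ 2 ≤ Real.exp (s * x) ^ 2 * ‖C‖ ^ 2})
      fun x hx => mem_ofPred.2 (hbig x (mul_nonneg_of_nonpos_of_nonpos hs hx))
    rw [Real.volume_Iic] at this
    exact absurd hfin (not_lt.2 this)

/-- The graph of the derivative on complex test functions, as a subspace of `L² × L²`. -/
def testGraph : Submodule ℂ (WithLp 2 (Lp ℂ 2 (volume : Measure ℝ) × Lp ℂ 2 (volume : Measure ℝ))) where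
  carrier := {z | ∃ f : ℝ → ℂ, ContDiff ℝ (⊤ : ℕ∞) f ∧ HasCompactSupport f ∧
    z.fst =ᵐ[volume] f ∧ z.snd =ᵐ[volume] deriv f}
  zero_mem' := by
    refine ⟨fun _ => 0, contDiff_const, HasCompactSupport.zero, Lp.coeFn_zero _ _ _, ?_⟩
    simp only [deriv_const']
    exact Lp.coeFn_zero _ _ _
  add_mem' := by
    rintro z w ⟨f, hf, hfs, h1, h2⟩ ⟨g, hg, hgs, h3, h4⟩
    refine ⟨fun x => f x + g x, hf.add hg, hfs.add hgs, ?_, ?_⟩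
    · filter_upwards [h1, h3, Lp.coeFn_add z.fst w.fst] with x h1 h3 h5
      rw [WithLp.add_fst, h5, Pi.add_apply, h1, h3]
    · filter_upwards [h2, h4, Lp.coeFn_add z.snd w.snd] with x h1 h3 h5
      rw [WithLp.add_snd, h5, Pi.add_apply, h1, h3,
        deriv_fun_add ((hf.differentiable (by simp)) x) ((hg.differentiable (by simp)) x)]
  smul_mem' := by
    rintro c z ⟨f, hf, hfs, h1, h2⟩
    refine ⟨fun x => c * f x, contDiff_const.mul hf, hfs.mul_left, ?_, ?_⟩
    · filter_upwards [h1, Lp.coeFn_smul c z.fst] with x h1 h5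
      rw [WithLp.smul_fst, h5, Pi.smul_apply, h1, smul_eq_mul]
    · filter_upwards [h2, Lp.coeFn_smul c z.snd] with x h1 h5
      rw [WithLp.smul_snd, h5, Pi.smul_apply, h1, smul_eq_mul,
        deriv_const_mul_field]

theorem memLp_of_continuous_hasCompactSupport {E : Type*} [NormedAddCommGroup E] {f : ℝ → E}
    (hf : Continuous f) (hs : HasCompactSupport f) : MemLp f 2 :=
  hf.memLp_of_hasCompactSupport hs

theorem norm_sq_Lp_two (v : Lp ℂ 2 (volume : Measure ℝ)) : ‖v‖ ^ 2 = ∫ x, ‖v x‖ ^ 2 := by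
  have := L2.inner_def (𝕜 := ℂ) v v
  simp only [inner_self_eq_norm_sq_to_K, ← RCLike.ofReal_pow] at this
  rw [integral_ofReal] at this
  exact RCLike.ofReal_injective this

/-- Integration by parts for complex test functions. -/
theorem hasWeakDeriv_of_contDiff {f : ℝ → ℂ} (hf : ContDiff ℝ (⊤ : ℕ∞) f)
    (hfs : HasCompactSupport f) : HasWeakDeriv f (deriv f) := by
  intro χ hχ hχs
  have hd : ∀ x, HasDerivAt (fun x => ((χ x : ℝ) : ℂ) * f x)
      (((deriv χ x : ℝ) : ℂ) * f x + ((χ x : ℝ) : ℂ) * deriv f x) x := fun x =>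
    (((hχ.differentiable (by simp)) x).hasDerivAt.ofReal_comp).mul
      ((hf.differentiable (by simp)) x).hasDerivAt
  have hdf : Continuous (deriv f) := hf.continuous_deriv (by simp)
  have hdχ : Continuous (deriv χ) := hχ.continuous_deriv (by simp)
  have hf0 := hf.continuous
  have hχ0 := hχ.continuous
  have i1 : Integrable fun x => ((deriv χ x : ℝ) : ℂ) * f x :=
    (by fun_prop : Continuous fun x => ((deriv χ x : ℝ) : ℂ) * f x).integrable_of_hasCompactSupport
      hfs.mul_left
  have i2 : Integrable fun x => ((χ x : ℝ) : ℂ) * deriv f x :=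
    (by fun_prop : Continuous fun x => ((χ x : ℝ) : ℂ) * deriv f x).integrable_of_hasCompactSupport
      hfs.deriv.mul_left
  have i3 : Integrable fun x => ((χ x : ℝ) : ℂ) * f x :=
    (by fun_prop : Continuous fun x => ((χ x : ℝ) : ℂ) * f x).integrable_of_hasCompactSupport
      hfs.mul_left
  have := integral_eq_zero_of_hasDerivAt_of_integrable hd (i1.add i2) i3
  rw [integral_add i1 i2] at this
  exact eq_neg_of_add_eq_zero_left this

/-- Test functions are dense in `H¹`: a square integrable function with square integrable weak
derivative is approximated, together with its derivative, by test functions. The difference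
between a pair and its projection on the closure of the test functions is a pair `(p, q)` with
`p' = q` and, by orthogonality, `q' = p`; so `p + q` and `p - q` are multiples of `exp x` and
`exp (-x)`, and vanish since they are square integrable. -/
theorem exists_test_approx {u u' : ℝ → ℂ} (hu : MemLp u 2) (hu' : MemLp u' 2)
    (hw : HasWeakDeriv u u') {η : ℝ} (hη : 0 < η) :
    ∃ f : ℝ → ℂ, ContDiff ℝ (⊤ : ℕ∞) f ∧ HasCompactSupport f ∧
      ∫ x, (‖f x - u x‖ ^ 2 + ‖deriv f x - u' x‖ ^ 2) < η := by
  classical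
  let E := WithLp 2 (Lp ℂ 2 (volume : Measure ℝ) × Lp ℂ 2 (volume : Measure ℝ))
  -- the pair of `L²` classes of complex functions `f`, `g`
  let mk : ∀ f g : ℝ → ℂ, MemLp f 2 → MemLp g 2 → E := fun f g hf hg =>
    WithLp.toLp 2 (hf.toLp f, hg.toLp g)
  have hinner : ∀ (f g : ℝ → ℂ) (hf : MemLp f 2) (hg : MemLp g 2) (z : E),
      inner ℂ (mk f g hf hg) z = (∫ x, conj (f x) * z.fst x) + ∫ x, conj (g x) * z.snd x := by
    intro f g hf hg z
    rw [WithLp.prod_inner_apply, L2.inner_def, L2.inner_def]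
    congr 1
    · refine integral_congr_ae ?_
      filter_upwards [hf.coeFn_toLp] with x hx
      simp [mk, hx, mul_comm]
    · refine integral_congr_ae ?_
      filter_upwards [hg.coeFn_toLp] with x hx
      simp [mk, hx, mul_comm]
  have hT : ∀ χ : ℝ → ℝ, ContDiff ℝ (⊤ : ℕ∞) χ → HasCompactSupport χ →
      MemLp (fun x => ((χ x : ℝ) : ℂ)) 2 ∧ MemLp (fun x => ((deriv χ x : ℝ) : ℂ)) 2 := by
    intro χ hχ hχs
    have hdχ : Continuous (deriv χ) := hχ.continuous_deriv (by simp)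
    have hχ0 := hχ.continuous
    exact ⟨memLp_of_continuous_hasCompactSupport (by fun_prop)
        (hχs.comp_left (g := fun r : ℝ => (r : ℂ)) (by simp)),
      memLp_of_continuous_hasCompactSupport (by fun_prop)
        (hχs.deriv.comp_left (g := fun r : ℝ => (r : ℂ)) (by simp))⟩
  -- pairs whose second entry is the weak derivative of the first
  let W : Set E := {z | ∀ (χ : ℝ → ℝ) (hχ : ContDiff ℝ (⊤ : ℕ∞) χ) (hχs : HasCompactSupport χ),
    inner ℂ (mk _ _ (hT χ hχ hχs).2 (hT χ hχ hχs).1) z = 0}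
  have hWc : IsClosed W := by
    simp only [W, ofPred_forall]
    refine isClosed_iInter fun χ => isClosed_iInter fun hχ => isClosed_iInter fun hχs => ?_
    exact isClosed_eq (by fun_prop) continuous_const
  have hWmem : ∀ z : E, z ∈ W ↔ HasWeakDeriv z.fst z.snd := by
    intro z
    simp only [W, mem_ofPred_eq, hinner, HasWeakDeriv, Complex.conj_ofReal, add_eq_zero_iff_eq_neg]
  have hcongr : ∀ {f f' g g' : ℝ → ℂ}, f =ᵐ[volume] f' → g =ᵐ[volume] g' → HasWeakDeriv f g →
      HasWeakDeriv f' g' := by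
    intro f f' g g' h1 h2 h χ hχ hχs
    have := h χ hχ hχs
    have e1 : ∫ x, ((deriv χ x : ℝ) : ℂ) * f' x = ∫ x, ((deriv χ x : ℝ) : ℂ) * f x :=
      integral_congr_ae (by filter_upwards [h1] with x hx; rw [hx])
    have e2 : ∫ x, ((χ x : ℝ) : ℂ) * g' x = ∫ x, ((χ x : ℝ) : ℂ) * g x :=
      integral_congr_ae (by filter_upwards [h2] with x hx; rw [hx])
    rw [e1, e2, this]
  have hKW : (testGraph.topologicalClosure : Set E) ⊆ W := by
    refine closure_minimal ?_ hWc
    rintro z ⟨f, hf, hfs, h1, h2⟩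
    exact (hWmem z).2 (hcongr h1.symm h2.symm (hasWeakDeriv_of_contDiff hf hfs))
  let z : E := mk u u' hu hu'
  have hzW : z ∈ W := (hWmem z).2 (hcongr hu.coeFn_toLp.symm hu'.coeFn_toLp.symm hw)
  let K := testGraph.topologicalClosure
  have : CompleteSpace K := (testGraph.isClosed_topologicalClosure).completeSpace_coe
  obtain ⟨y, hy, w, hwK, hyw⟩ := K.exists_add_mem_mem_orthogonal z
  have hwW : w ∈ W := by
    have : w = z - y := by rw [hyw]; abel
    intro χ hχ hχs
    rw [this, inner_sub_right, hzW χ hχ hχs, hKW hy χ hχ hχs, sub_zero]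
  have hw1 := (hWmem w).1 hwW
  have hw2 : ∀ χ : ℝ → ℝ, ContDiff ℝ (⊤ : ℕ∞) χ → HasCompactSupport χ →
      ∫ x, ((deriv χ x : ℝ) : ℂ) * w.snd x = - ∫ x, ((χ x : ℝ) : ℂ) * w.fst x := by
    intro χ hχ hχs
    have hmem : mk _ _ (hT χ hχ hχs).1 (hT χ hχ hχs).2 ∈ testGraph := by
      refine ⟨fun x => ((χ x : ℝ) : ℂ), Complex.ofRealCLM.contDiff.comp hχ,
        hχs.comp_left (g := fun r : ℝ => (r : ℂ)) (by simp), (hT χ hχ hχs).1.coeFn_toLp, ?_⟩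
      refine (hT χ hχ hχs).2.coeFn_toLp.trans (ae_of_all _ fun x => ?_)
      exact (((hχ.differentiable (by simp)) x).hasDerivAt.ofReal_comp).deriv.symm
    have := hwK _ (testGraph.le_topologicalClosure hmem)
    rw [hinner] at this
    simp only [Complex.conj_ofReal] at this
    rw [add_comm] at this
    exact eq_neg_of_add_eq_zero_left this
  have hp := Lp.memLp w.fst
  have hq := Lp.memLp w.snd
  have hint : ∀ (g : ℝ → ℝ), Continuous g → HasCompactSupport g → ∀ h : ℝ → ℂ, MemLp h 2 →
      Integrable fun x => ((g x : ℝ) : ℂ) * h x := by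
    intro g hg hgs h hh
    simpa using (hh.locallyIntegrable (by norm_num)).integrable_smul_left_of_hasCompactSupport hg hgs
  -- `p + s q` solves `h' = s h` when `s ^ 2 = 1`
  have hcomb : ∀ s : ℝ, s ^ 2 = 1 → ∀ᵐ x, w.fst x + (s : ℂ) * w.snd x = 0 := by
    intro s hs
    refine ae_eq_zero_of_weakDeriv_eq_mul (s := s) (hp.add (hq.const_mul (s : ℂ))) ?_
    intro χ hχ hχs
    have hdχ : Continuous (deriv χ) := hχ.continuous_deriv (by simp)
    have j1 := hint _ hdχ hχs.deriv _ hp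
    have j2 := hint _ hdχ hχs.deriv _ hq
    have j3 := hint _ hχ.continuous hχs _ hp
    have j4 := hint _ hχ.continuous hχs _ hq
    have e : ∀ x, (deriv χ x + s * χ x) • (w.fst x + (s : ℂ) * w.snd x) =
        ((((deriv χ x : ℝ) : ℂ) * w.fst x + (s : ℂ) * (((deriv χ x : ℝ) : ℂ) * w.snd x))
        + ((s : ℂ) * (((χ x : ℝ) : ℂ) * w.fst x) + ((χ x : ℝ) : ℂ) * w.snd x)) := by
      intro x
      have hs' : (s : ℂ) ^ 2 = 1 := by exact_mod_cast hs
      rw [Complex.real_smul]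
      push_cast
      linear_combination ((χ x : ℝ) : ℂ) * w.snd x * hs'
    rw [integral_congr_ae (ae_of_all _ e), integral_add, integral_add j1 (j2.const_mul _),
      integral_add (j3.const_mul _) j4, integral_const_mul, integral_const_mul, hw1 χ hχ hχs,
      hw2 χ hχ hχs]
    · ring
    · exact j1.add (j2.const_mul _)
    · exact (j3.const_mul _).add j4
  have hw0 : w = 0 := by
    have h1 := hcomb 1 (by norm_num)
    have h2 := hcomb (-1) (by norm_num)
    have f0 : w.fst = 0 := by
      rw [Lp.eq_zero_iff_ae_eq_zero]
      filter_upwards [h1, h2] with x h1 h2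
      push_cast at h1 h2
      simp only [Pi.zero_apply]
      linear_combination (h1 + h2) / 2
    have s0 : w.snd = 0 := by
      rw [Lp.eq_zero_iff_ae_eq_zero]
      filter_upwards [h1, h2] with x h1 h2
      push_cast at h1 h2
      simp only [Pi.zero_apply]
      linear_combination (h1 - h2) / 2
    exact WithLp.ofLp_injective 2 (Prod.ext f0 s0)
  rw [hw0, add_zero] at hyw
  have hzcl : z ∈ closure (testGraph : Set E) := hyw ▸ hy
  obtain ⟨y, ⟨f, hf, hfs, h1, h2⟩, hyz⟩ := Metric.mem_closure_iff.1 hzcl (Real.sqrt η)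
    (Real.sqrt_pos.2 hη)
  refine ⟨f, hf, hfs, ?_⟩
  have hnorm : ∀ v : E, ‖v‖ ^ 2 = ∫ x, (‖v.fst x‖ ^ 2 + ‖v.snd x‖ ^ 2) := by
    intro v
    rw [WithLp.prod_norm_sq_eq_of_L2, norm_sq_Lp_two, norm_sq_Lp_two, ← integral_add]
    · exact (Lp.memLp v.fst).integrable_norm_pow (by norm_num)
    · exact (Lp.memLp v.snd).integrable_norm_pow (by norm_num)
  have hlt : ‖z - y‖ ^ 2 < η := by
    rw [dist_eq_norm] at hyz
    calc ‖z - y‖ ^ 2 < Real.sqrt η ^ 2 := pow_lt_pow_left₀ hyz (norm_nonneg _) (by norm_num)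
      _ = η := Real.sq_sqrt hη.le
  rw [hnorm] at hlt
  refine lt_of_eq_of_lt (integral_congr_ae ?_) hlt
  filter_upwards [h1, h2, Lp.coeFn_sub z.fst y.fst, Lp.coeFn_sub z.snd y.snd, hu.coeFn_toLp,
    hu'.coeFn_toLp] with x h1 h2 h3 h4 h5 h6
  have e1 : z.fst x = u x := h5
  have e2 : z.snd x = u' x := h6
  rw [WithLp.sub_fst, WithLp.sub_snd, h3, h4, Pi.sub_apply, Pi.sub_apply, h1, h2, e1, e2,
    norm_sub_rev (f x), norm_sub_rev (deriv f x)]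

/-! ### The embedding of `H¹` into `L⁴` -/

/-- The pointwise bound `|f|² ≤ ‖f‖²_{H¹}` for test functions, by integrating `(|f|²)'`. -/
theorem norm_sq_le_of_contDiff {f : ℝ → ℂ} (hf : ContDiff ℝ (⊤ : ℕ∞) f)
    (hfs : HasCompactSupport f) (x : ℝ) :
    ‖f x‖ ^ 2 ≤ ∫ y, (‖f y‖ ^ 2 + ‖deriv f y‖ ^ 2) := by
  have hf0 := hf.continuous
  have hdf : Continuous (deriv f) := hf.continuous_deriv (by simp)
  have hd : ∀ y, HasDerivAt (fun y => ‖f y‖ ^ 2) (2 * inner ℝ (f y) (deriv f y)) y := fun y =>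
    ((hf.differentiable (by simp)) y).hasDerivAt.norm_sq
  have hi : Integrable fun y => ‖f y‖ ^ 2 + ‖deriv f y‖ ^ 2 :=
    ((memLp_of_continuous_hasCompactSupport hf0 hfs).integrable_norm_pow (by norm_num)).add
      ((memLp_of_continuous_hasCompactSupport hdf hfs.deriv).integrable_norm_pow (by norm_num))
  have hle : ∀ y, 2 * inner ℝ (f y) (deriv f y) ≤ ‖f y‖ ^ 2 + ‖deriv f y‖ ^ 2 := fun y => by
    nlinarith [real_inner_le_norm (f y) (deriv f y), sq_nonneg (‖f y‖ - ‖deriv f y‖)]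
  have hc : Continuous fun y => 2 * inner ℝ (f y) (deriv f y) := by fun_prop
  have hi2 : Integrable fun y => 2 * inner ℝ (f y) (deriv f y) := by
    refine hc.integrable_of_hasCompactSupport (HasCompactSupport.intro hfs.isCompact fun y hy => ?_)
    simp [image_eq_zero_of_notMem_tsupport hy]
  have hlim : Tendsto (fun y => ‖f y‖ ^ 2) atBot (𝓝 0) := by
    have h1 : HasCompactSupport fun y => ‖f y‖ ^ 2 :=
      HasCompactSupport.intro hfs.isCompact fun y hy => by
        simp [image_eq_zero_of_notMem_tsupport hy]
    exact h1.is_zero_at_infty.mono_left atBot_le_cocompact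
  have := integral_Iic_of_hasDerivAt_of_tendsto' (a := x) (fun y _ => hd y) hi2.integrableOn hlim
  rw [sub_zero] at this
  rw [← this]
  refine (integral_mono hi2.integrableOn hi.integrableOn hle).trans ?_
  exact setIntegral_le_integral hi (ae_of_all _ fun y => by positivity)

/-- The `L⁴` bound `∫ |u|⁴ ≤ 2 ‖u‖²_{H¹} ∫ |u|²`. -/
theorem integral_norm_pow_four_le {u u' : ℝ → ℂ} (hu : MemLp u 2) (hu' : MemLp u' 2)
    (hw : HasWeakDeriv u u') :
    ∫ x, ‖u x‖ ^ 4 ≤ 2 * (∫ x, (‖u x‖ ^ 2 + ‖u' x‖ ^ 2)) * ∫ x, ‖u x‖ ^ 2 := by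
  have iu : Integrable fun x => ‖u x‖ ^ 2 := hu.integrable_norm_pow (by norm_num)
  have iu' : Integrable fun x => ‖u' x‖ ^ 2 := hu'.integrable_norm_pow (by norm_num)
  set H := ∫ x, (‖u x‖ ^ 2 + ‖u' x‖ ^ 2) with hH
  have hH0 : 0 ≤ H := integral_nonneg fun x => by positivity
  -- the essential bound `|u|² ≤ 2 H + 2 δ`: the excess `(|u| - B)₊` is at most `|f - u|`
  have hae : ∀ δ : ℝ, 0 < δ → ∀ᵐ x, ‖u x‖ ^ 2 ≤ 2 * H + 2 * δ := by
    intro δ hδ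
    set B := Real.sqrt (2 * H + 2 * δ) with hB
    have hB2 : B ^ 2 = 2 * H + 2 * δ := Real.sq_sqrt (by positivity)
    have hB0 : 0 ≤ B := Real.sqrt_nonneg _
    have hle : ∫ x, max (‖u x‖ - B) 0 ^ 2 ≤ 0 := by
      refine le_of_forall_pos_le_add fun η hη => ?_
      obtain ⟨f, hf, hfs, hfu⟩ := exists_test_approx hu hu' hw (lt_min hη hδ)
      have hf2 : MemLp f 2 := memLp_of_continuous_hasCompactSupport hf.continuous hfs
      have hdf : MemLp (deriv f) 2 := memLp_of_continuous_hasCompactSupport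
        (hf.continuous_deriv (by simp)) hfs.deriv
      have i1 : Integrable fun x => ‖f x - u x‖ ^ 2 :=
        (hf2.sub hu).integrable_norm_pow (by norm_num)
      have i2 : Integrable fun x => ‖deriv f x - u' x‖ ^ 2 :=
        (hdf.sub hu').integrable_norm_pow (by norm_num)
      have hfB : ∀ x, ‖f x‖ ≤ B := by
        intro x
        refine Real.le_sqrt_of_sq_le ((norm_sq_le_of_contDiff hf hfs x).trans ?_)
        have j1 : Integrable fun y => 2 * (‖u y‖ ^ 2 + ‖u' y‖ ^ 2) := (iu.add iu').const_mul 2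
        have j2 : Integrable fun y => 2 * (‖f y - u y‖ ^ 2 + ‖deriv f y - u' y‖ ^ 2) :=
          (i1.add i2).const_mul 2
        have : ∫ y, (‖f y‖ ^ 2 + ‖deriv f y‖ ^ 2) ≤
            ∫ y, (2 * (‖u y‖ ^ 2 + ‖u' y‖ ^ 2) +
              2 * (‖f y - u y‖ ^ 2 + ‖deriv f y - u' y‖ ^ 2)) := by
          refine integral_mono ((hf2.integrable_norm_pow (by norm_num)).add
            (hdf.integrable_norm_pow (by norm_num)))
            (j1.add j2) fun y => ?_
          have h1 : ‖f y‖ ≤ ‖u y‖ + ‖f y - u y‖ := by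
            simpa using norm_add_le (u y) (f y - u y)
          have h2 : ‖deriv f y‖ ≤ ‖u' y‖ + ‖deriv f y - u' y‖ := by
            simpa using norm_add_le (u' y) (deriv f y - u' y)
          simp only
          nlinarith [sq_nonneg (‖u y‖ - ‖f y - u y‖), sq_nonneg (‖u' y‖ - ‖deriv f y - u' y‖),
            norm_nonneg (f y), norm_nonneg (deriv f y), pow_le_pow_left₀ (norm_nonneg _) h1 2,
            pow_le_pow_left₀ (norm_nonneg _) h2 2]
        rw [integral_add j1 j2, integral_const_mul, integral_const_mul] at this
        linarith [min_le_right η δ]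
      have : ∫ x, max (‖u x‖ - B) 0 ^ 2 ≤
          ∫ x, (‖f x - u x‖ ^ 2 + ‖deriv f x - u' x‖ ^ 2) := by
        refine integral_mono_of_nonneg (ae_of_all _ fun x => by positivity) (i1.add i2)
          (ae_of_all _ fun x => ?_)
        have h1 : ‖u x‖ ≤ ‖f x‖ + ‖f x - u x‖ := by
          have := norm_sub_le (f x) (f x - u x)
          simpa using this
        have h2 : max (‖u x‖ - B) 0 ≤ ‖f x - u x‖ :=
          max_le (by linarith [hfB x]) (norm_nonneg _)
        have h3 := pow_le_pow_left₀ (le_max_right (‖u x‖ - B) 0) h2 2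
        simp only
        nlinarith [sq_nonneg ‖deriv f x - u' x‖]
      linarith [min_le_left η δ]
    have hi : Integrable fun x => max (‖u x‖ - B) 0 ^ 2 := by
      refine iu.mono' ?_ (ae_of_all _ fun x => ?_)
      · exact (((hu.1.norm.sub aestronglyMeasurable_const).sup aestronglyMeasurable_const).pow 2)
      · rw [Real.norm_eq_abs, abs_of_nonneg (by positivity)]
        exact pow_le_pow_left₀ (le_max_right _ _) (max_le (by linarith) (norm_nonneg _)) 2
    have h0 := (integral_eq_zero_iff_of_nonneg (fun x => by positivity) hi).1
      (le_antisymm hle (integral_nonneg fun x => by positivity))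
    filter_upwards [h0] with x hx
    have hx' : max (‖u x‖ - B) 0 = 0 := by simpa using hx
    have : ‖u x‖ ≤ B := by linarith [le_max_left (‖u x‖ - B) 0]
    rw [← hB2]
    exact pow_le_pow_left₀ (norm_nonneg _) this 2
  have hlim : ∀ δ : ℝ, 0 < δ → ∫ x, ‖u x‖ ^ 4 ≤ (2 * H + 2 * δ) * ∫ x, ‖u x‖ ^ 2 := by
    intro δ hδ
    rw [← integral_const_mul]
    refine integral_mono_of_nonneg (ae_of_all _ fun x => by positivity) (iu.const_mul _) ?_
    filter_upwards [hae δ hδ] with x hx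
    have : ‖u x‖ ^ 4 = ‖u x‖ ^ 2 * ‖u x‖ ^ 2 := by ring
    rw [this]
    exact mul_le_mul_of_nonneg_right hx (by positivity)
  have ht : Tendsto (fun δ : ℝ => (2 * H + 2 * δ) * ∫ x, ‖u x‖ ^ 2) (𝓝[>] 0)
      (𝓝 ((2 * H + 2 * 0) * ∫ x, ‖u x‖ ^ 2)) :=
    Tendsto.mono_left (Continuous.tendsto (by fun_prop) 0) nhdsWithin_le_nhds
  have := ge_of_tendsto ht (by filter_upwards [self_mem_nhdsWithin] with δ hδ using hlim δ hδ)
  simpa using this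

/-! ### Coercivity of the Pöschl–Teller forms -/

/-- The hyperbolic secant. -/
def sech (x : ℝ) : ℝ := (Real.cosh x)⁻¹

theorem sech_pos (x : ℝ) : 0 < sech x := inv_pos.2 (Real.cosh_pos x)

theorem sech_le_one (x : ℝ) : sech x ≤ 1 := inv_le_one_of_one_le₀ (Real.one_le_cosh x)

theorem sech_neg (x : ℝ) : sech (-x) = sech x := by simp [sech]

theorem tanh_sq_eq (x : ℝ) : Real.tanh x ^ 2 = 1 - sech x ^ 2 := by
  have := Real.cosh_sq x
  have h := (Real.cosh_pos x).ne'
  rw [Real.tanh_eq_sinh_div_cosh, sech]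
  field_simp
  linarith

theorem abs_tanh_le_one (x : ℝ) : |Real.tanh x| ≤ 1 := by
  rw [← sq_le_one_iff_abs_le_one, tanh_sq_eq]
  nlinarith [sech_pos x]

theorem hasDerivAt_sech (x : ℝ) : HasDerivAt sech (-(sech x * Real.tanh x)) x := by
  refine ((Real.hasDerivAt_cosh x).fun_inv (Real.cosh_pos x).ne').congr_deriv ?_
  rw [Real.tanh_eq_sinh_div_cosh, sech]
  have h := (Real.cosh_pos x).ne'
  field_simp

theorem hasDerivAt_tanh (x : ℝ) : HasDerivAt Real.tanh (sech x ^ 2) x := by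
  have h0 := (Real.cosh_pos x).ne'
  have e : Real.tanh = fun x => Real.sinh x / Real.cosh x :=
    funext fun x => Real.tanh_eq_sinh_div_cosh x
  rw [e]
  refine ((Real.hasDerivAt_sinh x).fun_div (Real.hasDerivAt_cosh x) h0).congr_deriv ?_
  have := Real.cosh_sq x
  rw [sech]
  field_simp
  linarith

@[fun_prop]
theorem continuous_sech : Continuous sech :=
  continuous_iff_continuousAt.2 fun x => (hasDerivAt_sech x).continuousAt

@[fun_prop]
theorem continuous_tanh : Continuous Real.tanh :=
  continuous_iff_continuousAt.2 fun x => (hasDerivAt_tanh x).continuousAt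

/-- `a` is a compactly supported `C¹` function on the line with derivative `a'`. -/
structure IsC1c (a a' : ℝ → ℝ) : Prop where
  hasDerivAt : ∀ x, HasDerivAt a (a' x) x
  continuous' : Continuous a'
  hasCompactSupport : HasCompactSupport a

namespace IsC1c

variable {a a' b b' : ℝ → ℝ}

theorem continuous (h : IsC1c a a') : Continuous a :=
  continuous_iff_continuousAt.2 fun x => (h.hasDerivAt x).continuousAt

theorem zero_off (_h : IsC1c a a') {x : ℝ} (hx : x ∉ tsupport a) : a x = 0 :=
  image_eq_zero_of_notMem_tsupport hx

theorem zero_off' (h : IsC1c a a') {x : ℝ} (hx : x ∉ tsupport a) : a' x = 0 := by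
  have : a' = deriv a := funext fun x => (h.hasDerivAt x).deriv.symm
  rw [this]
  exact image_eq_zero_of_notMem_tsupport fun h => hx (tsupport_deriv_subset (𝕜 := ℝ) h)

/-- A continuous function that vanishes wherever `a` and `a'` do is integrable. -/
theorem integrable_of (h : IsC1c a a') {f : ℝ → ℝ} (hf : Continuous f)
    (h0 : ∀ x, a x = 0 → a' x = 0 → f x = 0) : Integrable f :=
  hf.integrable_of_hasCompactSupport (HasCompactSupport.intro h.hasCompactSupport.isCompact
    fun x hx => h0 x (h.zero_off hx) (h.zero_off' hx))

theorem sub (h : IsC1c a a') (k : IsC1c b b') :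
    IsC1c (fun x => a x - b x) (fun x => a' x - b' x) :=
  ⟨fun x => (h.hasDerivAt x).sub (k.hasDerivAt x), h.continuous'.sub k.continuous',
    h.hasCompactSupport.sub k.hasCompactSupport⟩

theorem mul {w w' : ℝ → ℝ} (h : IsC1c a a') (hw : ∀ x, HasDerivAt w (w' x) x)
    (hw' : Continuous w') : IsC1c (fun x => w x * a x) (fun x => w' x * a x + w x * a' x) := by
  have hwc : Continuous w := continuous_iff_continuousAt.2 fun x => (hw x).continuousAt
  exact ⟨fun x => (hw x).mul (h.hasDerivAt x),
    (hw'.mul h.continuous).add (hwc.mul h.continuous'), h.hasCompactSupport.mul_left⟩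

theorem const_mul (h : IsC1c a a') (r : ℝ) : IsC1c (fun x => r * a x) (fun x => r * a' x) :=
  ⟨fun x => (h.hasDerivAt x).const_mul r, h.continuous'.const_mul r,
    h.hasCompactSupport.mul_left⟩

theorem sum {ι : Type*} [Fintype ι] {χ χ' : ι → ℝ → ℝ} (h : ∀ i, IsC1c (χ i) (χ' i)) :
    IsC1c (fun x => ∑ i, χ i x) (fun x => ∑ i, χ' i x) := by
  refine ⟨fun x => HasDerivAt.fun_sum fun i _ => (h i).hasDerivAt x,
    continuous_finsetSum _ fun i _ => (h i).continuous', ?_⟩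
  refine HasCompactSupport.intro
    (isCompact_iUnion (fun i => (h i).hasCompactSupport.isCompact)) fun x hx => ?_
  refine Finset.sum_eq_zero fun i _ => (h i).zero_off fun hxi => hx (mem_iUnion.2 ⟨i, hxi⟩)

/-- Functions with a common value of the integral: their difference is the derivative of `w a²`. -/
theorem integral_congr_of_deriv (h : IsC1c a a') {f g w w' : ℝ → ℝ} (hf : Continuous f)
    (hg : Continuous g) (hw : ∀ x, HasDerivAt w (w' x) x)
    (hf0 : ∀ x, a x = 0 → a' x = 0 → f x = 0) (hg0 : ∀ x, a x = 0 → a' x = 0 → g x = 0)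
    (e : ∀ x, f x - g x = w' x * a x ^ 2 + w x * (2 * a x * a' x)) :
    ∫ x, f x = ∫ x, g x := by
  have hwc : Continuous w := continuous_iff_continuousAt.2 fun x => (hw x).continuousAt
  have hac := h.continuous
  have i1 := h.integrable_of hf hf0
  have i2 := h.integrable_of hg hg0
  have hd : ∀ x, HasDerivAt (fun x => w x * a x ^ 2) (f x - g x) x := by
    intro x
    rw [e x]
    exact ((hw x).fun_mul ((h.hasDerivAt x).fun_pow 2)).congr_deriv (by simp)
  have := integral_eq_zero_of_hasDerivAt_of_integrable hd (i1.sub i2)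
    (h.integrable_of (by fun_prop) fun x h0 _ => by simp [h0])
  rw [integral_sub i1 i2] at this
  linarith

/-- Solving `-g' + (w'/w) g = a` by `g = -w ∫ a / w`: the solution has compact support as soon as
`a / w` has integral zero. -/
theorem exists_solution (h : IsC1c a a') {w w' p : ℝ → ℝ} (hw : ∀ x, HasDerivAt w (w' x) x)
    (hw' : Continuous w') (hw0 : ∀ x, w x ≠ 0) (hp : ∀ x, w' x = p x * w x)
    (h0 : ∫ x, a x * (w x)⁻¹ = 0) :
    ∃ g g' : ℝ → ℝ, IsC1c g g' ∧ ∀ x, a x = -g' x + p x * g x := by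
  have hwc : Continuous w := continuous_iff_continuousAt.2 fun x => (hw x).continuousAt
  have hac := h.continuous
  have hc : Continuous fun x => a x * (w x)⁻¹ := hac.mul (hwc.inv₀ hw0)
  obtain ⟨G, hG, hGs⟩ := exists_primitive_hasCompactSupport hc h.hasCompactSupport.mul_right h0
  have hG1 : IsC1c G fun x => a x * (w x)⁻¹ := ⟨hG, hc, hGs⟩
  refine ⟨_, _, (hG1.mul hw hw').const_mul (-1), fun x => ?_⟩
  have := hw0 x
  simp only [hp x]
  field_simp
  ring

end IsC1c

/-- `-∂² + 1 = A A*` with `A = ∂ + tanh`. -/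
theorem integral_sq_adjoint_one {h h' : ℝ → ℝ} (H : IsC1c h h') :
    ∫ x, (-h' x + Real.tanh x * h x) ^ 2 = ∫ x, (h' x ^ 2 + h x ^ 2) := by
  have h1 := H.continuous
  have h2 := H.continuous'
  refine H.integral_congr_of_deriv (w := fun x => -Real.tanh x) (by fun_prop) (by fun_prop)
    (fun x => (hasDerivAt_tanh x).neg) (fun x a b => by simp [a, b]) (fun x a b => by simp [a, b])
    fun x => ?_
  linear_combination h x ^ 2 * tanh_sq_eq x

/-- `-∂² + 1 - 2 sech² = A* A` with `A = ∂ + tanh`. -/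
theorem integral_sq_one {g g' : ℝ → ℝ} (H : IsC1c g g') :
    ∫ x, (g' x + Real.tanh x * g x) ^ 2 =
      ∫ x, (g' x ^ 2 + g x ^ 2 - 2 * sech x ^ 2 * g x ^ 2) := by
  have h1 := H.continuous
  have h2 := H.continuous'
  refine H.integral_congr_of_deriv (w := fun x => Real.tanh x) (by fun_prop) (by fun_prop)
    (fun x => (hasDerivAt_tanh x)) (fun x a b => by simp [a, b]) (fun x a b => by simp [a, b])
    fun x => ?_
  linear_combination g x ^ 2 * tanh_sq_eq x

/-- The intertwining `B B* = A* A + 3` of `A = ∂ + tanh` and `B = ∂ + 2 tanh`. -/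
theorem integral_sq_adjoint_two {g g' : ℝ → ℝ} (H : IsC1c g g') :
    ∫ x, (-g' x + 2 * Real.tanh x * g x) ^ 2 =
      (∫ x, (g' x + Real.tanh x * g x) ^ 2) + 3 * ∫ x, g x ^ 2 := by
  have h1 := H.continuous
  have h2 := H.continuous'
  rw [← integral_const_mul, ← integral_add (H.integrable_of (by fun_prop) fun x a b => by simp [a, b])
    (H.integrable_of (by fun_prop) fun x a b => by simp [a])]
  refine H.integral_congr_of_deriv (w := fun x => -3 * Real.tanh x) (by fun_prop) (by fun_prop)
    (fun x => (hasDerivAt_tanh x).const_mul (-3)) (fun x a b => by simp [a, b])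
    (fun x a b => by simp [a, b]) fun x => ?_
  linear_combination 3 * g x ^ 2 * tanh_sq_eq x

/-- `-∂² + 1 - 6 sech² = B* B - 3` with `B = ∂ + 2 tanh`. -/
theorem integral_sq_two {a a' : ℝ → ℝ} (H : IsC1c a a') :
    (∫ x, (a' x + 2 * Real.tanh x * a x) ^ 2) =
      (∫ x, (a' x ^ 2 + a x ^ 2 - 6 * sech x ^ 2 * a x ^ 2)) + 3 * ∫ x, a x ^ 2 := by
  have h1 := H.continuous
  have h2 := H.continuous'
  rw [← integral_const_mul, ← integral_add (H.integrable_of (by fun_prop) fun x a b => by simp [a, b])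
    (H.integrable_of (by fun_prop) fun x a b => by simp [a])]
  refine H.integral_congr_of_deriv (w := fun x => 2 * Real.tanh x) (by fun_prop) (by fun_prop)
    (fun x => (hasDerivAt_tanh x).const_mul 2) (fun x a b => by simp [a, b])
    (fun x a b => by simp [a, b]) fun x => ?_
  linear_combination 4 * a x ^ 2 * tanh_sq_eq x

/-- Functions orthogonal to the ground state `sech` of `-∂² + 1 - 2 sech²`. -/
theorem integral_sq_le_of_orthogonal_one {g g' : ℝ → ℝ} (H : IsC1c g g')
    (h0 : ∫ x, g x * sech x = 0) :
    ∫ x, g x ^ 2 ≤ ∫ x, (g' x + Real.tanh x * g x) ^ 2 := by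
  have hg1 := H.continuous
  have hg2 := H.continuous'
  obtain ⟨h, h', Hh, e⟩ := H.exists_solution (w := Real.cosh) (p := Real.tanh)
    (fun x => Real.hasDerivAt_cosh x) Real.continuous_sinh (fun x => (Real.cosh_pos x).ne')
    (fun x => by rw [Real.tanh_eq_sinh_div_cosh, div_mul_cancel₀ _ (Real.cosh_pos x).ne']) h0
  have hh1 := Hh.continuous
  have hh2 := Hh.continuous'
  have e1 := integral_sq_adjoint_one Hh
  simp only [← e] at e1
  -- `∫ g² = ∫ g A* h = ∫ (A g) h`
  have e2 : ∫ x, ((g' x + Real.tanh x * g x) * h x - g x ^ 2) = 0 := by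
    refine integral_eq_zero_of_hasDerivAt_of_integrable (f := fun x => g x * h x) (fun x => ?_)
      (H.integrable_of (by fun_prop) fun x a b => by simp [a, b])
      (H.integrable_of (by fun_prop) fun x a b => by simp [a])
    refine ((H.hasDerivAt x).mul (Hh.hasDerivAt x)).congr_deriv ?_
    linear_combination g x * e x
  have i1 : Integrable fun x => (g' x + Real.tanh x * g x) * h x :=
    H.integrable_of (by fun_prop) fun x a b => by simp [a, b]
  have i2 : Integrable fun x => g x ^ 2 := H.integrable_of (by fun_prop) fun x a b => by simp [a]
  have i3 : Integrable fun x => (g' x + Real.tanh x * g x) ^ 2 :=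
    H.integrable_of (by fun_prop) fun x a b => by simp [a, b]
  have i4 : Integrable fun x => h' x ^ 2 + h x ^ 2 :=
    Hh.integrable_of (by fun_prop) fun x a b => by simp [a, b]
  rw [integral_sub i1 i2] at e2
  have i5 : Integrable fun x => 2 * ((g' x + Real.tanh x * g x) * h x) := i1.const_mul 2
  have e3 : ∫ x, 2 * ((g' x + Real.tanh x * g x) * h x) ≤
      ∫ x, ((g' x + Real.tanh x * g x) ^ 2 + (h' x ^ 2 + h x ^ 2)) :=
    integral_mono i5 (i3.add i4) fun x => by
      simp only
      nlinarith [sq_nonneg (g' x + Real.tanh x * g x - h x), sq_nonneg (h' x)]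
  rw [integral_const_mul, integral_add i3 i4] at e3
  linarith

/-- Functions orthogonal to `sech²` and `sech tanh`, the eigenfunctions of `-∂² + 1 - 6 sech²`
for `-3` and `0`. -/
theorem integral_sq_le_of_orthogonal_two {a a' : ℝ → ℝ} (H : IsC1c a a')
    (h0 : ∫ x, a x * sech x ^ 2 = 0) (h1 : ∫ x, a x * (sech x * Real.tanh x) = 0) :
    4 * ∫ x, a x ^ 2 ≤ ∫ x, (a' x + 2 * Real.tanh x * a x) ^ 2 := by
  have ha1 := H.continuous
  have ha2 := H.continuous'
  obtain ⟨g, g', Hg, e⟩ := H.exists_solution (w := fun x => Real.cosh x ^ 2)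
    (p := fun x => 2 * Real.tanh x) (w' := fun x => 2 * Real.cosh x * Real.sinh x)
    (fun x => ((Real.hasDerivAt_cosh x).fun_pow 2).congr_deriv (by simp))
    (by fun_prop) (fun x => pow_ne_zero _ (Real.cosh_pos x).ne')
    (fun x => by
      have := (Real.cosh_pos x).ne'
      rw [Real.tanh_eq_sinh_div_cosh]; field_simp)
    (by simpa [sech] using h0)
  have hg1 := Hg.continuous
  have hg2 := Hg.continuous'
  -- `g` is orthogonal to `sech = B (sech tanh)`
  have hg0 : ∫ x, g x * sech x = 0 := by
    have e2 : ∫ x, (g x * sech x - a x * (sech x * Real.tanh x)) = 0 := by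
      refine integral_eq_zero_of_hasDerivAt_of_integrable
        (f := fun x => g x * (sech x * Real.tanh x)) (fun x => ?_) ?_
        (Hg.integrable_of (by fun_prop) fun x a b => by simp [a])
      · refine ((Hg.hasDerivAt x).fun_mul ((hasDerivAt_sech x).fun_mul (hasDerivAt_tanh x))).congr_deriv ?_
        linear_combination sech x * Real.tanh x * e x + g x * sech x * tanh_sq_eq x
      · exact (Hg.integrable_of (by fun_prop) fun x a b => by simp [a]).sub
          (H.integrable_of (by fun_prop) fun x a b => by simp [a])
    rw [integral_sub (Hg.integrable_of (by fun_prop) fun x a b => by simp [a])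
      (H.integrable_of (by fun_prop) fun x a b => by simp [a]), h1] at e2
    linarith
  have k1 := integral_sq_le_of_orthogonal_one Hg hg0
  have k2 := integral_sq_adjoint_two Hg
  simp only [← e] at k2
  have e2 : ∫ x, ((a' x + 2 * Real.tanh x * a x) * g x - a x ^ 2) = 0 := by
    refine integral_eq_zero_of_hasDerivAt_of_integrable (f := fun x => a x * g x) (fun x => ?_)
      (H.integrable_of (by fun_prop) fun x a b => by simp [a, b])
      (H.integrable_of (by fun_prop) fun x a b => by simp [a])
    refine ((H.hasDerivAt x).mul (Hg.hasDerivAt x)).congr_deriv ?_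
    linear_combination a x * e x
  have i1 : Integrable fun x => (a' x + 2 * Real.tanh x * a x) * g x :=
    H.integrable_of (by fun_prop) fun x a b => by simp [a, b]
  have i2 : Integrable fun x => a x ^ 2 := H.integrable_of (by fun_prop) fun x a b => by simp [a]
  have i3 : Integrable fun x => (a' x + 2 * Real.tanh x * a x) ^ 2 :=
    H.integrable_of (by fun_prop) fun x a b => by simp [a, b]
  have i4 : Integrable fun x => 16 * g x ^ 2 :=
    Hg.integrable_of (by fun_prop) fun x a b => by simp [a]
  rw [integral_sub i1 i2] at e2
  have e3 : ∫ x, 8 * ((a' x + 2 * Real.tanh x * a x) * g x) ≤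
      ∫ x, ((a' x + 2 * Real.tanh x * a x) ^ 2 + 16 * g x ^ 2) :=
    integral_mono (i1.const_mul 8) (i3.add i4) fun x => by
      simp only
      nlinarith [sq_nonneg (a' x + 2 * Real.tanh x * a x - 4 * g x)]
  rw [integral_const_mul, integral_add i3 i4, integral_const_mul] at e3
  linarith

theorem coercive_one_of_orthogonal {b b' : ℝ → ℝ} (H : IsC1c b b')
    (h0 : ∫ x, b x * sech x = 0) :
    1 / 7 * ∫ x, (b' x ^ 2 + b x ^ 2) ≤ ∫ x, (b' x ^ 2 + b x ^ 2 - 2 * sech x ^ 2 * b x ^ 2) := by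
  have h1 := H.continuous
  have h2 := H.continuous'
  have k := integral_sq_le_of_orthogonal_one H h0
  rw [integral_sq_one H] at k
  have i1 : Integrable fun x => b' x ^ 2 + b x ^ 2 - 2 * sech x ^ 2 * b x ^ 2 :=
    H.integrable_of (by fun_prop) fun x a b => by simp [a, b]
  have i2 : Integrable fun x => b x ^ 2 := H.integrable_of (by fun_prop) fun x a b => by simp [a]
  have i3 : Integrable fun x => b' x ^ 2 + b x ^ 2 :=
    H.integrable_of (by fun_prop) fun x a b => by simp [a, b]
  have e3 : ∫ x, (b' x ^ 2 + b x ^ 2) ≤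
      ∫ x, ((b' x ^ 2 + b x ^ 2 - 2 * sech x ^ 2 * b x ^ 2) + 2 * b x ^ 2) :=
    integral_mono i3 (i1.add (i2.const_mul 2)) fun x => by
      simp only
      have : sech x ^ 2 ≤ 1 := pow_le_one₀ (sech_pos x).le (sech_le_one x)
      nlinarith [sq_nonneg (b x)]
  rw [integral_add i1 (i2.const_mul 2), integral_const_mul] at e3
  have : 0 ≤ ∫ x, b x ^ 2 := integral_nonneg fun x => by positivity
  linarith

theorem coercive_two_of_orthogonal {a a' : ℝ → ℝ} (H : IsC1c a a')
    (h0 : ∫ x, a x * sech x ^ 2 = 0) (h1 : ∫ x, a x * (sech x * Real.tanh x) = 0) :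
    1 / 7 * ∫ x, (a' x ^ 2 + a x ^ 2) ≤ ∫ x, (a' x ^ 2 + a x ^ 2 - 6 * sech x ^ 2 * a x ^ 2) := by
  have h1' := H.continuous
  have h2 := H.continuous'
  have k := integral_sq_le_of_orthogonal_two H h0 h1
  rw [integral_sq_two H] at k
  have i1 : Integrable fun x => a' x ^ 2 + a x ^ 2 - 6 * sech x ^ 2 * a x ^ 2 :=
    H.integrable_of (by fun_prop) fun x a b => by simp [a, b]
  have i2 : Integrable fun x => a x ^ 2 := H.integrable_of (by fun_prop) fun x a b => by simp [a]
  have i3 : Integrable fun x => a' x ^ 2 + a x ^ 2 :=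
    H.integrable_of (by fun_prop) fun x a b => by simp [a, b]
  have e3 : ∫ x, (a' x ^ 2 + a x ^ 2) ≤
      ∫ x, ((a' x ^ 2 + a x ^ 2 - 6 * sech x ^ 2 * a x ^ 2) + 6 * a x ^ 2) :=
    integral_mono i3 (i1.add (i2.const_mul 6)) fun x => by
      simp only
      have : sech x ^ 2 ≤ 1 := pow_le_one₀ (sech_pos x).le (sech_le_one x)
      nlinarith [sq_nonneg (a x)]
  rw [integral_add i1 (i2.const_mul 6), integral_const_mul] at e3
  linarith

/-- A form `∫ a'² + a² - m a²` that is coercive on the orthogonal complement of finitely many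
weights `S i` is coercive on the whole space after adding a multiple of the squares of
`∫ a S i`: subtract from `a` a combination of compactly supported functions dual to the `S i`. -/
theorem coercive_of_coercive_orthogonal {ι : Type*} [Fintype ι] [DecidableEq ι] {m : ℝ → ℝ}
    (hm : Continuous m) (hm6 : ∀ x, |m x| ≤ 6) {S : ι → ℝ → ℝ} (hS : ∀ i, Continuous (S i))
    {χ χ' : ι → ℝ → ℝ} (hχ : ∀ i, IsC1c (χ i) (χ' i))
    (hdual : ∀ i j, ∫ x, χ i x * S j x = if i = j then 1 else 0)
    (hco : ∀ a a' : ℝ → ℝ, IsC1c a a' → (∀ i, ∫ x, a x * S i x = 0) →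
      1 / 7 * ∫ x, (a' x ^ 2 + a x ^ 2) ≤ ∫ x, (a' x ^ 2 + a x ^ 2 - m x * a x ^ 2)) :
    ∃ C, 0 ≤ C ∧ ∀ a a' : ℝ → ℝ, IsC1c a a' →
      1 / 28 * ∫ x, (a' x ^ 2 + a x ^ 2) ≤
        (∫ x, (a' x ^ 2 + a x ^ 2 - m x * a x ^ 2)) + C * ∑ i, (∫ x, a x * S i x) ^ 2 := by
  set M := ∑ i, ∫ x, (χ' i x ^ 2 + χ i x ^ 2) with hM
  have hM0 : 0 ≤ M := Finset.sum_nonneg fun i _ => integral_nonneg fun x => by positivity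
  refine ⟨694 * (Fintype.card ι * M), by positivity, fun a a' ha => ?_⟩
  set l : ι → ℝ := fun i => ∫ x, a x * S i x with hl
  have hr : IsC1c (fun x => ∑ i, l i * χ i x) (fun x => ∑ i, l i * χ' i x) :=
    IsC1c.sum fun i => (hχ i).const_mul (l i)
  set r : ℝ → ℝ := fun x => ∑ i, l i * χ i x with hrdef
  set r' : ℝ → ℝ := fun x => ∑ i, l i * χ' i x with hrdef'
  have hd := ha.sub hr
  have ha1 := ha.continuous
  have ha2 := ha.continuous'
  have hr1 := hr.continuous
  have hr2 := hr.continuous'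
  have hrS : ∀ j, ∫ x, r x * S j x = l j := by
    intro j
    simp only [hrdef, Finset.sum_mul]
    rw [integral_finsetSum]
    · simp only [mul_assoc, integral_const_mul, hdual]
      simp
    · intro i _
      have := (hχ i).continuous
      have := hS j
      exact (hχ i).integrable_of (by fun_prop) fun x a b => by simp [a]
  have key := hco _ _ hd fun j => by
    have := hS j
    simp only [sub_mul]
    rw [integral_sub (ha.integrable_of (by fun_prop) fun x a b => by simp [a])
      (hr.integrable_of (by fun_prop) fun x a b => by simp [a]), hrS j]
    exact sub_self _
  have hrle : ∫ x, (r' x ^ 2 + r x ^ 2) ≤ Fintype.card ι * M * ∑ i, l i ^ 2 := by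
    have hpt : ∀ x, r' x ^ 2 + r x ^ 2 ≤
        Fintype.card ι * ∑ i, l i ^ 2 * (χ' i x ^ 2 + χ i x ^ 2) := by
      intro x
      have h1 := sq_sum_le_card_mul_sum_sq (s := Finset.univ) (f := fun i => l i * χ i x)
      have h2 := sq_sum_le_card_mul_sum_sq (s := Finset.univ) (f := fun i => l i * χ' i x)
      rw [Finset.card_univ] at h1 h2
      have : ∑ i, l i ^ 2 * (χ' i x ^ 2 + χ i x ^ 2) =
          ∑ i, (l i * χ' i x) ^ 2 + ∑ i, (l i * χ i x) ^ 2 := by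
        rw [← Finset.sum_add_distrib]
        exact Finset.sum_congr rfl fun i _ => by ring
      rw [this, mul_add]
      exact add_le_add h2 h1
    have hi : ∀ i, Integrable fun x => χ' i x ^ 2 + χ i x ^ 2 := fun i => by
      have h1 := (hχ i).continuous
      have h2 := (hχ i).continuous'
      exact (hχ i).integrable_of (by fun_prop) fun x a b => by simp [a, b]
    refine (integral_mono (hr.integrable_of (by fun_prop) fun x a b => by simp [a, b])
      ((integrable_finsetSum _ fun i _ => (hi i).const_mul (l i ^ 2)).const_mul _) hpt).trans ?_
    rw [integral_const_mul, integral_finsetSum _ fun i _ => (hi i).const_mul (l i ^ 2)]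
    simp only [integral_const_mul]
    rw [mul_assoc]
    refine mul_le_mul_of_nonneg_left ?_ (by positivity)
    rw [mul_comm, Finset.sum_mul]
    refine Finset.sum_le_sum fun i _ => mul_le_mul_of_nonneg_left ?_ (sq_nonneg _)
    exact Finset.single_le_sum (f := fun i => ∫ x, (χ' i x ^ 2 + χ i x ^ 2))
      (fun i _ => integral_nonneg fun x => by positivity) (Finset.mem_univ i)
  have iq : ∀ {b b' : ℝ → ℝ}, IsC1c b b' → Integrable fun x => b' x ^ 2 + b x ^ 2 := by
    intro b b' hb
    have h1 := hb.continuous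
    have h2 := hb.continuous'
    exact hb.integrable_of (by fun_prop) fun x a b => by simp [a, b]
  have im : ∀ {b b' : ℝ → ℝ}, IsC1c b b' →
      Integrable fun x => b' x ^ 2 + b x ^ 2 - m x * b x ^ 2 := by
    intro b b' hb
    have h1 := hb.continuous
    have h2 := hb.continuous'
    exact hb.integrable_of (by fun_prop) fun x a b => by simp [a, b]
  have A1 : (∫ x, ((a' x - r' x) ^ 2 + (a x - r x) ^ 2 - m x * (a x - r x) ^ 2)) ≤
      ∫ x, ((a' x ^ 2 + a x ^ 2 - m x * a x ^ 2) +
        (1 / 14 * ((a' x - r' x) ^ 2 + (a x - r x) ^ 2) + 693 * (r' x ^ 2 + r x ^ 2))) := by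
    refine integral_mono (im hd) ((im ha).add (((iq hd).const_mul _).add ((iq hr).const_mul _)))
      fun x => ?_
    simp only
    obtain ⟨h1, h2⟩ := abs_le.1 (hm6 x)
    have e1 : |1 - m x| ≤ 7 := abs_le.2 ⟨by linarith, by linarith⟩
    -- `a = d + r`, and the mixed term is absorbed by Young's inequality
    have e2 : (1 - m x) * ((a x - r x) ^ 2 - a x ^ 2) ≤
        1 / 14 * (a x - r x) ^ 2 + 693 * r x ^ 2 := by
      have : (1 - m x) * ((a x - r x) ^ 2 - a x ^ 2) ≤
          7 * |(a x - r x) ^ 2 - a x ^ 2| := by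
        refine (le_abs_self _).trans ?_
        rw [abs_mul]
        exact mul_le_mul_of_nonneg_right e1 (abs_nonneg _)
      refine this.trans ?_
      have : |(a x - r x) ^ 2 - a x ^ 2| ≤ 1 / 98 * (a x - r x) ^ 2 + 99 * r x ^ 2 := by
        rw [abs_le]
        constructor <;>
          nlinarith [sq_nonneg ((a x - r x) - 98 * r x), sq_nonneg ((a x - r x) + 98 * r x)]
      linarith
    nlinarith [sq_nonneg ((a' x - r' x) + 14 * r' x), sq_nonneg (r' x)]
  have A2 : ∫ x, (a' x ^ 2 + a x ^ 2) ≤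
      ∫ x, (2 * ((a' x - r' x) ^ 2 + (a x - r x) ^ 2) + 2 * (r' x ^ 2 + r x ^ 2)) :=
    integral_mono (iq ha) (((iq hd).const_mul _).add ((iq hr).const_mul _)) fun x => by
      simp only
      nlinarith [sq_nonneg (a' x - 2 * r' x), sq_nonneg (a x - 2 * r x)]
  have i1 := (iq hd).const_mul (1 / 14)
  have i2 := (iq hr).const_mul 693
  have i12 : Integrable fun x => 1 / 14 * ((a' x - r' x) ^ 2 + (a x - r x) ^ 2) +
    693 * (r' x ^ 2 + r x ^ 2) := i1.add i2
  rw [integral_add (im ha) i12, integral_add i1 i2, integral_const_mul,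
    integral_const_mul] at A1
  rw [integral_add ((iq hd).const_mul _) ((iq hr).const_mul _), integral_const_mul,
    integral_const_mul] at A2
  have : 0 ≤ ∫ x, (r' x ^ 2 + r x ^ 2) := integral_nonneg fun x => by positivity
  nlinarith

theorem integral_eq_zero_of_odd {f : ℝ → ℝ} (hf : ∀ x, f (-x) = -f x) : ∫ x, f x = 0 := by
  have h := integral_neg_eq_self f volume
  simp only [hf, integral_neg] at h
  linarith

/-- An even nonnegative cutoff with derivative, equal to `1` on `[-1, 1]`. -/
theorem exists_even_bump : ∃ b b' : ℝ → ℝ, IsC1c b b' ∧ (∀ x, b (-x) = b x) ∧ (∀ x, 0 ≤ b x) ∧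
    (∀ x ∈ Icc (-1 : ℝ) 1, b x = 1) := by
  let b : ContDiffBump (0 : ℝ) := ⟨1, 2, one_pos, one_lt_two⟩
  have hb : ContDiff ℝ 1 b := b.contDiff
  refine ⟨b, deriv b, ⟨fun x => ((hb.differentiable (by simp)) x).hasDerivAt,
    hb.continuous_deriv (by simp), b.hasCompactSupport⟩, b.neg, fun x => b.nonneg, fun x hx => ?_⟩
  refine b.one_of_mem_closedBall ?_
  rw [Real.closedBall_eq_Icc]
  simpa [b] using hx

theorem coercive_one : ∃ C, 0 ≤ C ∧ ∀ b b' : ℝ → ℝ, IsC1c b b' →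
    1 / 28 * ∫ x, (b' x ^ 2 + b x ^ 2) ≤
      (∫ x, (b' x ^ 2 + b x ^ 2 - 2 * sech x ^ 2 * b x ^ 2)) + C * (∫ x, b x * sech x) ^ 2 := by
  obtain ⟨w, w', hw, -, hw0, hw1⟩ := exists_even_bump
  have hwc := hw.continuous
  have hpos : 0 < ∫ x, sech x * w x * sech x := by
    refine Continuous.integral_pos_of_hasCompactSupport_nonneg_nonzero (x := 0) (by fun_prop)
      (HasCompactSupport.mul_right hw.hasCompactSupport.mul_left) (fun x => ?_) ?_
    · have := (sech_pos x).le
      have := hw0 x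
      positivity
    · have := (sech_pos 0).ne'
      rw [hw1 0 (by norm_num)]
      positivity
  obtain ⟨C, hC, h⟩ := coercive_of_coercive_orthogonal (ι := Unit)
    (m := fun x => 2 * sech x ^ 2) (S := fun _ => sech) (by fun_prop)
    (fun x => by
      have : sech x ^ 2 ≤ 1 := pow_le_one₀ (sech_pos x).le (sech_le_one x)
      rw [abs_of_nonneg (by positivity)]; linarith)
    (fun _ => continuous_sech)
    (fun _ => (hw.mul hasDerivAt_sech (by fun_prop)).const_mul (∫ x, sech x * w x * sech x)⁻¹)
    (fun i j => by
      simp only [mul_assoc (∫ x, sech x * w x * sech x)⁻¹, integral_const_mul]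
      rw [inv_mul_cancel₀ hpos.ne']
      simp)
    (fun a a' ha h0 => coercive_one_of_orthogonal ha (h0 ()))
  refine ⟨C, hC, fun b b' hb => ?_⟩
  simpa using h b b' hb

theorem coercive_two : ∃ C, 0 ≤ C ∧ ∀ a a' : ℝ → ℝ, IsC1c a a' →
    1 / 28 * ∫ x, (a' x ^ 2 + a x ^ 2) ≤
      (∫ x, (a' x ^ 2 + a x ^ 2 - 6 * sech x ^ 2 * a x ^ 2)) +
        C * ((∫ x, a x * sech x ^ 2) ^ 2 + (∫ x, a x * (sech x * Real.tanh x)) ^ 2) := by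
  obtain ⟨w, w', hw, hwe, hw0, hw1⟩ := exists_even_bump
  have hwc := hw.continuous
  have hodd : ∫ x, sech x ^ 2 * w x * (sech x * Real.tanh x) = 0 :=
    integral_eq_zero_of_odd fun x => by rw [sech_neg, hwe, Real.tanh_neg]; ring
  have hpos1 : 0 < ∫ x, sech x ^ 2 * w x * sech x ^ 2 := by
    refine Continuous.integral_pos_of_hasCompactSupport_nonneg_nonzero (x := 0) (by fun_prop)
      (HasCompactSupport.mul_right hw.hasCompactSupport.mul_left) (fun x => ?_) ?_
    · have := (sech_pos x).le
      have := hw0 x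
      positivity
    · have := (sech_pos 0).ne'
      rw [hw1 0 (by norm_num)]
      positivity
  have hpos2 : 0 < ∫ x, sech x * Real.tanh x * w x * (sech x * Real.tanh x) := by
    refine Continuous.integral_pos_of_hasCompactSupport_nonneg_nonzero (x := 1) (by fun_prop)
      (HasCompactSupport.mul_right hw.hasCompactSupport.mul_left) (fun x => ?_) ?_
    · have e : sech x * Real.tanh x * w x * (sech x * Real.tanh x) =
        w x * (sech x * Real.tanh x) ^ 2 := by ring
      rw [e]
      exact mul_nonneg (hw0 x) (sq_nonneg _)
    · have := (sech_pos 1).ne'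
      have : Real.tanh 1 ≠ 0 := by
        rw [Real.tanh_eq_sinh_div_cosh]
        exact div_ne_zero (Real.sinh_pos_iff.2 one_pos).ne' (Real.cosh_pos 1).ne'
      rw [hw1 1 (by norm_num)]
      positivity
  set p := ∫ x, sech x ^ 2 * w x * sech x ^ 2 with hp
  set q := ∫ x, sech x * Real.tanh x * w x * (sech x * Real.tanh x) with hq
  have d1 : IsC1c (fun x => p⁻¹ * (sech x ^ 2 * w x)) _ :=
    (hw.mul (fun x => (hasDerivAt_sech x).fun_pow 2) (by fun_prop)).const_mul p⁻¹
  have d2 : IsC1c (fun x => q⁻¹ * (sech x * Real.tanh x * w x)) _ :=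
    (hw.mul (fun x => (hasDerivAt_sech x).fun_mul (hasDerivAt_tanh x)) (by fun_prop)).const_mul q⁻¹
  have i11 : ∫ x, p⁻¹ * (sech x ^ 2 * w x) * sech x ^ 2 = 1 := by
    simp only [mul_assoc p⁻¹, integral_const_mul]
    exact inv_mul_cancel₀ hpos1.ne'
  have i12 : ∫ x, p⁻¹ * (sech x ^ 2 * w x) * (sech x * Real.tanh x) = 0 := by
    simp only [mul_assoc p⁻¹, integral_const_mul, hodd, mul_zero]
  have i21 : ∫ x, q⁻¹ * (sech x * Real.tanh x * w x) * sech x ^ 2 = 0 := by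
    simp only [mul_assoc q⁻¹, integral_const_mul]
    rw [show ∫ x, sech x * Real.tanh x * w x * sech x ^ 2 = 0 from by
      rw [← hodd]; exact integral_congr_ae (ae_of_all _ fun x => by ring)]
    simp
  have i22 : ∫ x, q⁻¹ * (sech x * Real.tanh x * w x) * (sech x * Real.tanh x) = 1 := by
    simp only [mul_assoc q⁻¹, integral_const_mul]
    exact inv_mul_cancel₀ hpos2.ne'
  obtain ⟨C, hC, h⟩ := coercive_of_coercive_orthogonal (ι := Bool)
    (m := fun x => 6 * sech x ^ 2)
    (S := fun i => Bool.rec (fun x => sech x * Real.tanh x) (fun x => sech x ^ 2) i)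
    (χ := fun i => Bool.rec _ _ i) (χ' := fun i => Bool.rec _ _ i) (by fun_prop)
    (fun x => by
      have : sech x ^ 2 ≤ 1 := pow_le_one₀ (sech_pos x).le (sech_le_one x)
      rw [abs_of_nonneg (by positivity)]; linarith)
    (fun i => by cases i <;> fun_prop)
    (fun i => by
      cases i
      · exact d2
      · exact d1)
    (fun i j => by
      cases i <;> cases j
      · exact i22
      · exact i21
      · exact i12
      · exact i11)
    (fun a a' ha h0 => coercive_two_of_orthogonal ha (h0 true) (h0 false))
  refine ⟨C, hC, fun a a' ha => ?_⟩
  simpa using h a a' ha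

/-! ### The negative eigenfunction -/

theorem sech_le_inv (x : ℝ) : sech x ≤ 2 * (1 + x ^ 2)⁻¹ := by
  have h2 : 1 + x ^ 2 / 2 ≤ Real.cosh x := by
    have h1 := Real.cosh_sq (x / 2)
    have h3 : Real.cosh x = 1 + 2 * Real.sinh (x / 2) ^ 2 := by
      have := Real.cosh_two_mul (x / 2)
      rw [mul_div_cancel₀ x two_ne_zero] at this
      linarith
    have h4 : (x / 2) ^ 2 ≤ Real.sinh (x / 2) ^ 2 := by
      rw [sq_le_sq]
      rcases le_total 0 (x / 2) with h | h
      · rw [abs_of_nonneg h, abs_of_nonneg (Real.sinh_nonneg_iff.2 h)]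
        exact Real.self_le_sinh_iff.2 h
      · rw [abs_of_nonpos h, abs_of_nonpos (Real.sinh_nonpos_iff.2 h)]
        exact neg_le_neg (Real.sinh_le_self_iff.2 h)
    nlinarith
  rw [sech, ← div_eq_mul_inv, inv_eq_one_div,
    div_le_div_iff₀ (Real.cosh_pos x) (by positivity)]
  nlinarith [sq_nonneg x]

theorem integrable_sech : Integrable sech :=
  (integrable_inv_one_add_sq.const_mul 2).mono' continuous_sech.aestronglyMeasurable
    (ae_of_all _ fun x => by
      rw [Real.norm_eq_abs, abs_of_pos (sech_pos x)]; exact sech_le_inv x)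

theorem memLp_of_abs_le_sech {f : ℝ → ℝ} (hf : Continuous f) {M : ℝ}
    (h : ∀ x, |f x| ≤ M * sech x) : MemLp f 2 := by
  rw [memLp_two_iff_integrable_sq hf.aestronglyMeasurable]
  refine (integrable_sech.const_mul (M ^ 2)).mono' (by fun_prop) (ae_of_all _ fun x => ?_)
  rw [Real.norm_eq_abs, abs_of_nonneg (sq_nonneg _), ← sq_abs]
  calc |f x| ^ 2 ≤ (M * sech x) ^ 2 := pow_le_pow_left₀ (abs_nonneg _) (h x) 2
    _ = M ^ 2 * sech x * sech x := by ring
    _ ≤ M ^ 2 * sech x * 1 := by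
      have := sech_pos x
      exact mul_le_mul_of_nonneg_left (sech_le_one x) (by positivity)
    _ = M ^ 2 * sech x := mul_one _

theorem abs_sech_sq_le (x : ℝ) : |sech x ^ 2| ≤ 1 * sech x := by
  rw [abs_of_nonneg (by positivity)]
  nlinarith [sech_pos x, sech_le_one x]

theorem abs_sech_mul_tanh_le (x : ℝ) : |sech x * Real.tanh x| ≤ 1 * sech x := by
  rw [abs_mul, abs_of_pos (sech_pos x), mul_comm]
  exact mul_le_mul_of_nonneg_right (abs_tanh_le_one x) (sech_pos x).le

/-- Cutting off at a scale tending to infinity does not change the limit of an integral. -/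
theorem tendsto_integral_cutoff {w h : ℝ → ℝ} (hw : Continuous w) {M : ℝ}
    (hM : ∀ x, |w x| ≤ M) (h0 : w 0 = 1) (hh : Integrable h) {r : ℕ → ℝ}
    (hr : Tendsto r atTop (𝓝 0)) :
    Tendsto (fun n => ∫ x, w (r n * x) * h x) atTop (𝓝 (∫ x, h x)) := by
  refine tendsto_integral_of_dominated_convergence (fun x => M * |h x|) (fun n => ?_)
    (hh.abs.const_mul M) (fun n => ae_of_all _ fun x => ?_) (ae_of_all _ fun x => ?_)
  · exact (by fun_prop : Continuous fun x => w (r n * x)).aestronglyMeasurable.mul hh.1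
  · rw [Real.norm_eq_abs, abs_mul]
    exact mul_le_mul_of_nonneg_right (hM _) (abs_nonneg _)
  · have h1 : Tendsto (fun n => w (r n * x)) atTop (𝓝 (w (0 * x))) :=
      (hw.tendsto _).comp (hr.mul_const x)
    rw [zero_mul, h0] at h1
    simpa using h1.mul_const (h x)

/-- A smooth bump equal to `1` at the origin, with its first two derivatives and a common bound. -/
theorem exists_smooth_bump : ∃ (b b' b'' : ℝ → ℝ) (M : ℝ), 0 ≤ M ∧
    (∀ x, HasDerivAt b (b' x) x) ∧ (∀ x, HasDerivAt b' (b'' x) x) ∧ Continuous b'' ∧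
    HasCompactSupport b ∧ b 0 = 1 ∧ (∀ x, |b x| ≤ M) ∧ (∀ x, |b' x| ≤ M) ∧ ∀ x, |b'' x| ≤ M := by
  let b : ContDiffBump (0 : ℝ) := ⟨1, 2, one_pos, one_lt_two⟩
  have hb : ContDiff ℝ (⊤ : ℕ∞) b := b.contDiff
  have hb' : ContDiff ℝ (⊤ : ℕ∞) (deriv b) := (contDiff_infty_iff_deriv.1 hb).2
  have hb'' : ContDiff ℝ (⊤ : ℕ∞) (deriv (deriv b)) := (contDiff_infty_iff_deriv.1 hb').2
  have hs : HasCompactSupport b := b.hasCompactSupport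
  obtain ⟨M0, h0⟩ := hb.continuous.bounded_above_of_compact_support hs
  obtain ⟨M1, h1⟩ := hb'.continuous.bounded_above_of_compact_support hs.deriv
  obtain ⟨M2, h2⟩ := hb''.continuous.bounded_above_of_compact_support hs.deriv.deriv
  refine ⟨b, deriv b, deriv (deriv b), |M0| + |M1| + |M2|, by positivity,
    fun x => ((hb.differentiable (by simp)) x).hasDerivAt,
    fun x => ((hb'.differentiable (by simp)) x).hasDerivAt, hb''.continuous, hs,
    b.one_of_mem_closedBall (by simp [b.rIn_pos.le]), fun x => ?_, fun x => ?_, fun x => ?_⟩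
  · have := h0 x
    rw [Real.norm_eq_abs] at this
    linarith [le_abs_self M0, abs_nonneg M1, abs_nonneg M2]
  · have := h1 x
    rw [Real.norm_eq_abs] at this
    linarith [le_abs_self M1, abs_nonneg M0, abs_nonneg M2]
  · have := h2 x
    rw [Real.norm_eq_abs] at this
    linarith [le_abs_self M2, abs_nonneg M1, abs_nonneg M0]

theorem hasCompactSupport_comp_mul {b : ℝ → ℝ} (hb : HasCompactSupport b) {r : ℝ} (hr : r ≠ 0) :
    HasCompactSupport fun x => b (r * x) :=
  hb.comp_homeomorph (Homeomorph.mulLeft₀ r hr)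

/-- Solutions of a Schrödinger equation for different spectral parameters are orthogonal. The
derivative of `f` need not be integrable: the boundary terms are moved to the derivatives of a
cutoff function and of `g`. -/
theorem integral_mul_eq_zero_of_eigen {f f' f'' g g' g'' V : ℝ → ℝ} {ν ν₀ : ℝ} (hν : ν ≠ ν₀)
    (hf : ∀ x, HasDerivAt f (f' x) x) (hf' : ∀ x, HasDerivAt f' (f'' x) x)
    (hg : ∀ x, HasDerivAt g (g' x) x) (hg' : ∀ x, HasDerivAt g' (g'' x) x)
    (ef : ∀ x, f'' x = (V x - ν) * f x) (eg : ∀ x, g'' x = (V x - ν₀) * g x)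
    (ifg : Integrable fun x => f x * g x) (ifg' : Integrable fun x => f x * g' x) :
    ∫ x, f x * g x = 0 := by
  obtain ⟨b, b', b'', M, hM, hb, hb', hb'', hbs, hb0, hbM, hbM', hbM''⟩ := exists_smooth_bump
  have cb : Continuous b := continuous_iff_continuousAt.2 fun x => (hb x).continuousAt
  have cb' : Continuous b' := continuous_iff_continuousAt.2 fun x => (hb' x).continuousAt
  have cf : Continuous f := continuous_iff_continuousAt.2 fun x => (hf x).continuousAt
  have cf' : Continuous f' := continuous_iff_continuousAt.2 fun x => (hf' x).continuousAt
  have cg : Continuous g := continuous_iff_continuousAt.2 fun x => (hg x).continuousAt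
  have cg' : Continuous g' := continuous_iff_continuousAt.2 fun x => (hg' x).continuousAt
  have hlin : ∀ r x : ℝ, HasDerivAt (fun x : ℝ => r * x) r x := fun r x => by
    simpa using (hasDerivAt_id x).const_mul r
  have key : ∀ r : ℝ, 0 < r → r ≤ 1 → |(ν - ν₀) * ∫ x, b (r * x) * (f x * g x)| ≤
      r * (2 * M * (∫ x, |f x * g' x|) + M * ∫ x, |f x * g x|) := by
    intro r hr hr1
    have i1 : Integrable fun x => b (r * x) * (f x * g x) :=
      (by fun_prop : Continuous fun x => b (r * x) * (f x * g x)).integrable_of_hasCompactSupport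
        (hasCompactSupport_comp_mul hbs hr.ne').mul_right
    have i2 : Integrable fun x => 2 * (r * b' (r * x)) * (f x * g' x) +
        r ^ 2 * b'' (r * x) * (f x * g x) := by
      refine (ifg'.bdd_mul (c := 2 * (r * M)) (by fun_prop) (ae_of_all _ fun x => ?_)).add
        (ifg.bdd_mul (c := r ^ 2 * M) (by fun_prop) (ae_of_all _ fun x => ?_))
      · rw [Real.norm_eq_abs, abs_mul, abs_mul, abs_of_pos hr, abs_of_pos two_pos]
        have := hbM' (r * x)
        gcongr
      · rw [Real.norm_eq_abs, abs_mul, abs_of_pos (pow_pos hr 2)]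
        have := hbM'' (r * x)
        gcongr
    have h0 : ∫ x, ((ν - ν₀) * (b (r * x) * (f x * g x)) + (2 * (r * b' (r * x)) * (f x * g' x) +
        r ^ 2 * b'' (r * x) * (f x * g x))) = 0 := by
      refine integral_eq_zero_of_hasDerivAt_of_integrable
        (f := fun x => b (r * x) * (f x * g' x - f' x * g x) + r * b' (r * x) * (f x * g x))
        (fun x => ?_) ((i1.const_mul _).add i2) ?_
      · have e1 := (hb (r * x)).comp x (hlin r x)
        have e2 := (hb' (r * x)).comp x (hlin r x)
        refine (((e1.fun_mul (((hf x).fun_mul (hg' x)).fun_sub ((hf' x).fun_mul (hg x))))).fun_add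
          ((e2.const_mul r).fun_mul ((hf x).fun_mul (hg x)))).congr_deriv ?_
        simp only [Function.comp_apply, ef, eg]
        ring
      · refine Continuous.integrable_of_hasCompactSupport (by fun_prop) ?_
        have hbs' : HasCompactSupport b' := by
          have : b' = deriv b := funext fun x => (hb x).deriv.symm
          exact this ▸ hbs.deriv
        exact (hasCompactSupport_comp_mul hbs hr.ne').mul_right.add
          ((hasCompactSupport_comp_mul hbs' hr.ne').mul_left (f := fun _ => r)).mul_right
    rw [integral_add (i1.const_mul _) i2, integral_const_mul] at h0
    have h1 : (ν - ν₀) * ∫ x, b (r * x) * (f x * g x) = -∫ x, (2 * (r * b' (r * x)) * (f x * g' x) +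
        r ^ 2 * b'' (r * x) * (f x * g x)) := by linarith
    rw [h1, abs_neg]
    have j1 : Integrable fun x => r * (2 * M * |f x * g' x|) := (ifg'.abs.const_mul _).const_mul _
    have j2 : Integrable fun x => r * (M * |f x * g x|) := (ifg.abs.const_mul _).const_mul _
    calc |∫ x, (2 * (r * b' (r * x)) * (f x * g' x) + r ^ 2 * b'' (r * x) * (f x * g x))|
        ≤ ∫ x, |2 * (r * b' (r * x)) * (f x * g' x) + r ^ 2 * b'' (r * x) * (f x * g x)| :=
          abs_integral_le_integral_abs
      _ ≤ ∫ x, (r * (2 * M * |f x * g' x|) + r * (M * |f x * g x|)) := by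
          refine integral_mono i2.abs (j1.add j2) fun x => (abs_add_le _ _).trans
            (add_le_add ?_ ?_)
          · rw [abs_mul, abs_mul, abs_mul, abs_of_pos hr, abs_of_pos two_pos]
            have := mul_le_mul_of_nonneg_right (hbM' (r * x)) (abs_nonneg (f x * g' x))
            nlinarith
          · rw [abs_mul, abs_mul, abs_of_pos (pow_pos hr 2)]
            have h3 := mul_le_mul_of_nonneg_right (hbM'' (r * x)) (abs_nonneg (f x * g x))
            have h4 : r ^ 2 ≤ r := by nlinarith
            calc r ^ 2 * |b'' (r * x)| * |f x * g x| = r ^ 2 * (|b'' (r * x)| * |f x * g x|) := by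
                  ring
              _ ≤ r * (M * |f x * g x|) := mul_le_mul h4 h3 (by positivity) hr.le
      _ = _ := by
          rw [integral_add j1 j2]
          simp only [integral_const_mul]
          ring
  have hr : Tendsto (fun n : ℕ => 1 / ((n : ℝ) + 1)) atTop (𝓝 0) :=
    tendsto_one_div_add_atTop_nhds_zero_nat
  have hl := ((tendsto_integral_cutoff cb hbM hb0 ifg hr).const_mul (ν - ν₀)).abs
  have hl2 := hr.mul_const (2 * M * (∫ x, |f x * g' x|) + M * ∫ x, |f x * g x|)
  have := le_of_tendsto_of_tendsto' hl hl2 fun n => key _ (by positivity) (by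
    rw [div_le_one (by positivity)]
    have : (0 : ℝ) ≤ n := n.cast_nonneg
    linarith)
  rw [zero_mul] at this
  have h0 := abs_eq_zero.1 (le_antisymm this (abs_nonneg _))
  exact (mul_eq_zero.1 h0).resolve_left (sub_ne_zero.2 hν)

theorem hasDerivAt_sech_sq (x : ℝ) :
    HasDerivAt (fun x => sech x ^ 2) (-2 * (sech x ^ 2 * Real.tanh x)) x :=
  ((hasDerivAt_sech x).fun_pow 2).congr_deriv (by simp; ring)

theorem hasDerivAt_sech_mul_tanh (x : ℝ) :
    HasDerivAt (fun x => sech x * Real.tanh x) (2 * sech x ^ 3 - sech x) x :=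
  ((hasDerivAt_sech x).fun_mul (hasDerivAt_tanh x)).congr_deriv
    (by linear_combination -sech x * tanh_sq_eq x)

/-- A square integrable solution of `-f'' + f - 6 sech² f = ν f` with `ν < 0` is a multiple of
`sech²`: after removing its component along `sech²` it is orthogonal to `sech²` and `sech tanh`,
so the coercivity of the form contradicts `ν < 0` unless it vanishes. -/
theorem eq_const_mul_sech_sq {f f' f'' : ℝ → ℝ} {ν : ℝ} (hν : ν < 0)
    (hf : ∀ x, HasDerivAt f (f' x) x) (hf' : ∀ x, HasDerivAt f' (f'' x) x)
    (ef : ∀ x, f'' x = (1 - 6 * sech x ^ 2 - ν) * f x) (hf2 : MemLp f 2) :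
    ∃ p : ℝ, ∀ x, f x = p * sech x ^ 2 := by
  have mS : MemLp (fun x => sech x ^ 2) 2 := memLp_of_abs_le_sech (by fun_prop) abs_sech_sq_le
  have mS' : MemLp (fun x => -2 * (sech x ^ 2 * Real.tanh x)) 2 :=
    memLp_of_abs_le_sech (M := 2) (by fun_prop) fun x => by
      rw [abs_mul, abs_mul]
      have := abs_sech_sq_le x
      have h2 := abs_tanh_le_one x
      have h3 : |sech x ^ 2| * |Real.tanh x| ≤ (1 * sech x) * 1 :=
        mul_le_mul this h2 (abs_nonneg _) (by have := sech_pos x; positivity)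
      rw [show |(-2 : ℝ)| = 2 by norm_num]
      linarith
  have mT : MemLp (fun x => sech x * Real.tanh x) 2 :=
    memLp_of_abs_le_sech (by fun_prop) abs_sech_mul_tanh_le
  have mT' : MemLp (fun x => 2 * sech x ^ 3 - sech x) 2 :=
    memLp_of_abs_le_sech (M := 1) (by fun_prop) fun x => by
      have h1 := sech_pos x
      have h2 := sech_le_one x
      have h3 : sech x ^ 2 ≤ 1 := pow_le_one₀ h1.le h2
      rw [abs_le]
      constructor <;> nlinarith [pow_pos h1 3]
  have dS' : ∀ x, HasDerivAt (fun x => -2 * (sech x ^ 2 * Real.tanh x))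
      ((1 - 6 * sech x ^ 2 - (-3)) * sech x ^ 2) x := fun x =>
    (((hasDerivAt_sech_sq x).fun_mul (hasDerivAt_tanh x)).const_mul (-2)).congr_deriv
      (by linear_combination 4 * sech x ^ 2 * tanh_sq_eq x)
  have dT' : ∀ x, HasDerivAt (fun x => 2 * sech x ^ 3 - sech x)
      ((1 - 6 * sech x ^ 2 - 0) * (sech x * Real.tanh x)) x := fun x =>
    ((((hasDerivAt_sech x).fun_pow 3).const_mul 2).fun_sub (hasDerivAt_sech x)).congr_deriv
      (by simp; ring)
  have hSS : 0 < ∫ x, sech x ^ 2 * sech x ^ 2 := by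
    refine integral_pos_of_integrable_nonneg_nonzero (x := 0) (by fun_prop)
      (mS.integrable_mul mS) (fun x => by positivity) ?_
    have := (sech_pos 0).ne'
    positivity
  set p := (∫ x, f x * sech x ^ 2) / ∫ x, sech x ^ 2 * sech x ^ 2 with hp
  -- the component of `f` orthogonal to `sech²` solves the same equation
  set d : ℝ → ℝ := fun x => f x - p * sech x ^ 2 with hd
  have hpν : p * (ν + 3) = 0 := by
    by_cases h : ν = -3
    · rw [h]; norm_num
    · have := integral_mul_eq_zero_of_eigen h hf hf' hasDerivAt_sech_sq dS' ef (fun x => rfl)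
        (hf2.integrable_mul mS) (hf2.integrable_mul mS')
      rw [hp, this]; simp
  have dd : ∀ x, HasDerivAt d (f' x - p * (-2 * (sech x ^ 2 * Real.tanh x))) x := fun x =>
    (hf x).sub ((hasDerivAt_sech_sq x).const_mul p)
  have dd' : ∀ x, HasDerivAt (fun x => f' x - p * (-2 * (sech x ^ 2 * Real.tanh x)))
      ((1 - 6 * sech x ^ 2 - ν) * d x) x := fun x =>
    ((hf' x).fun_sub ((dS' x).const_mul p)).congr_deriv (by
      rw [ef, hd]
      linear_combination -sech x ^ 2 * hpν)
  have md : MemLp d 2 := hf2.sub (mS.const_mul p)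
  have dS0 : ∫ x, d x * sech x ^ 2 = 0 := by
    have : ∀ x, d x * sech x ^ 2 = f x * sech x ^ 2 - p * (sech x ^ 2 * sech x ^ 2) := fun x => by
      rw [hd]; ring
    simp only [this]
    have i1 : Integrable fun x => f x * sech x ^ 2 := hf2.integrable_mul mS
    have i2 : Integrable fun x => p * (sech x ^ 2 * sech x ^ 2) :=
      (mS.integrable_mul mS).const_mul p
    rw [integral_sub i1 i2, integral_const_mul, hp, div_mul_cancel₀ _ hSS.ne', sub_self]
  have dT0 : ∫ x, d x * (sech x * Real.tanh x) = 0 :=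
    integral_mul_eq_zero_of_eigen hν.ne dd dd' hasDerivAt_sech_mul_tanh dT' (fun x => rfl)
      (fun x => rfl) (md.integrable_mul mT) (md.integrable_mul mT')
  have cd : Continuous d := continuous_iff_continuousAt.2 fun x => (dd x).continuousAt
  set d' : ℝ → ℝ := fun x => f' x - p * (-2 * (sech x ^ 2 * Real.tanh x)) with hd'
  have cd' : Continuous d' := continuous_iff_continuousAt.2 fun x => (dd' x).continuousAt
  have id2 : Integrable fun x => d x ^ 2 := md.integrable_sq
  obtain ⟨C, hC, hco⟩ := coercive_two
  obtain ⟨b, b', b'', M, hM, hb, hb', hb'', hbs, hb0, hbM, hbM', -⟩ := exists_smooth_bump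
  have cb : Continuous b := continuous_iff_continuousAt.2 fun x => (hb x).continuousAt
  have cb' : Continuous b' := continuous_iff_continuousAt.2 fun x => (hb' x).continuousAt
  have hlin : ∀ r x : ℝ, HasDerivAt (fun x : ℝ => r * x) r x := fun r x => by
    simpa using (hasDerivAt_id x).const_mul r
  have key : ∀ r : ℝ, 0 < r → 1 / 28 * ∫ x, b (r * x) ^ 2 * d x ^ 2 ≤
      ν * (∫ x, b (r * x) ^ 2 * d x ^ 2) + r ^ 2 * (M ^ 2 * ∫ x, d x ^ 2) +
      C * ((∫ x, b (r * x) * (d x * sech x ^ 2)) ^ 2 +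
        (∫ x, b (r * x) * (d x * (sech x * Real.tanh x))) ^ 2) := by
    intro r hr
    have e1 : ∀ x, HasDerivAt (fun x => b (r * x)) (b' (r * x) * r) x := fun x =>
      (hb (r * x)).comp x (hlin r x)
    have hcut : IsC1c (fun x => b (r * x)) (fun x => b' (r * x) * r) :=
      ⟨e1, by fun_prop, hasCompactSupport_comp_mul hbs hr.ne'⟩
    have ha : IsC1c (fun x => d x * b (r * x)) _ := hcut.mul dd cd'
    have k := hco _ _ ha
    have i1 : Integrable fun x => b (r * x) ^ 2 * d x ^ 2 :=
      hcut.integrable_of (by fun_prop) fun x a b => by simp [a]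
    have i2 : Integrable fun x => (b' (r * x) * r) ^ 2 * d x ^ 2 :=
      hcut.integrable_of (by fun_prop) fun x a b => by simp [b]
    have k1 : ∫ x, b (r * x) ^ 2 * d x ^ 2 ≤
        ∫ x, ((d' x * b (r * x) + d x * (b' (r * x) * r)) ^ 2 + (d x * b (r * x)) ^ 2) :=
      integral_mono i1 (hcut.integrable_of (by fun_prop) fun x a b => by simp [a, b]) fun x => by
        simp only
        nlinarith [sq_nonneg (d' x * b (r * x) + d x * (b' (r * x) * r))]
    have k2 : ∫ x, ((d' x * b (r * x) + d x * (b' (r * x) * r)) ^ 2 + (d x * b (r * x)) ^ 2 -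
        6 * sech x ^ 2 * (d x * b (r * x)) ^ 2) =
        ∫ x, (ν * (b (r * x) ^ 2 * d x ^ 2) + (b' (r * x) * r) ^ 2 * d x ^ 2) := by
      refine hcut.integral_congr_of_deriv (w := fun x => d x * d' x) (by fun_prop) (by fun_prop)
        (fun x => (dd x).mul (dd' x)) (fun x a b => by simp [a, b]) (fun x a b => by simp [a, b])
        fun x => ?_
      ring
    rw [k2, integral_add (i1.const_mul ν) i2, integral_const_mul] at k
    have k3 : ∫ x, (b' (r * x) * r) ^ 2 * d x ^ 2 ≤ r ^ 2 * (M ^ 2 * ∫ x, d x ^ 2) := by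
      rw [← mul_assoc, ← integral_const_mul]
      refine integral_mono i2 (id2.const_mul _) fun x => ?_
      refine mul_le_mul_of_nonneg_right ?_ (sq_nonneg _)
      have : b' (r * x) ^ 2 ≤ M ^ 2 := by
        rw [← sq_abs]; exact pow_le_pow_left₀ (abs_nonneg _) (hbM' _) 2
      rw [mul_pow]
      nlinarith [sq_nonneg r]
    have e2 : ∀ w : ℝ → ℝ, ∫ x, d x * b (r * x) * w x = ∫ x, b (r * x) * (d x * w x) := fun w =>
      integral_congr_ae (ae_of_all _ fun x => by ring)
    rw [e2, e2] at k
    linarith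
  have hr : Tendsto (fun n : ℕ => 1 / ((n : ℝ) + 1)) atTop (𝓝 0) :=
    tendsto_one_div_add_atTop_nhds_zero_nat
  have l1 := tendsto_integral_cutoff (w := fun x => b x ^ 2) (by fun_prop) (M := M ^ 2)
    (fun x => by rw [abs_pow]; exact pow_le_pow_left₀ (abs_nonneg _) (hbM x) 2)
    (by simp [hb0]) id2 hr
  have l2 := tendsto_integral_cutoff cb hbM hb0 (md.integrable_mul mS) hr
  have l3 := tendsto_integral_cutoff cb hbM hb0 (md.integrable_mul mT) hr
  simp only [Pi.mul_apply] at l2 l3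
  have := le_of_tendsto_of_tendsto' (l1.const_mul (1 / 28))
    (((l1.const_mul ν).add ((hr.pow 2).mul_const (M ^ 2 * ∫ x, d x ^ 2))).add
      (((l2.pow 2).add (l3.pow 2)).const_mul C)) fun n => key _ (by positivity)
  rw [dS0, dT0] at this
  have hnn : 0 ≤ ∫ x, d x ^ 2 := integral_nonneg fun x => by positivity
  have hz : ∫ x, d x ^ 2 = 0 := by
    refine le_antisymm ?_ hnn
    nlinarith
  have hdz : d = 0 := by
    by_contra hne
    obtain ⟨x, hx⟩ := Function.ne_iff.1 hne
    have := integral_pos_of_integrable_nonneg_nonzero (x := x) (by fun_prop) id2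
      (fun x => by positivity) (pow_ne_zero 2 hx)
    linarith
  refine ⟨p, fun x => ?_⟩
  have := congrFun hdz x
  simp only [hd, Pi.zero_apply] at this
  linarith

/-- The inverse width `√(1 - c² - ω²) / (1 - c²)` of the profile. -/
def invWidth (ω c : ℝ) : ℝ := Real.sqrt (1 - c ^ 2 - ω ^ 2) / (1 - c ^ 2)

theorem one_sub_sq_pos {ω c : ℝ} (h : 0 < 1 - c ^ 2 - ω ^ 2) : 0 < 1 - c ^ 2 := by
  nlinarith [sq_nonneg ω]

theorem invWidth_pos {ω c : ℝ} (h : 0 < 1 - c ^ 2 - ω ^ 2) : 0 < invWidth ω c :=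
  div_pos (Real.sqrt_pos.2 h) (one_sub_sq_pos h)

theorem invWidth_sq {ω c : ℝ} (h : 0 < 1 - c ^ 2 - ω ^ 2) :
    invWidth ω c ^ 2 * (1 - c ^ 2) ^ 2 = 1 - c ^ 2 - ω ^ 2 := by
  have := (one_sub_sq_pos h).ne'
  rw [invWidth, div_pow, Real.sq_sqrt h.le, div_mul_cancel₀ _ (pow_ne_zero 2 this)]

theorem profile_eq (α β ω c x : ℝ) : profile α β ω c x =
    Real.sqrt (2 * (1 - c ^ 2 - ω ^ 2) / (α - β * (1 - c ^ 2))) * sech (invWidth ω c * x) := by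
  rw [profile, sech, invWidth, div_eq_mul_inv]

theorem profile_sq {α β ω c : ℝ} (h : 0 < 1 - c ^ 2 - ω ^ 2) (h' : 0 < α - β * (1 - c ^ 2))
    (x : ℝ) : profile α β ω c x ^ 2 =
      2 * (1 - c ^ 2 - ω ^ 2) / (α - β * (1 - c ^ 2)) * sech (invWidth ω c * x) ^ 2 := by
  rw [profile_eq, mul_pow, Real.sq_sqrt (by positivity)]

theorem integral_comp_div_add (G : ℝ → ℝ) {κ : ℝ} (hκ : 0 < κ) (y : ℝ) :
    ∫ x, G (x / κ + y) = κ * ∫ x, G x := by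
  have h := Measure.integral_comp_div (fun x => G (x + y)) κ
  rw [h, integral_add_right_eq_self, abs_of_pos hκ, smul_eq_mul]

/-- The negative eigenfunction is a multiple of `sech²`. -/
theorem IsNegEigenfunction.eq_sech_sq {α β ω c : ℝ} {Ψ : ℝ → ℝ}
    (hΨ : IsNegEigenfunction α β ω c Ψ) (h : 0 < 1 - c ^ 2 - ω ^ 2)
    (h' : 0 < α - β * (1 - c ^ 2)) :
    ∃ p, p ≠ 0 ∧ ∀ x, Ψ x = p * sech (invWidth ω c * x) ^ 2 := by
  obtain ⟨hC, hL, ⟨x₀, hx₀⟩, μ, hμ, he⟩ := hΨ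
  have hD := one_sub_sq_pos h
  set κ := invWidth ω c with hκ
  have hκ0 : 0 < κ := invWidth_pos h
  have hκ2 : κ ^ 2 * (1 - c ^ 2) ^ 2 = 1 - c ^ 2 - ω ^ 2 := invWidth_sq h
  have d1 : ∀ x, HasDerivAt Ψ (deriv Ψ x) x := fun x =>
    ((hC.differentiable (by simp)) x).hasDerivAt
  have hC1 : ContDiff ℝ 1 (deriv Ψ) :=
    (contDiff_succ_iff_deriv (n := 1).1 (by simpa [one_add_one_eq_two] using hC)).2.2
  have d2 : ∀ x, HasDerivAt (deriv Ψ) (deriv (deriv Ψ) x) x := fun x =>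
    ((hC1.differentiable (by simp)) x).hasDerivAt
  have hlin : ∀ x : ℝ, HasDerivAt (fun x : ℝ => x / κ) κ⁻¹ x := fun x => by
    simpa [div_eq_mul_inv] using (hasDerivAt_id x).mul_const κ⁻¹
  have d3 : ∀ x, HasDerivAt (fun x => deriv Ψ (x / κ)) (deriv (deriv Ψ) (x / κ) * κ⁻¹) x := fun x =>
    HasDerivAt.comp (h := fun x => x / κ) (h₂ := deriv Ψ) x (d2 (x / κ)) (hlin x)
  obtain ⟨p, hp⟩ := eq_const_mul_sech_sq (f := fun x => Ψ (x / κ))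
    (f' := fun x => deriv Ψ (x / κ) * κ⁻¹)
    (f'' := fun x => deriv (deriv Ψ) (x / κ) * κ⁻¹ * κ⁻¹) (ν := μ / ((1 - c ^ 2) * κ ^ 2))
    (div_neg_of_neg_of_pos hμ (by positivity))
    (fun x => (d1 (x / κ)).comp x (hlin x)) (fun x => (d3 x).mul_const κ⁻¹)
    (fun x => by
      have e := he (x / κ)
      rw [linOp, profile_sq h h', mul_div_cancel₀ x hκ0.ne', ← hκ2] at e
      have e2 : deriv (deriv Ψ) (x / κ) =
          ((1 - 6 * sech x ^ 2) * κ ^ 2 - μ / (1 - c ^ 2)) * Ψ (x / κ) := by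
        generalize α - β * (1 - c ^ 2) = A at e h'
        field_simp at e ⊢
        linarith
      simp only [e2]
      field_simp)
    (by
      have hc : Continuous Ψ := hC.continuous
      rw [memLp_two_iff_integrable_sq (by fun_prop)]
      have := hL.integrable_sq
      exact this.comp_div hκ0.ne')
  have hΨ' : ∀ x, Ψ x = p * sech (κ * x) ^ 2 := fun x => by
    have := hp (κ * x)
    rwa [mul_div_cancel_left₀ x hκ0.ne'] at this
  refine ⟨p, fun h0 => hx₀ ?_, hΨ'⟩
  rw [hΨ', h0, zero_mul]

/-! ### Coercivity around one soliton -/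

theorem IsC1c.comp_div_add {a a' : ℝ → ℝ} (h : IsC1c a a') {κ : ℝ} (hκ : 0 < κ) (y : ℝ) :
    IsC1c (fun x => a (x / κ + y)) (fun x => a' (x / κ + y) * κ⁻¹) := by
  have h1 := h.continuous
  have h2 := h.continuous'
  refine ⟨fun x => ?_, by fun_prop, ?_⟩
  · have hlin : HasDerivAt (fun x : ℝ => x / κ + y) κ⁻¹ x := by
      simpa [div_eq_mul_inv] using ((hasDerivAt_id x).mul_const κ⁻¹).add_const y
    exact (h.hasDerivAt _).comp x hlin
  · exact h.hasCompactSupport.comp_homeomorph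
      ((Homeomorph.mulRight₀ κ⁻¹ (inv_ne_zero hκ.ne')).trans (Homeomorph.addRight y))

theorem le_of_scaled_le {κ A B C L : ℝ} (hκ : 0 < κ)
    (h : 1 / 28 * (κ * ((κ ^ 2)⁻¹ * A)) ≤ κ * ((κ ^ 2)⁻¹ * B) + C * (κ ^ 2 * L)) :
    1 / 28 * A ≤ B + C * κ ^ 3 * L := by
  have := mul_le_mul_of_nonneg_left h hκ.le
  field_simp at this
  linarith

theorem coercive_one_scaled : ∃ C, 0 ≤ C ∧ ∀ κ y : ℝ, 0 < κ → ∀ b b' : ℝ → ℝ, IsC1c b b' →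
    1 / 28 * ∫ x, (b' x ^ 2 + κ ^ 2 * b x ^ 2) ≤
      (∫ x, (b' x ^ 2 + κ ^ 2 * b x ^ 2 - 2 * κ ^ 2 * sech (κ * (x - y)) ^ 2 * b x ^ 2)) +
        C * κ ^ 3 * (∫ x, b x * sech (κ * (x - y))) ^ 2 := by
  obtain ⟨C, hC, h⟩ := coercive_one
  refine ⟨C, hC, fun κ y hκ b b' hb => ?_⟩
  have k := h _ _ (hb.comp_div_add hκ y)
  have hs : ∀ x, x = κ * ((x / κ + y) - y) := fun x => by field_simp; ring
  have e1 : ∫ x, ((b' (x / κ + y) * κ⁻¹) ^ 2 + b (x / κ + y) ^ 2) =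
      κ * ((κ ^ 2)⁻¹ * ∫ x, (b' x ^ 2 + κ ^ 2 * b x ^ 2)) := by
    rw [← integral_const_mul, ← integral_comp_div_add _ hκ y]
    refine integral_congr_ae (ae_of_all _ fun x => ?_)
    simp only
    field_simp
  have e2 : ∫ x, ((b' (x / κ + y) * κ⁻¹) ^ 2 + b (x / κ + y) ^ 2 -
      2 * sech x ^ 2 * b (x / κ + y) ^ 2) = κ * ((κ ^ 2)⁻¹ * ∫ x, (b' x ^ 2 + κ ^ 2 * b x ^ 2 -
        2 * κ ^ 2 * sech (κ * (x - y)) ^ 2 * b x ^ 2)) := by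
    rw [← integral_const_mul, ← integral_comp_div_add _ hκ y]
    refine integral_congr_ae (ae_of_all _ fun x => ?_)
    simp only [← hs]
    field_simp
  have e3 : ∫ x, b (x / κ + y) * sech x = κ * ∫ x, b x * sech (κ * (x - y)) := by
    rw [← integral_comp_div_add _ hκ y]
    simp only [← hs]
  rw [e1, e2, e3] at k
  exact le_of_scaled_le hκ (k.trans_eq (by ring))

theorem coercive_two_scaled : ∃ C, 0 ≤ C ∧ ∀ κ y : ℝ, 0 < κ → ∀ b b' : ℝ → ℝ, IsC1c b b' →
    1 / 28 * ∫ x, (b' x ^ 2 + κ ^ 2 * b x ^ 2) ≤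
      (∫ x, (b' x ^ 2 + κ ^ 2 * b x ^ 2 - 6 * κ ^ 2 * sech (κ * (x - y)) ^ 2 * b x ^ 2)) +
        C * κ ^ 3 * ((∫ x, b x * sech (κ * (x - y)) ^ 2) ^ 2 +
          (∫ x, b x * (sech (κ * (x - y)) * Real.tanh (κ * (x - y)))) ^ 2) := by
  obtain ⟨C, hC, h⟩ := coercive_two
  refine ⟨C, hC, fun κ y hκ b b' hb => ?_⟩
  have k := h _ _ (hb.comp_div_add hκ y)
  have hs : ∀ x, x = κ * ((x / κ + y) - y) := fun x => by field_simp; ring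
  have e1 : ∫ x, ((b' (x / κ + y) * κ⁻¹) ^ 2 + b (x / κ + y) ^ 2) =
      κ * ((κ ^ 2)⁻¹ * ∫ x, (b' x ^ 2 + κ ^ 2 * b x ^ 2)) := by
    rw [← integral_const_mul, ← integral_comp_div_add _ hκ y]
    refine integral_congr_ae (ae_of_all _ fun x => ?_)
    simp only
    field_simp
  have e2 : ∫ x, ((b' (x / κ + y) * κ⁻¹) ^ 2 + b (x / κ + y) ^ 2 -
      6 * sech x ^ 2 * b (x / κ + y) ^ 2) = κ * ((κ ^ 2)⁻¹ * ∫ x, (b' x ^ 2 + κ ^ 2 * b x ^ 2 -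
        6 * κ ^ 2 * sech (κ * (x - y)) ^ 2 * b x ^ 2)) := by
    rw [← integral_const_mul, ← integral_comp_div_add _ hκ y]
    refine integral_congr_ae (ae_of_all _ fun x => ?_)
    simp only [← hs]
    field_simp
  have e3 : ∫ x, b (x / κ + y) * sech x ^ 2 = κ * ∫ x, b x * sech (κ * (x - y)) ^ 2 := by
    rw [← integral_comp_div_add _ hκ y]
    simp only [← hs]
  have e4 : ∫ x, b (x / κ + y) * (sech x * Real.tanh x) =
      κ * ∫ x, b x * (sech (κ * (x - y)) * Real.tanh (κ * (x - y))) := by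
    rw [← integral_comp_div_add _ hκ y]
    simp only [← hs]
  rw [e1, e2, e3, e4] at k
  exact le_of_scaled_le hκ (k.trans_eq (by ring))

/-- The two scalar forms combined: the real part of `w` sees `-∂² + κ² - 6 κ² sech²`, the
imaginary part `-∂² + κ² - 2 κ² sech²`. -/
theorem coercive_complex : ∃ C, 0 ≤ C ∧ ∀ κ y : ℝ, 0 < κ → ∀ w w' : ℝ → ℂ,
    (∀ x, HasDerivAt w (w' x) x) → Continuous w' → HasCompactSupport w →
    1 / 28 * ∫ x, (‖w' x‖ ^ 2 + κ ^ 2 * ‖w x‖ ^ 2) ≤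
      (∫ x, (‖w' x‖ ^ 2 + κ ^ 2 * ‖w x‖ ^ 2 -
        2 * κ ^ 2 * sech (κ * (x - y)) ^ 2 * (‖w x‖ ^ 2 + 2 * (w x).re ^ 2))) +
      C * κ ^ 3 * ((∫ x, (w x).re * sech (κ * (x - y)) ^ 2) ^ 2 +
        (∫ x, (w x).re * (sech (κ * (x - y)) * Real.tanh (κ * (x - y)))) ^ 2 +
        (∫ x, (w x).im * sech (κ * (x - y))) ^ 2) := by
  obtain ⟨C1, hC1, h1⟩ := coercive_one_scaled
  obtain ⟨C2, hC2, h2⟩ := coercive_two_scaled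
  refine ⟨C1 + C2, by positivity, fun κ y hκ w w' hw hw' hws => ?_⟩
  have hre : IsC1c (fun x => (w x).re) (fun x => (w' x).re) :=
    ⟨fun x => (Complex.reCLM.hasFDerivAt (x := w x)).comp_hasDerivAt x (hw x), by fun_prop,
      hws.comp_left (g := Complex.re) rfl⟩
  have him : IsC1c (fun x => (w x).im) (fun x => (w' x).im) :=
    ⟨fun x => (Complex.imCLM.hasFDerivAt (x := w x)).comp_hasDerivAt x (hw x), by fun_prop,
      hws.comp_left (g := Complex.im) rfl⟩
  have c1 := hre.continuous
  have c2 := hre.continuous'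
  have c3 := him.continuous
  have c4 := him.continuous'
  have k1 := h1 κ y hκ _ _ him
  have k2 := h2 κ y hκ _ _ hre
  have e1 : ∫ x, (‖w' x‖ ^ 2 + κ ^ 2 * ‖w x‖ ^ 2) =
      (∫ x, ((w' x).re ^ 2 + κ ^ 2 * (w x).re ^ 2)) +
        ∫ x, ((w' x).im ^ 2 + κ ^ 2 * (w x).im ^ 2) := by
    rw [← integral_add (hre.integrable_of (by fun_prop) fun x a b => by simp [a, b])
      (him.integrable_of (by fun_prop) fun x a b => by simp [a, b])]
    refine integral_congr_ae (ae_of_all _ fun x => ?_)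
    simp only [Complex.sq_norm, Complex.normSq_apply]
    ring
  have e2 : ∫ x, (‖w' x‖ ^ 2 + κ ^ 2 * ‖w x‖ ^ 2 -
        2 * κ ^ 2 * sech (κ * (x - y)) ^ 2 * (‖w x‖ ^ 2 + 2 * (w x).re ^ 2)) =
      (∫ x, ((w' x).re ^ 2 + κ ^ 2 * (w x).re ^ 2 -
        6 * κ ^ 2 * sech (κ * (x - y)) ^ 2 * (w x).re ^ 2)) +
        ∫ x, ((w' x).im ^ 2 + κ ^ 2 * (w x).im ^ 2 -
          2 * κ ^ 2 * sech (κ * (x - y)) ^ 2 * (w x).im ^ 2) := by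
    rw [← integral_add (hre.integrable_of (by fun_prop) fun x a b => by simp [a, b])
      (him.integrable_of (by fun_prop) fun x a b => by simp [a, b])]
    refine integral_congr_ae (ae_of_all _ fun x => ?_)
    simp only [Complex.sq_norm, Complex.normSq_apply]
    ring
  rw [e1, e2]
  have hκ3 := pow_pos hκ 3
  have n1 := sq_nonneg (∫ x, (w x).re * sech (κ * (x - y)) ^ 2)
  have n2 := sq_nonneg (∫ x, (w x).re * (sech (κ * (x - y)) * Real.tanh (κ * (x - y))))
  have n3 := sq_nonneg (∫ x, (w x).im * sech (κ * (x - y)))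
  have m1 : 0 ≤ C1 * κ ^ 3 := by positivity
  have m2 : 0 ≤ C2 * κ ^ 3 := by positivity
  nlinarith [mul_nonneg m1 n1, mul_nonneg m1 n2, mul_nonneg m2 n3]

theorem norm_phase (ω c γ t x : ℝ) : ‖phase ω c γ t x‖ = 1 := by
  rw [phase, mul_comm, Complex.norm_exp_ofReal_mul_I]

theorem conj_phase_mul_phase (ω c γ t x : ℝ) :
    conj (phase ω c γ t x) * phase ω c γ t x = 1 := by
  rw [mul_comm, Complex.mul_conj, Complex.normSq_eq_norm_sq, norm_phase]
  simp

theorem hasDerivAt_phase (ω c γ t x : ℝ) : HasDerivAt (phase ω c γ t)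
    (Complex.I * ((ω * c / (1 - c ^ 2) : ℝ) : ℂ) * phase ω c γ t x) x := by
  have h1 : HasDerivAt (fun x : ℝ => ω * c / (1 - c ^ 2) * x - ω / (1 - c ^ 2) * t + γ)
      (ω * c / (1 - c ^ 2)) x := by
    simpa using (((hasDerivAt_id x).const_mul (ω * c / (1 - c ^ 2))).sub_const
      (ω / (1 - c ^ 2) * t)).add_const γ
  have h2 := (h1.ofReal_comp.const_mul Complex.I).cexp
  exact h2.congr_deriv (by rw [phase]; ring)

theorem continuous_phase (ω c γ t : ℝ) : Continuous (phase ω c γ t) :=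
  continuous_iff_continuousAt.2 fun x => (hasDerivAt_phase ω c γ t x).continuousAt

/-- The density, in the first component alone, of the form around one soliton: `v` is the
potential, `e` the phase factor, and `U'` stands for the derivative of `U`. -/
def solitonForm (ω c v : ℝ) (e U U' : ℂ) : ℝ :=
  ‖U'‖ ^ 2 + ‖U‖ ^ 2 - ‖Complex.I * (ω : ℂ) * U + (c : ℂ) * U'‖ ^ 2 -
    v * (‖U‖ ^ 2 + 2 * (conj e * U).re ^ 2)

/-- Removing the phase `e`, with `e' = i θ e` and `θ = ω c / (1 - c²)`, diagonalizes the form of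
frequency `ω'` up to terms that vanish for `ω' = ω`. -/
theorem solitonForm_mul_phase {ω ω' c v : ℝ} {e w w' : ℂ} (he : ‖e‖ = 1)
    (h : 0 < 1 - c ^ 2 - ω' ^ 2) :
    solitonForm ω' c v e (e * w) (e * (w' + Complex.I * ((ω * c / (1 - c ^ 2) : ℝ) : ℂ) * w)) =
      (1 - c ^ 2) * (‖w'‖ ^ 2 + invWidth ω' c ^ 2 * ‖w‖ ^ 2) +
        c ^ 2 * (ω - ω') ^ 2 / (1 - c ^ 2) * ‖w‖ ^ 2 + 2 * c * (ω - ω') * (w' * conj w).im -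
        v * (‖w‖ ^ 2 + 2 * w.re ^ 2) := by
  have hD := one_sub_sq_pos h
  have hκ : invWidth ω' c ^ 2 = (1 - c ^ 2 - ω' ^ 2) / (1 - c ^ 2) ^ 2 := by
    rw [← invWidth_sq h]; field_simp
  have h1 : conj e * (e * w) = w := by
    rw [← mul_assoc, mul_comm (conj e), Complex.mul_conj, Complex.normSq_eq_norm_sq, he]
    simp
  have h2 : ∀ z : ℂ, Complex.I * (ω' : ℂ) * (e * w) + (c : ℂ) * (e * z) =
      e * (Complex.I * (ω' : ℂ) * w + (c : ℂ) * z) := fun z => by ring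
  rw [solitonForm, h1, h2, norm_mul, norm_mul, norm_mul, he, one_mul, one_mul, one_mul, hκ]
  simp only [Complex.sq_norm, Complex.normSq_apply, Complex.add_re, Complex.add_im,
    Complex.mul_re, Complex.mul_im, Complex.I_re, Complex.I_im, Complex.ofReal_re,
    Complex.ofReal_im, Complex.conj_re, Complex.conj_im]
  field_simp
  ring

/-- The Cauchy–Schwarz inequality for integrals. -/
theorem sq_integral_mul_le {f g : ℝ → ℝ} (hf : MemLp f 2) (hg : MemLp g 2) :
    (∫ x, f x * g x) ^ 2 ≤ (∫ x, f x ^ 2) * ∫ x, g x ^ 2 := by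
  have i1 := hf.integrable_sq
  have i2 := hg.integrable_sq
  have i3 : Integrable fun x => f x * g x := hf.integrable_mul hg
  have key : ∀ s : ℝ, 0 ≤ (∫ x, g x ^ 2) * (s * s) + 2 * (∫ x, f x * g x) * s + ∫ x, f x ^ 2 := by
    intro s
    have h : 0 ≤ ∫ x, ((s * s) * g x ^ 2 + (2 * s) * (f x * g x) + f x ^ 2) :=
      integral_nonneg fun x => by
        have : (s * s) * g x ^ 2 + (2 * s) * (f x * g x) + f x ^ 2 = (s * g x + f x) ^ 2 := by ring
        rw [Pi.zero_apply, this]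
        positivity
    rw [integral_add (by exact (i2.const_mul _).add (i3.const_mul _)) i1,
      integral_add (i2.const_mul _) (i3.const_mul _), integral_const_mul, integral_const_mul] at h
    linarith
  have := discrim_le_zero key
  rw [discrim] at this
  linarith

theorem sq_integral_re_conj_mul_le {g d : ℝ → ℂ} (hg : MemLp g 2) (hd : MemLp d 2) :
    (∫ x, (conj (g x) * d x).re) ^ 2 ≤ (∫ x, ‖g x‖ ^ 2) * ∫ x, ‖d x‖ ^ 2 := by
  refine le_trans ?_ (sq_integral_mul_le hg.norm hd.norm)
  rw [sq_le_sq]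
  refine (abs_integral_le_integral_abs).trans (le_trans ?_ (le_abs_self _))
  refine integral_mono_of_nonneg (ae_of_all _ fun x => abs_nonneg _)
    (hg.norm.integrable_mul hd.norm) (ae_of_all _ fun x => ?_)
  refine (Complex.abs_re_le_norm _).trans ?_
  rw [norm_mul, RCLike.norm_conj]

theorem integrable_re_conj_mul {g d : ℝ → ℂ} (hg : MemLp g 2) (hd : MemLp d 2) :
    Integrable fun x => (conj (g x) * d x).re := by
  have h : Integrable fun x => conj (g x) * d x := (hg.star).integrable_mul hd
  exact h.re

theorem memLp_continuous_mul {g : ℝ → ℂ} (hg : Continuous g) {M : ℝ} (hM : ∀ x, ‖g x‖ ≤ M)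
    {f : ℝ → ℂ} (hf : MemLp f 2) : MemLp (fun x => g x * f x) 2 :=
  hf.of_le_mul (c := M) (hg.aestronglyMeasurable.mul hf.1) (ae_of_all _ fun x => by
    rw [norm_mul]; exact mul_le_mul_of_nonneg_right (hM x) (norm_nonneg _))

theorem integrable_solitonForm {ω c V : ℝ} {v : ℝ → ℝ} {e : ℝ → ℂ} (hv : Continuous v)
    (hV : ∀ x, |v x| ≤ V) (he : Continuous e) (he1 : ∀ x, ‖e x‖ = 1) {U U' : ℝ → ℂ}
    (hU : MemLp U 2) (hU' : MemLp U' 2) :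
    Integrable fun x => solitonForm ω c (v x) (e x) (U x) (U' x) := by
  have i1 := hU.integrable_norm_pow (by norm_num)
  have i2 := hU'.integrable_norm_pow (by norm_num)
  have i3 := ((hU.const_mul (Complex.I * (ω : ℂ))).add
    (hU'.const_mul (c : ℂ))).integrable_norm_pow (by norm_num)
  have m4 : MemLp (fun x => conj (e x) * U x) 2 :=
    memLp_continuous_mul (M := 1) (by fun_prop) (fun x => by simp [he1]) hU
  have i4 : Integrable fun x => (conj (e x) * U x).re ^ 2 := m4.re.integrable_sq
  exact ((i2.add i1).sub i3).sub ((i1.add (i4.const_mul 2)).bdd_mul (c := V)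
    hv.aestronglyMeasurable (ae_of_all _ hV))

theorem abs_norm_add_sq_sub_le (X Y : ℂ) {r : ℝ} (hr : 0 < r) :
    |‖X + Y‖ ^ 2 - ‖X‖ ^ 2| ≤ r * ‖X‖ ^ 2 + (1 + r⁻¹) * ‖Y‖ ^ 2 := by
  have h1 := norm_add_le X Y
  have h2 : ‖X‖ - ‖Y‖ ≤ ‖X + Y‖ := by
    have := norm_sub_le (X + Y) Y
    rw [add_sub_cancel_right] at this
    linarith
  have e : 2 * ‖X‖ * ‖Y‖ ≤ r * ‖X‖ ^ 2 + r⁻¹ * ‖Y‖ ^ 2 := by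
    have h : r * ‖X‖ ^ 2 + r⁻¹ * ‖Y‖ ^ 2 - 2 * ‖X‖ * ‖Y‖ = r⁻¹ * (r * ‖X‖ - ‖Y‖) ^ 2 := by
      field_simp; ring
    have : 0 ≤ r⁻¹ * (r * ‖X‖ - ‖Y‖) ^ 2 := by positivity
    linarith
  have n1 := norm_nonneg X
  have n2 := norm_nonneg Y
  have n3 := norm_nonneg (X + Y)
  rw [abs_le]
  constructor
  · rcases le_total ‖X‖ ‖Y‖ with h | h
    · nlinarith [sq_nonneg ‖X + Y‖]
    · nlinarith [pow_le_pow_left₀ (sub_nonneg.2 h) h2 2]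
  · nlinarith [pow_le_pow_left₀ n3 h1 2]

theorem abs_sq_sub_sq_le (a b : ℝ) {r : ℝ} (hr : 0 < r) :
    |(a + b) ^ 2 - a ^ 2| ≤ r * a ^ 2 + (1 + r⁻¹) * b ^ 2 := by
  have h := abs_norm_add_sq_sub_le (a : ℂ) (b : ℂ) hr
  rw [← Complex.ofReal_add] at h
  simpa only [Complex.norm_real, Real.norm_eq_abs, sq_abs] using h

/-- The form depends continuously on the pair `(U, U')`. -/
theorem solitonForm_add_le {ω c v V : ℝ} {e : ℂ} (he : ‖e‖ = 1) (hω : |ω| ≤ 1) (hc : |c| ≤ 1)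
    (hv : |v| ≤ V) (U U' D D' : ℂ) {r : ℝ} (hr : 0 < r) :
    solitonForm ω c v e (U + D) (U' + D') ≤ solitonForm ω c v e U U' +
      (3 + 3 * V) * (r * (‖U‖ ^ 2 + ‖U'‖ ^ 2) + (1 + r⁻¹) * (‖D‖ ^ 2 + ‖D'‖ ^ 2)) := by
  have hlin : ∀ A B : ℂ, ‖Complex.I * (ω : ℂ) * A + (c : ℂ) * B‖ ^ 2 ≤ 2 * (‖A‖ ^ 2 + ‖B‖ ^ 2) := by
    intro A B
    have h1 : ‖Complex.I * (ω : ℂ) * A + (c : ℂ) * B‖ ≤ ‖A‖ + ‖B‖ := by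
      refine (norm_add_le _ _).trans (add_le_add ?_ ?_)
      · rw [norm_mul, norm_mul, Complex.norm_I, one_mul, Complex.norm_real, Real.norm_eq_abs]
        exact mul_le_of_le_one_left (norm_nonneg _) hω
      · rw [norm_mul, Complex.norm_real, Real.norm_eq_abs]
        exact mul_le_of_le_one_left (norm_nonneg _) hc
    nlinarith [pow_le_pow_left₀ (norm_nonneg _) h1 2, sq_nonneg (‖A‖ - ‖B‖)]
  have hre : ∀ A : ℂ, (conj e * A).re ^ 2 ≤ ‖A‖ ^ 2 := by
    intro A
    have h := Complex.abs_re_le_norm (conj e * A)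
    rw [norm_mul, RCLike.norm_conj, he, one_mul] at h
    rw [← sq_abs]
    exact pow_le_pow_left₀ (abs_nonneg _) h 2
  have t1 := abs_norm_add_sq_sub_le U D hr
  have t2 := abs_norm_add_sq_sub_le U' D' hr
  have t3 := abs_norm_add_sq_sub_le (Complex.I * (ω : ℂ) * U + (c : ℂ) * U')
    (Complex.I * (ω : ℂ) * D + (c : ℂ) * D') hr
  have t4 := abs_sq_sub_sq_le (conj e * U).re (conj e * D).re hr
  have e3 : Complex.I * (ω : ℂ) * (U + D) + (c : ℂ) * (U' + D') =
    (Complex.I * (ω : ℂ) * U + (c : ℂ) * U') + (Complex.I * (ω : ℂ) * D + (c : ℂ) * D') := by ring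
  have e4 : (conj e * (U + D)).re = (conj e * U).re + (conj e * D).re := by
    rw [mul_add, Complex.add_re]
  have hr' : 0 < 1 + r⁻¹ := by positivity
  set q := r * (‖U‖ ^ 2 + ‖U'‖ ^ 2) + (1 + r⁻¹) * (‖D‖ ^ 2 + ‖D'‖ ^ 2) with hq
  have b3 : r * ‖Complex.I * (ω : ℂ) * U + (c : ℂ) * U'‖ ^ 2 +
      (1 + r⁻¹) * ‖Complex.I * (ω : ℂ) * D + (c : ℂ) * D'‖ ^ 2 ≤ 2 * q := by
    have := mul_le_mul_of_nonneg_left (hlin U U') hr.le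
    have := mul_le_mul_of_nonneg_left (hlin D D') hr'.le
    rw [hq]
    linarith
  have p1 : 0 ≤ r * ‖U'‖ ^ 2 := by positivity
  have p2 : 0 ≤ (1 + r⁻¹) * ‖D'‖ ^ 2 := by positivity
  have b4 : r * (conj e * U).re ^ 2 + (1 + r⁻¹) * (conj e * D).re ^ 2 ≤ q := by
    have := mul_le_mul_of_nonneg_left (hre U) hr.le
    have := mul_le_mul_of_nonneg_left (hre D) hr'.le
    rw [hq]
    linarith
  have b1 : r * ‖U‖ ^ 2 + (1 + r⁻¹) * ‖D‖ ^ 2 ≤ q := by rw [hq]; linarith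
  have hq0 : 0 ≤ q := by positivity
  have hV0 : 0 ≤ V := (abs_nonneg v).trans hv
  -- the potential term
  have b5 : |v * ((‖U + D‖ ^ 2 + 2 * (conj e * (U + D)).re ^ 2) -
      (‖U‖ ^ 2 + 2 * (conj e * U).re ^ 2))| ≤ V * (3 * q) := by
    rw [abs_mul]
    refine mul_le_mul hv ?_ (abs_nonneg _) hV0
    rw [e4]
    rw [abs_le] at t1 t4 ⊢
    constructor <;> linarith [t1.1, t1.2, t4.1, t4.2]
  rw [solitonForm, solitonForm, e3]
  rw [abs_le] at t1 t2 t3 b5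
  have b12 : r * ‖U‖ ^ 2 + (1 + r⁻¹) * ‖D‖ ^ 2 + (r * ‖U'‖ ^ 2 + (1 + r⁻¹) * ‖D'‖ ^ 2) = q := by
    rw [hq]; ring
  have e6 : v * (‖U‖ ^ 2 + 2 * (conj e * U).re ^ 2) -
      v * (‖U + D‖ ^ 2 + 2 * (conj e * (U + D)).re ^ 2) ≤ V * (3 * q) := by linarith [b5.1]
  linarith [t1.2, t2.2, t3.1]

/-- A coercivity estimate for test functions passes to `H¹` by density. -/
theorem solitonForm_coercive_of_smooth {ι : Type*} [Fintype ι] {ω c V k C : ℝ} (hω : |ω| ≤ 1)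
    (hc : |c| ≤ 1) {v : ℝ → ℝ} {e : ℝ → ℂ} (hv : Continuous v) (hV : ∀ x, |v x| ≤ V)
    (he : Continuous e) (he1 : ∀ x, ‖e x‖ = 1) (hk : 0 < k) (hC : 0 ≤ C) {g : ι → ℝ → ℂ}
    (hg : ∀ i, MemLp (g i) 2)
    (H : ∀ f : ℝ → ℂ, ContDiff ℝ (⊤ : ℕ∞) f → HasCompactSupport f →
      k * ∫ x, (‖f x‖ ^ 2 + ‖deriv f x‖ ^ 2) ≤
        (∫ x, solitonForm ω c (v x) (e x) (f x) (deriv f x)) +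
          C * ∑ i, (∫ x, (conj (g i x) * f x).re) ^ 2)
    {U U' : ℝ → ℂ} (hU : MemLp U 2) (hU' : MemLp U' 2) (hw : HasWeakDeriv U U') :
    k / 4 * ∫ x, (‖U x‖ ^ 2 + ‖U' x‖ ^ 2) ≤
      (∫ x, solitonForm ω c (v x) (e x) (U x) (U' x)) +
        2 * C * ∑ i, (∫ x, (conj (g i x) * U x).re) ^ 2 := by
  have hV0 : 0 ≤ V := (abs_nonneg _).trans (hV 0)
  set M := 3 + 3 * V with hM
  have hM0 : 0 < M := by positivity
  set r := k / (4 * M) with hr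
  have hr0 : 0 < r := by positivity
  set B := k + M * (1 + r⁻¹) + 2 * C * ∑ i, ∫ x, ‖g i x‖ ^ 2 with hB
  have hG : 0 ≤ ∑ i, ∫ x, ‖g i x‖ ^ 2 :=
    Finset.sum_nonneg fun i _ => integral_nonneg fun x => by positivity
  have hB0 : 0 < B := by positivity
  refine le_of_forall_pos_le_add fun η hη => ?_
  obtain ⟨f, hf, hfs, hfη⟩ := exists_test_approx hU hU' hw (div_pos hη hB0)
  have k0 := H f hf hfs
  have mf : MemLp f 2 := memLp_of_continuous_hasCompactSupport hf.continuous hfs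
  have mf' : MemLp (deriv f) 2 := memLp_of_continuous_hasCompactSupport
    (hf.continuous_deriv (by simp)) hfs.deriv
  have md : MemLp (fun x => f x - U x) 2 := mf.sub hU
  have md' : MemLp (fun x => deriv f x - U' x) 2 := mf'.sub hU'
  have iU : Integrable fun x => ‖U x‖ ^ 2 + ‖U' x‖ ^ 2 :=
    (hU.integrable_norm_pow (by norm_num)).add (hU'.integrable_norm_pow (by norm_num))
  have jf : Integrable fun x => ‖f x‖ ^ 2 + ‖deriv f x‖ ^ 2 :=
    (mf.integrable_norm_pow (by norm_num)).add (mf'.integrable_norm_pow (by norm_num))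
  have jd : Integrable fun x => ‖f x - U x‖ ^ 2 + ‖deriv f x - U' x‖ ^ 2 :=
    (md.integrable_norm_pow (by norm_num)).add (md'.integrable_norm_pow (by norm_num))
  have iq := integrable_solitonForm (ω := ω) (c := c) hv hV he he1 hU hU'
  have jq := integrable_solitonForm (ω := ω) (c := c) hv hV he he1 mf mf'
  set d := ∫ x, (‖f x - U x‖ ^ 2 + ‖deriv f x - U' x‖ ^ 2) with hd
  set N := ∫ x, (‖U x‖ ^ 2 + ‖U' x‖ ^ 2) with hN
  have hd0 : 0 ≤ d := integral_nonneg fun x => by positivity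
  have hdB : d * B < η := by rwa [lt_div_iff₀ hB0] at hfη
  have k1 : ∫ x, solitonForm ω c (v x) (e x) (f x) (deriv f x) ≤
      (∫ x, solitonForm ω c (v x) (e x) (U x) (U' x)) + M * (r * N + (1 + r⁻¹) * d) := by
    have i3 : Integrable fun x => M * (r * (‖U x‖ ^ 2 + ‖U' x‖ ^ 2) +
        (1 + r⁻¹) * (‖f x - U x‖ ^ 2 + ‖deriv f x - U' x‖ ^ 2)) :=
      ((iU.const_mul _).add (jd.const_mul _)).const_mul _
    have := integral_mono jq (iq.add i3) fun x => by
      have := solitonForm_add_le (he1 x) hω hc (hV x) (U x) (U' x) (f x - U x)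
        (deriv f x - U' x) hr0
      rw [add_sub_cancel, add_sub_cancel] at this
      exact this
    refine this.trans_eq ?_
    simp only [Pi.add_apply]
    rw [integral_add iq i3, integral_const_mul, integral_add (iU.const_mul _) (jd.const_mul _),
      integral_const_mul, integral_const_mul]
  have k2 : N ≤ 2 * (∫ x, (‖f x‖ ^ 2 + ‖deriv f x‖ ^ 2)) + 2 * d := by
    rw [hd, ← integral_const_mul, ← integral_const_mul,
      ← integral_add (jf.const_mul _) (jd.const_mul _)]
    refine integral_mono iU ((jf.const_mul _).add (jd.const_mul _)) fun x => ?_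
    have h1 : ‖U x‖ ≤ ‖f x‖ + ‖f x - U x‖ := by
      simpa using norm_sub_le (f x) (f x - U x)
    have h2 : ‖U' x‖ ≤ ‖deriv f x‖ + ‖deriv f x - U' x‖ := by
      simpa using norm_sub_le (deriv f x) (deriv f x - U' x)
    simp only
    nlinarith [pow_le_pow_left₀ (norm_nonneg _) h1 2, pow_le_pow_left₀ (norm_nonneg _) h2 2,
      sq_nonneg (‖f x‖ - ‖f x - U x‖), sq_nonneg (‖deriv f x‖ - ‖deriv f x - U' x‖)]
  have k3 : ∑ i, (∫ x, (conj (g i x) * f x).re) ^ 2 ≤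
      2 * (∑ i, (∫ x, (conj (g i x) * U x).re) ^ 2) + 2 * (∑ i, ∫ x, ‖g i x‖ ^ 2) * d := by
    rw [Finset.mul_sum, mul_assoc, Finset.sum_mul, Finset.mul_sum, ← Finset.sum_add_distrib]
    refine Finset.sum_le_sum fun i _ => ?_
    have h1 := sq_integral_re_conj_mul_le (hg i) md
    have h2 : ∫ x, ‖f x - U x‖ ^ 2 ≤ d :=
      integral_mono (md.integrable_norm_pow (by norm_num)) jd fun x => by
        simp only
        nlinarith [sq_nonneg ‖deriv f x - U' x‖]
    have h3 : ∫ x, (conj (g i x) * f x).re =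
        (∫ x, (conj (g i x) * U x).re) + ∫ x, (conj (g i x) * (f x - U x)).re := by
      rw [← integral_add (integrable_re_conj_mul (hg i) hU) (integrable_re_conj_mul (hg i) md)]
      refine integral_congr_ae (ae_of_all _ fun x => ?_)
      simp only [← Complex.add_re]
      congr 1
      ring
    have h4 : 0 ≤ ∫ x, ‖g i x‖ ^ 2 := integral_nonneg fun x => by positivity
    rw [h3]
    nlinarith [mul_le_mul_of_nonneg_left h2 h4, sq_nonneg ((∫ x, (conj (g i x) * U x).re) -
      ∫ x, (conj (g i x) * (f x - U x)).re)]
  have k4 := mul_le_mul_of_nonneg_left k3 hC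
  have k5 := mul_le_mul_of_nonneg_left k2 hk.le
  have hMr : M * r = k / 4 := by rw [hr]; field_simp
  have hdB' : d * B = k * d + M * ((1 + r⁻¹) * d) + C * (2 * (∑ i, ∫ x, ‖g i x‖ ^ 2) * d) := by
    rw [hB]; ring
  have : M * (r * N + (1 + r⁻¹) * d) = k / 4 * N + M * ((1 + r⁻¹) * d) := by
    rw [← hMr]; ring
  linarith

theorem sech_le_sech {x y : ℝ} (h : |y| ≤ |x|) : sech x ≤ sech y :=
  inv_anti₀ (Real.cosh_pos y) (Real.cosh_le_cosh.2 h)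

theorem sech_mul_le {κ κ' : ℝ} (hκ : 0 < κ) (h : κ ≤ κ') (x : ℝ) :
    sech (κ' * x) ≤ sech (κ * x) := by
  refine sech_le_sech ?_
  rw [abs_mul, abs_mul, abs_of_pos hκ, abs_of_pos (hκ.trans_le h)]
  exact mul_le_mul_of_nonneg_right h (abs_nonneg x)

theorem integrable_sech_mul {κ : ℝ} (hκ : 0 < κ) : Integrable fun x => sech (κ * x) :=
  integrable_sech.comp_mul_left' hκ.ne'

theorem continuous_invWidth (c : ℝ) : Continuous fun ω => invWidth ω c := by
  unfold invWidth
  fun_prop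

theorem eventually_one_sub_sq_sub_sq_pos {ω c : ℝ} (h : 0 < 1 - c ^ 2 - ω ^ 2) :
    ∀ᶠ ω' in 𝓝 ω, 0 < 1 - c ^ 2 - ω' ^ 2 :=
  (by fun_prop : Continuous fun ω' : ℝ => 1 - c ^ 2 - ω' ^ 2).continuousAt.eventually
    (lt_mem_nhds h)

/-- `sech²(κ x)` depends continuously on `κ > 0` in `L²`. -/
theorem tendsto_integral_sech_sq_sub {κ : ℝ} (hκ : 0 < κ) :
    Tendsto (fun κ' => ∫ x, (sech (κ' * x) ^ 2 - sech (κ * x) ^ 2) ^ 2) (𝓝 κ) (𝓝 0) := by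
  have h0 : (0 : ℝ) = ∫ x, (sech (κ * x) ^ 2 - sech (κ * x) ^ 2) ^ 2 := by simp
  rw [h0]
  refine tendsto_integral_filter_of_dominated_convergence (fun x => sech (κ / 2 * x))
    (Eventually.of_forall fun κ' => by fun_prop) ?_ (integrable_sech_mul (half_pos hκ))
    (ae_of_all _ fun x => ?_)
  · filter_upwards [lt_mem_nhds (half_lt_self hκ)] with κ' hκ'
    refine ae_of_all _ fun x => ?_
    have h1 := sech_mul_le (half_pos hκ) hκ'.le x
    have h2 := sech_mul_le (half_pos hκ) (half_le_self hκ.le) x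
    have p1 := sech_pos (κ' * x)
    have p2 := sech_pos (κ * x)
    have p3 := sech_pos (κ / 2 * x)
    have p4 := sech_le_one (κ / 2 * x)
    rw [Real.norm_eq_abs, abs_of_nonneg (sq_nonneg _), ← sq_abs]
    have h3 : |sech (κ' * x) ^ 2 - sech (κ * x) ^ 2| ≤ sech (κ / 2 * x) := by
      rw [abs_le]
      constructor <;> nlinarith
    nlinarith [abs_nonneg (sech (κ' * x) ^ 2 - sech (κ * x) ^ 2)]
  · have : Continuous fun κ' => (sech (κ' * x) ^ 2 - sech (κ * x) ^ 2) ^ 2 := by fun_prop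
    exact this.tendsto κ

theorem memLp_two_comp_mul_sub {f : ℝ → ℝ} (hf : Continuous f) {M : ℝ}
    (h : ∀ x, |f x| ≤ M * sech x) {κ : ℝ} (hκ : 0 < κ) (y : ℝ) :
    MemLp (fun x => f (κ * (x - y))) 2 := by
  rw [memLp_two_iff_integrable_sq (by fun_prop)]
  have h1 := (memLp_of_abs_le_sech hf h).integrable_sq
  exact (h1.comp_mul_left' hκ.ne').comp_sub_right y

theorem norm_sq_add_norm_sq_le_of_phase (θ : ℝ) (w w' : ℂ) :
    ‖w‖ ^ 2 + ‖w' + Complex.I * (θ : ℂ) * w‖ ^ 2 ≤ (2 + 2 * θ ^ 2) * (‖w‖ ^ 2 + ‖w'‖ ^ 2) := by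
  have t1 := norm_add_le w' (Complex.I * (θ : ℂ) * w)
  rw [norm_mul (Complex.I * (θ : ℂ)), norm_mul Complex.I, Complex.norm_I, one_mul,
    Complex.norm_real, Real.norm_eq_abs] at t1
  have t2 := pow_le_pow_left₀ (norm_nonneg _) t1 2
  nlinarith [sq_nonneg (‖w'‖ - |θ| * ‖w‖), sq_abs θ, sq_nonneg (θ * ‖w'‖), sq_nonneg (‖w‖)]

set_option maxHeartbeats 800000 in
/-- Coercivity around one soliton for test functions, uniformly for frequencies `ω'` close to
`ω`. -/
theorem soliton_coercive_smooth {ω c : ℝ} (h : 0 < 1 - c ^ 2 - ω ^ 2) :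
    ∃ k, 0 < k ∧ ∃ C, 0 ≤ C ∧ ∀ᶠ ω' in 𝓝 ω, ∀ γ t y : ℝ, ∀ U : ℝ → ℂ,
      ContDiff ℝ (⊤ : ℕ∞) U → HasCompactSupport U →
      k * ∫ x, (‖U x‖ ^ 2 + ‖deriv U x‖ ^ 2) ≤
        (∫ x, solitonForm ω' c (2 * invWidth ω' c ^ 2 * (1 - c ^ 2) *
          sech (invWidth ω' c * (x - y)) ^ 2) (phase ω c γ t x) (U x) (deriv U x)) +
        C * ((∫ x, (conj (phase ω c γ t x) * U x).re * sech (invWidth ω' c * (x - y)) ^ 2) ^ 2 +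
          (∫ x, (conj (phase ω c γ t x) * U x).re * (sech (invWidth ω' c * (x - y)) *
            Real.tanh (invWidth ω' c * (x - y)))) ^ 2 +
          (∫ x, (conj (phase ω c γ t x) * U x).im * sech (invWidth ω' c * (x - y))) ^ 2) := by
  obtain ⟨C, hC, hco⟩ := coercive_complex
  have hD := one_sub_sq_pos h
  set κ := invWidth ω c with hκ
  have hκ0 : 0 < κ := invWidth_pos h
  set θ := ω * c / (1 - c ^ 2) with hθ
  set m := min 1 (κ ^ 2 / 4) with hm
  have hm0 : 0 < m := lt_min one_pos (by positivity)
  set k₁ := (1 - c ^ 2) * m / 56 with hk₁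
  have hk₁0 : 0 < k₁ := by positivity
  refine ⟨k₁ / (2 + 2 * θ ^ 2), by positivity, C * (2 * κ) ^ 3, by positivity, ?_⟩
  have ev1 := eventually_one_sub_sq_sub_sq_pos h
  have ev2 : ∀ᶠ ω' in 𝓝 ω, κ / 2 < invWidth ω' c :=
    (continuous_invWidth c).continuousAt.eventually (lt_mem_nhds (half_lt_self hκ0))
  have ev3 : ∀ᶠ ω' in 𝓝 ω, invWidth ω' c < 2 * κ :=
    (continuous_invWidth c).continuousAt.eventually (gt_mem_nhds (by linarith))
  have ev4 : ∀ᶠ ω' in 𝓝 ω, |ω - ω'| < k₁ := by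
    filter_upwards [Metric.ball_mem_nhds ω hk₁0] with ω' hω'
    rwa [Metric.mem_ball, dist_comm, Real.dist_eq] at hω'
  filter_upwards [ev1, ev2, ev3, ev4] with ω' h1 h2 h3 h4 γ t y U hU hUs
  set κ' := invWidth ω' c with hκ'
  have hκ'0 : 0 < κ' := invWidth_pos h1
  set e : ℝ → ℂ := phase ω c γ t with he
  have hec : Continuous e := continuous_phase ω c γ t
  have he1 : ∀ x, ‖e x‖ = 1 := fun x => norm_phase ω c γ t x
  have hed : ∀ x, HasDerivAt e (Complex.I * (θ : ℂ) * e x) x := fun x => hasDerivAt_phase ω c γ t x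
  have hcee : ∀ x, conj (e x) * e x = 1 := fun x => conj_phase_mul_phase ω c γ t x
  set w : ℝ → ℂ := fun x => conj (e x) * U x with hw
  set w' : ℝ → ℂ := fun x => conj (e x) * (deriv U x - Complex.I * (θ : ℂ) * U x) with hw'
  have hUc := hU.continuous
  have hU'c : Continuous (deriv U) := hU.continuous_deriv (by simp)
  have hwd : ∀ x, HasDerivAt w (w' x) x := by
    intro x
    have d1 : HasDerivAt (fun x => conj (e x)) (conj (Complex.I * (θ : ℂ) * e x)) x := by
      simpa using (hed x).star
    refine (d1.fun_mul ((hU.differentiable (by simp)) x).hasDerivAt).congr_deriv ?_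
    simp only [hw', map_mul, Complex.conj_I, Complex.conj_ofReal]
    ring
  have hw'c : Continuous w' := by fun_prop
  have hwc : Continuous w := by fun_prop
  have hws : HasCompactSupport w := hUs.mul_left
  have k := hco κ' y hκ'0 w w' hwd hw'c hws
  have hUw : ∀ x, U x = e x * w x := fun x => by
    rw [hw]
    simp only
    linear_combination (-U x) * hcee x
  have hUw' : ∀ x, deriv U x = e x * (w' x + Complex.I * (θ : ℂ) * w x) := fun x => by
    rw [hw, hw']
    simp only
    linear_combination (-deriv U x) * hcee x
  have mw : MemLp w 2 := memLp_of_continuous_hasCompactSupport hwc hws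
  have hw's : HasCompactSupport w' := by
    have : w' = deriv w := funext fun x => (hwd x).deriv.symm
    rw [this]
    exact hws.deriv
  have mw' : MemLp w' 2 := memLp_of_continuous_hasCompactSupport hw'c hw's
  have mU : MemLp U 2 := memLp_of_continuous_hasCompactSupport hUc hUs
  have mU' : MemLp (deriv U) 2 := memLp_of_continuous_hasCompactSupport hU'c hUs.deriv
  have iw : Integrable fun x => ‖w x‖ ^ 2 := mw.integrable_norm_pow (by norm_num)
  have iw' : Integrable fun x => ‖w' x‖ ^ 2 := mw'.integrable_norm_pow (by norm_num)
  set S : ℝ → ℝ := fun x => sech (κ' * (x - y)) with hS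
  have hS0 : ∀ x, |S x| ≤ 1 := fun x => by
    rw [abs_of_pos (sech_pos _)]; exact sech_le_one _
  have iqw : Integrable fun x => ‖w' x‖ ^ 2 + κ' ^ 2 * ‖w x‖ ^ 2 -
      2 * κ' ^ 2 * S x ^ 2 * (‖w x‖ ^ 2 + 2 * (w x).re ^ 2) := by
    refine (iw'.add (iw.const_mul _)).sub ?_
    refine (Continuous.integrable_of_hasCompactSupport (by fun_prop)
      (HasCompactSupport.intro hws.isCompact fun x hx => ?_))
    simp [image_eq_zero_of_notMem_tsupport hx]
  set v : ℝ → ℝ := fun x => 2 * κ' ^ 2 * (1 - c ^ 2) * S x ^ 2 with hv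
  have hvc : Continuous v := by fun_prop
  have hvb : ∀ x, |v x| ≤ 2 * κ' ^ 2 * (1 - c ^ 2) := fun x => by
    have hs : 0 ≤ S x ^ 2 := by positivity
    have hs1 : S x ^ 2 ≤ 1 := (sq_le_one_iff_abs_le_one _).2 (hS0 x)
    have hp : 0 ≤ 2 * κ' ^ 2 * (1 - c ^ 2) := by positivity
    rw [abs_of_nonneg (mul_nonneg hp hs)]
    exact mul_le_of_le_one_right hp hs1
  have iq := integrable_solitonForm (ω := ω') (c := c) hvc hvb hec he1 mU mU'
  have hc1 : |c| ≤ 1 := by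
    rw [← sq_le_one_iff_abs_le_one]; linarith
  -- the form in terms of `w`, up to an error of size `|ω - ω'|`
  have K1 : (1 - c ^ 2) * (∫ x, (‖w' x‖ ^ 2 + κ' ^ 2 * ‖w x‖ ^ 2 -
      2 * κ' ^ 2 * S x ^ 2 * (‖w x‖ ^ 2 + 2 * (w x).re ^ 2))) - k₁ * (∫ x, (‖w x‖ ^ 2 + ‖w' x‖ ^ 2))
      ≤ ∫ x, solitonForm ω' c (v x) (e x) (U x) (deriv U x) := by
    have iww : Integrable fun x => ‖w x‖ ^ 2 + ‖w' x‖ ^ 2 := iw.add iw'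
    rw [← integral_const_mul, ← integral_const_mul,
      ← integral_sub (iqw.const_mul _) (iww.const_mul _)]
    refine integral_mono ((iqw.const_mul _).sub (iww.const_mul _)) iq fun x => ?_
    simp only
    rw [hUw' x, hUw x, solitonForm_mul_phase (he1 x) h1]
    have p1 : 0 ≤ c ^ 2 * (ω - ω') ^ 2 / (1 - c ^ 2) * ‖w x‖ ^ 2 := by positivity
    have p2 : |2 * c * (ω - ω') * (w' x * conj (w x)).im| ≤ k₁ * (‖w x‖ ^ 2 + ‖w' x‖ ^ 2) := by
      have q1 := Complex.abs_im_le_norm (w' x * conj (w x))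
      rw [norm_mul, RCLike.norm_conj] at q1
      rw [abs_mul, abs_mul, abs_mul, abs_of_pos (two_pos : (0 : ℝ) < 2)]
      calc 2 * |c| * |ω - ω'| * |(w' x * conj (w x)).im|
          ≤ 2 * 1 * k₁ * (‖w' x‖ * ‖w x‖) := by gcongr
        _ ≤ _ := by nlinarith [sq_nonneg (‖w' x‖ - ‖w x‖)]
    have := (abs_le.1 p2).1
    simp only [hv]
    linarith
  have K2 : m * (∫ x, (‖w x‖ ^ 2 + ‖w' x‖ ^ 2)) ≤ ∫ x, (‖w' x‖ ^ 2 + κ' ^ 2 * ‖w x‖ ^ 2) := by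
    rw [← integral_const_mul]
    refine integral_mono ((iw.add iw').const_mul _) (iw'.add (iw.const_mul _)) fun x => ?_
    simp only
    have m1 : m ≤ 1 := min_le_left _ _
    have m2 : m ≤ κ' ^ 2 := (min_le_right _ _).trans (by nlinarith)
    nlinarith [mul_le_mul_of_nonneg_right m1 (sq_nonneg ‖w' x‖),
      mul_le_mul_of_nonneg_right m2 (sq_nonneg ‖w x‖)]
  have K3 : ∫ x, (‖U x‖ ^ 2 + ‖deriv U x‖ ^ 2) ≤
      (2 + 2 * θ ^ 2) * ∫ x, (‖w x‖ ^ 2 + ‖w' x‖ ^ 2) := by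
    rw [← integral_const_mul]
    refine integral_mono ((mU.integrable_norm_pow (by norm_num)).add
      (mU'.integrable_norm_pow (by norm_num))) ((iw.add iw').const_mul _) fun x => ?_
    simp only
    have s1 : ‖U x‖ = ‖w x‖ := by rw [hUw x, norm_mul, he1, one_mul]
    have s2 : ‖deriv U x‖ = ‖w' x + Complex.I * (θ : ℂ) * w x‖ := by
      rw [hUw' x, norm_mul, he1, one_mul]
    rw [s1, s2]
    exact norm_sq_add_norm_sq_le_of_phase θ (w x) (w' x)
  set Q := (∫ x, (w x).re * S x ^ 2) ^ 2 + (∫ x, (w x).re * (S x * Real.tanh (κ' * (x - y)))) ^ 2 +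
    (∫ x, (w x).im * S x) ^ 2 with hQ
  have hQ0 : 0 ≤ Q := by positivity
  have K4 : C * κ' ^ 3 * Q * (1 - c ^ 2) ≤ C * (2 * κ) ^ 3 * Q := by
    have a1 : κ' ^ 3 ≤ (2 * κ) ^ 3 := pow_le_pow_left₀ hκ'0.le h3.le 3
    have a2 : 1 - c ^ 2 ≤ 1 := by nlinarith [sq_nonneg c]
    calc C * κ' ^ 3 * Q * (1 - c ^ 2) ≤ C * κ' ^ 3 * Q * 1 := by gcongr
      _ ≤ C * (2 * κ) ^ 3 * Q := by rw [mul_one]; gcongr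
  set E := ∫ x, (‖w x‖ ^ 2 + ‖w' x‖ ^ 2) with hE
  have K5 : k₁ / (2 + 2 * θ ^ 2) * ∫ x, (‖U x‖ ^ 2 + ‖deriv U x‖ ^ 2) ≤ k₁ * E := by
    have : k₁ * E = k₁ / (2 + 2 * θ ^ 2) * ((2 + 2 * θ ^ 2) * E) := by field_simp
    rw [this]
    exact mul_le_mul_of_nonneg_left K3 (by positivity)
  have K6 := mul_le_mul_of_nonneg_left k hD.le
  have K7 := mul_le_mul_of_nonneg_left K2 hD.le
  have K8 : (1 - c ^ 2) * (m * E) = 56 * k₁ * E := by rw [hk₁]; ring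
  change _ ≤ (∫ x, solitonForm ω' c (v x) (e x) (U x) (deriv U x)) + C * (2 * κ) ^ 3 * Q
  rw [mul_add] at K6
  linarith

/-- Coercivity around one soliton in `H¹`, uniformly for frequencies `ω'` close to `ω`. The
negative direction `sech²` belongs to the frequency `ω`, the two others to `ω'`. -/
theorem soliton_coercive {ω c : ℝ} (h : 0 < 1 - c ^ 2 - ω ^ 2) :
    ∃ k, 0 < k ∧ ∃ C, 0 ≤ C ∧ ∀ᶠ ω' in 𝓝 ω, ∀ γ t y : ℝ, ∀ U U' : ℝ → ℂ,
      MemLp U 2 → MemLp U' 2 → HasWeakDeriv U U' →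
      k * ∫ x, (‖U x‖ ^ 2 + ‖U' x‖ ^ 2) ≤
        (∫ x, solitonForm ω' c (2 * invWidth ω' c ^ 2 * (1 - c ^ 2) *
          sech (invWidth ω' c * (x - y)) ^ 2) (phase ω c γ t x) (U x) (U' x)) +
        C * ((∫ x, (conj (phase ω c γ t x) * U x).re * sech (invWidth ω c * (x - y)) ^ 2) ^ 2 +
          (∫ x, (conj (phase ω c γ t x) * U x).re * (sech (invWidth ω' c * (x - y)) *
            Real.tanh (invWidth ω' c * (x - y)))) ^ 2 +
          (∫ x, (conj (phase ω c γ t x) * U x).im * sech (invWidth ω' c * (x - y))) ^ 2) := by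
  obtain ⟨k, hk, C, hC, hev⟩ := soliton_coercive_smooth h
  have hD := one_sub_sq_pos h
  have hκ0 : 0 < invWidth ω c := invWidth_pos h
  refine ⟨k / 8, by positivity, 4 * C, by positivity, ?_⟩
  have ev1 := eventually_one_sub_sq_sub_sq_pos h
  have hη : 0 < k / (32 * (C + 1)) := by positivity
  have ev2 : ∀ᶠ ω' in 𝓝 ω,
      ∫ x, (sech (invWidth ω' c * x) ^ 2 - sech (invWidth ω c * x) ^ 2) ^ 2 <
        k / (32 * (C + 1)) :=
    ((tendsto_integral_sech_sq_sub hκ0).comp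
      ((continuous_invWidth c).tendsto ω)).eventually (gt_mem_nhds hη)
  filter_upwards [hev, ev1, ev2] with ω' hsm h1 h2 γ t y U U' hU hU' hw
  set κ := invWidth ω c with hκ
  set κ' := invWidth ω' c with hκ'
  have hκ'0 : 0 < κ' := invWidth_pos h1
  set e : ℝ → ℂ := phase ω c γ t with he
  have hec : Continuous e := continuous_phase ω c γ t
  have he1 : ∀ x, ‖e x‖ = 1 := fun x => norm_phase ω c γ t x
  have hc1 : |c| ≤ 1 := by
    rw [← sq_le_one_iff_abs_le_one]; linarith
  have hω1 : |ω'| ≤ 1 := by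
    rw [← sq_le_one_iff_abs_le_one]; nlinarith [sq_nonneg c]
  have mS : MemLp (fun x => sech (κ' * (x - y)) ^ 2) 2 :=
    memLp_two_comp_mul_sub (by fun_prop) abs_sech_sq_le hκ'0 y
  have mS0 : MemLp (fun x => sech (κ * (x - y)) ^ 2) 2 :=
    memLp_two_comp_mul_sub (by fun_prop) abs_sech_sq_le hκ0 y
  have mT : MemLp (fun x => sech (κ' * (x - y)) * Real.tanh (κ' * (x - y))) 2 :=
    memLp_two_comp_mul_sub (f := fun x => sech x * Real.tanh x) (by fun_prop)
      abs_sech_mul_tanh_le hκ'0 y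
  have mQ : MemLp (fun x => sech (κ' * (x - y))) 2 :=
    memLp_two_comp_mul_sub (M := 1) continuous_sech (fun x => by
      rw [abs_of_pos (sech_pos x), one_mul]) hκ'0 y
  have hgm : ∀ (z : ℂ), ‖z‖ ≤ 1 → ∀ F : ℝ → ℝ, MemLp F 2 →
      MemLp (fun x => z * e x * (F x : ℂ)) 2 := fun z hz F hF =>
    memLp_continuous_mul (M := 1) (by fun_prop) (fun x => by
      rw [norm_mul, he1, mul_one]; exact hz) hF.ofReal
  set g : Fin 3 → ℝ → ℂ := ![fun x => 1 * e x * ((sech (κ' * (x - y)) ^ 2 : ℝ) : ℂ),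
    fun x => 1 * e x * ((sech (κ' * (x - y)) * Real.tanh (κ' * (x - y)) : ℝ) : ℂ),
    fun x => Complex.I * e x * ((sech (κ' * (x - y)) : ℝ) : ℂ)] with hg
  have hg2 : ∀ i, MemLp (g i) 2 := by
    intro i
    fin_cases i
    · exact hgm 1 (by simp) _ mS
    · exact hgm 1 (by simp) _ mT
    · exact hgm Complex.I (by simp) _ mQ
  have hg0 : ∀ f : ℝ → ℂ, ∑ i, (∫ x, (conj (g i x) * f x).re) ^ 2 =
      (∫ x, (conj (e x) * f x).re * sech (κ' * (x - y)) ^ 2) ^ 2 +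
      (∫ x, (conj (e x) * f x).re * (sech (κ' * (x - y)) * Real.tanh (κ' * (x - y)))) ^ 2 +
      (∫ x, (conj (e x) * f x).im * sech (κ' * (x - y))) ^ 2 := by
    intro f
    rw [Fin.sum_univ_three]
    congr 1
    · congr 1
      · congr 1
        refine integral_congr_ae (ae_of_all _ fun x => ?_)
        simp [hg, -Complex.ofReal_pow]
        ring
      · congr 1
        refine integral_congr_ae (ae_of_all _ fun x => ?_)
        simp [hg, -Complex.ofReal_mul, -Complex.ofReal_tanh]
        ring
    · congr 1
      refine integral_congr_ae (ae_of_all _ fun x => ?_)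
      simp [hg]
      ring
  have hvb : ∀ x, |2 * κ' ^ 2 * (1 - c ^ 2) * sech (κ' * (x - y)) ^ 2| ≤
      2 * κ' ^ 2 * (1 - c ^ 2) := fun x => by
    have hs1 : sech (κ' * (x - y)) ^ 2 ≤ 1 := pow_le_one₀ (sech_pos _).le (sech_le_one _)
    have hp : 0 ≤ 2 * κ' ^ 2 * (1 - c ^ 2) := by positivity
    rw [abs_of_nonneg (mul_nonneg hp (sq_nonneg _))]
    exact mul_le_of_le_one_right hp hs1
  have main := solitonForm_coercive_of_smooth (e := e) hω1 hc1
    (v := fun x => 2 * κ' ^ 2 * (1 - c ^ 2) * sech (κ' * (x - y)) ^ 2) (by fun_prop) hvb hec he1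
    hk hC hg2 (fun f hf hfs => by rw [hg0]; exact hsm γ t y f hf hfs) hU hU' hw
  rw [hg0] at main
  -- replacing `sech²(κ' x)` by `sech²(κ x)`
  have mre : MemLp (fun x => (conj (e x) * U x).re) 2 :=
    (memLp_continuous_mul (M := 1) (by fun_prop) (fun x => by simp [he1]) hU).re
  have iU := hU.integrable_norm_pow (p := 2) (by norm_num)
  have hreU : ∫ x, (conj (e x) * U x).re ^ 2 ≤ ∫ x, ‖U x‖ ^ 2 := by
    refine integral_mono mre.integrable_sq iU fun x => ?_
    have h := Complex.abs_re_le_norm (conj (e x) * U x)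
    rw [norm_mul, RCLike.norm_conj, he1, one_mul] at h
    simp only
    rw [← sq_abs]
    exact pow_le_pow_left₀ (abs_nonneg _) h 2
  have hUU : ∫ x, ‖U x‖ ^ 2 ≤ ∫ x, (‖U x‖ ^ 2 + ‖U' x‖ ^ 2) :=
    integral_mono iU (iU.add (hU'.integrable_norm_pow (by norm_num))) fun x => by
      simp only; nlinarith [sq_nonneg ‖U' x‖]
  have hshift : ∫ x, (sech (κ' * (x - y)) ^ 2 - sech (κ * (x - y)) ^ 2) ^ 2 =
      ∫ x, (sech (κ' * x) ^ 2 - sech (κ * x) ^ 2) ^ 2 :=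
    integral_sub_right_eq_self (fun x => (sech (κ' * x) ^ 2 - sech (κ * x) ^ 2) ^ 2) y
  have hcs := sq_integral_mul_le mre (mS.sub mS0)
  simp only [Pi.sub_apply] at hcs
  rw [hshift] at hcs
  have hsplit : ∫ x, (conj (e x) * U x).re * sech (κ' * (x - y)) ^ 2 =
      (∫ x, (conj (e x) * U x).re * sech (κ * (x - y)) ^ 2) +
      ∫ x, (conj (e x) * U x).re * (sech (κ' * (x - y)) ^ 2 - sech (κ * (x - y)) ^ 2) := by
    have i1 : Integrable fun x => (conj (e x) * U x).re * sech (κ * (x - y)) ^ 2 :=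
      mre.integrable_mul mS0
    have i2 : Integrable fun x => (conj (e x) * U x).re *
      (sech (κ' * (x - y)) ^ 2 - sech (κ * (x - y)) ^ 2) := mre.integrable_mul (mS.sub mS0)
    rw [← integral_add i1 i2]
    exact integral_congr_ae (ae_of_all _ fun x => by ring)
  set N := ∫ x, (‖U x‖ ^ 2 + ‖U' x‖ ^ 2) with hN
  have hN0 : 0 ≤ N := integral_nonneg fun x => by positivity
  set A := ∫ x, (conj (e x) * U x).re * sech (κ * (x - y)) ^ 2 with hA
  set B := ∫ x, (conj (e x) * U x).re * (sech (κ' * (x - y)) ^ 2 - sech (κ * (x - y)) ^ 2) with hB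
  have hBN : B ^ 2 ≤ N * (k / (32 * (C + 1))) := by
    refine hcs.trans (mul_le_mul (hreU.trans hUU) h2.le (integral_nonneg fun x => by positivity) hN0)
  have hCB : 4 * C * B ^ 2 ≤ k / 8 * N := by
    have h3 : 4 * C * B ^ 2 ≤ 4 * C * (N * (k / (32 * (C + 1)))) :=
      mul_le_mul_of_nonneg_left hBN (by positivity)
    have h4 : 4 * C * (N * (k / (32 * (C + 1)))) = k / 8 * N * (C / (C + 1)) := by
      field_simp; ring
    have h5 : C / (C + 1) ≤ 1 := (div_le_one (by positivity)).2 (by linarith)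
    rw [h4] at h3
    exact h3.trans (mul_le_of_le_one_right (by positivity) h5)
  rw [hsplit] at main
  have hAB : (A + B) ^ 2 ≤ 2 * A ^ 2 + 2 * B ^ 2 := by nlinarith [sq_nonneg (A - B)]
  have hAB' := mul_le_mul_of_nonneg_left hAB (by positivity : 0 ≤ 2 * C)
  have n1 := mul_nonneg hC (sq_nonneg
    (∫ x, (conj (e x) * U x).re * (sech (κ' * (x - y)) * Real.tanh (κ' * (x - y)))))
  have n2 := mul_nonneg hC (sq_nonneg (∫ x, (conj (e x) * U x).im * sech (κ' * (x - y))))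
  linarith

/-! ### Elimination of the last three components and localization -/

theorem norm_lin_sq_le (Ω C : ℝ) (u ux : ℂ) :
    ‖Complex.I * (Ω : ℂ) * u + (C : ℂ) * ux‖ ^ 2 ≤ (Ω ^ 2 + C ^ 2) * (‖u‖ ^ 2 + ‖ux‖ ^ 2) := by
  have t1 := norm_add_le (Complex.I * (Ω : ℂ) * u) ((C : ℂ) * ux)
  rw [norm_mul (Complex.I * (Ω : ℂ)), norm_mul Complex.I, Complex.norm_I, one_mul,
    Complex.norm_real, norm_mul (C : ℂ), Complex.norm_real, Real.norm_eq_abs,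
    Real.norm_eq_abs] at t1
  have t2 := pow_le_pow_left₀ (norm_nonneg _) t1 2
  nlinarith [sq_nonneg (|Ω| * ‖ux‖ - |C| * ‖u‖), sq_abs Ω, sq_abs C]

/-- Completing the square in `ρ`. -/
theorem sq_norm_sub_lin (Ω C : ℝ) (u ux ρ : ℂ) (s : ℝ) :
    ‖ρ - (s : ℂ) * (Complex.I * (Ω : ℂ) * u + (C : ℂ) * ux)‖ ^ 2 =
      ‖ρ‖ ^ 2 + s * (-2 * Ω * (conj u * ρ).im - 2 * C * (ux * conj ρ).re) +
        s ^ 2 * ‖Complex.I * (Ω : ℂ) * u + (C : ℂ) * ux‖ ^ 2 := by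
  simp only [Complex.sq_norm, Complex.normSq_apply, Complex.add_re, Complex.add_im,
    Complex.sub_re, Complex.sub_im,
    Complex.mul_re, Complex.mul_im, Complex.I_re, Complex.I_im, Complex.ofReal_re,
    Complex.ofReal_im, Complex.conj_re, Complex.conj_im]
  ring

/-- Minimizing over `ρ`, `v`, `n`. Here `w` stands for the potential terms and `r` for the
coupling of the first component with `v`. -/
theorem reduced_le_density {α C Ω w r v n : ℝ} {u ux ρ : ℂ} (hα : 0 ≤ α) (hC : C ^ 2 < 1) :
    ‖ux‖ ^ 2 + ‖u‖ ^ 2 - ‖Complex.I * (Ω : ℂ) * u + (C : ℂ) * ux‖ ^ 2 + w -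
      2 * α / (1 - C ^ 2) * r ^ 2 ≤
    ‖ux‖ ^ 2 + ‖u‖ ^ 2 + ‖ρ‖ ^ 2 + α / 2 * v ^ 2 + α / 2 * n ^ 2 + (w + 2 * α * r * v) +
      (α * C * (v * n) - 2 * Ω * (conj u * ρ).im - 2 * C * (ux * conj ρ).re) := by
  have h1 := sq_norm_sub_lin Ω C u ux ρ 1
  have h2 := sq_nonneg ‖ρ - ((1 : ℝ) : ℂ) * (Complex.I * (Ω : ℂ) * u + (C : ℂ) * ux)‖
  have hD : 0 < 1 - C ^ 2 := by linarith
  have h3 : α / 2 * v ^ 2 + α / 2 * n ^ 2 + α * C * (v * n) + 2 * α * r * v +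
      2 * α / (1 - C ^ 2) * r ^ 2 = α / 2 * (n + C * v) ^ 2 +
        α / 2 * (1 - C ^ 2) * (v + 2 * r / (1 - C ^ 2)) ^ 2 := by
    field_simp
    ring
  have h4 : 0 ≤ α / 2 * (n + C * v) ^ 2 +
        α / 2 * (1 - C ^ 2) * (v + 2 * r / (1 - C ^ 2)) ^ 2 := by positivity
  linarith

/-- The density controls the last three components up to the first one. -/
theorem le_density {α C Ω w r v n k₀ B M : ℝ} {u ux ρ : ℂ} (hα : 0 < α) (hk : 0 < k₀)
    (hM : 0 ≤ M)
    (hC : C ^ 2 + Ω ^ 2 ≤ 1 - k₀) (hr : |r| ≤ B * ‖u‖) (hw : |w| ≤ M * ‖u‖ ^ 2) :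
    min (1 / 2) (α * k₀ / 8) * (‖ρ‖ ^ 2 + v ^ 2 + n ^ 2) -
      (2 + 8 * α / k₀ * B ^ 2 + M) * (‖u‖ ^ 2 + ‖ux‖ ^ 2) ≤
    ‖ux‖ ^ 2 + ‖u‖ ^ 2 + ‖ρ‖ ^ 2 + α / 2 * v ^ 2 + α / 2 * n ^ 2 + (w + 2 * α * r * v) +
      (α * C * (v * n) - 2 * Ω * (conj u * ρ).im - 2 * C * (ux * conj ρ).re) := by
  have h1 := sq_norm_sub_lin Ω C u ux ρ 2
  have h2 := sq_nonneg ‖ρ - ((2 : ℝ) : ℂ) * (Complex.I * (Ω : ℂ) * u + (C : ℂ) * ux)‖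
  have hE : 0 ≤ ‖u‖ ^ 2 + ‖ux‖ ^ 2 := by positivity
  have h3 : ‖Complex.I * (Ω : ℂ) * u + (C : ℂ) * ux‖ ^ 2 ≤ ‖u‖ ^ 2 + ‖ux‖ ^ 2 := by
    refine (norm_lin_sq_le Ω C u ux).trans (mul_le_of_le_one_left hE (by linarith))
  have hC1 : |C| ≤ 1 - k₀ / 2 := by
    refine abs_le_of_sq_le_sq ?_ ?_ <;> nlinarith [sq_nonneg C, sq_nonneg Ω, sq_nonneg k₀]
  have h4 : -((1 - k₀ / 2) * (v ^ 2 + n ^ 2) / 2) ≤ C * (v * n) := by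
    have a1 : |C * (v * n)| ≤ (1 - k₀ / 2) * ((v ^ 2 + n ^ 2) / 2) := by
      rw [abs_mul]
      refine mul_le_mul hC1 ?_ (abs_nonneg _) ((abs_nonneg C).trans hC1)
      rw [abs_le]
      constructor <;> nlinarith [sq_nonneg (v - n), sq_nonneg (v + n)]
    linarith [(abs_le.1 a1).1]
  have h5 : -(k₀ / 8 * v ^ 2 + 8 / k₀ * r ^ 2) ≤ 2 * r * v := by
    have : 2 * r * v + (k₀ / 8 * v ^ 2 + 8 / k₀ * r ^ 2) = k₀ / 8 * (v + 8 / k₀ * r) ^ 2 := by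
      field_simp; ring
    have h : 0 ≤ k₀ / 8 * (v + 8 / k₀ * r) ^ 2 := by positivity
    linarith
  have h6 : r ^ 2 ≤ B ^ 2 * ‖u‖ ^ 2 := by
    rw [← mul_pow, ← sq_abs r]
    exact pow_le_pow_left₀ (abs_nonneg _) hr 2
  have hα4 := mul_le_mul_of_nonneg_left h4 hα.le
  have hα5 := mul_le_mul_of_nonneg_left h5 hα.le
  have hα6 := mul_le_mul_of_nonneg_left h6 (by positivity : 0 ≤ 8 * α / k₀)
  have hα6' : α * (8 / k₀ * r ^ 2) = 8 * α / k₀ * r ^ 2 := by ring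
  have hux : 0 ≤ 8 * α / k₀ * B ^ 2 * ‖ux‖ ^ 2 := by positivity
  have hMu : 0 ≤ M * ‖ux‖ ^ 2 := by positivity
  set m := min (1 / 2) (α * k₀ / 8) with hm
  have m1 : m * ‖ρ‖ ^ 2 ≤ 1 / 2 * ‖ρ‖ ^ 2 :=
    mul_le_mul_of_nonneg_right (min_le_left _ _) (sq_nonneg _)
  have m2 : m * (v ^ 2 + n ^ 2) ≤ α * k₀ / 8 * (v ^ 2 + n ^ 2) :=
    mul_le_mul_of_nonneg_right (min_le_right _ _) (by positivity)
  have hn : 0 ≤ α * k₀ / 8 * n ^ 2 := by positivity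
  have hw' := (abs_le.1 hw).1
  linarith

/-- The density left after minimizing over the last three components, for solitons of phase
factors `e i` and amplitudes `f i`; `C` and `Ω` are the local averages of speeds and
frequencies. -/
def reducedForm {ι : Type*} [Fintype ι] (α β : ℝ) (c : ι → ℝ) (C Ω : ℝ) (f : ι → ℝ) (e : ι → ℂ)
    (u ux : ℂ) : ℝ :=
  ‖ux‖ ^ 2 + ‖u‖ ^ 2 - ‖Complex.I * (Ω : ℂ) * u + (C : ℂ) * ux‖ ^ 2 +
    ∑ i, ((β - α / (1 - c i ^ 2)) * f i ^ 2 * ‖u‖ ^ 2 +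
      2 * β * (f i * (conj (e i) * u).re) ^ 2) -
    2 * α / (1 - C ^ 2) * (∑ i, f i * (conj (e i) * u).re) ^ 2

/-- Averages of subluminal pairs are subluminal. -/
theorem sq_sum_add_sq_sum_le {ι : Type*} [Fintype ι] {p c ω : ι → ℝ} {k₀ : ℝ}
    (hk1 : k₀ ≤ 1) (hp0 : ∀ i, 0 ≤ p i) (hp1 : ∑ i, p i ≤ 1)
    (hk : ∀ i, c i ^ 2 + ω i ^ 2 ≤ 1 - k₀) :
    (∑ i, p i * c i) ^ 2 + (∑ i, p i * ω i) ^ 2 ≤ 1 - k₀ := by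
  have hS : 0 ≤ ∑ i, p i := Finset.sum_nonneg fun i _ => hp0 i
  have h : ∀ a : ι → ℝ, (∑ i, p i * a i) ^ 2 ≤ (∑ i, p i) * ∑ i, p i * a i ^ 2 := fun a =>
    Finset.sum_sq_le_sum_mul_sum_of_sq_le_mul _ (fun i _ => hp0 i)
      (fun i _ => mul_nonneg (hp0 i) (sq_nonneg _)) fun i _ => le_of_eq (by ring)
  have h3 : (∑ i, p i * c i ^ 2) + ∑ i, p i * ω i ^ 2 ≤ (∑ i, p i) * (1 - k₀) := by
    rw [← Finset.sum_add_distrib, Finset.sum_mul]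
    refine Finset.sum_le_sum fun i _ => ?_
    rw [← mul_add]
    exact mul_le_mul_of_nonneg_left (hk i) (hp0 i)
  have h4 := mul_le_mul_of_nonneg_left h3 hS
  have h5 : (∑ i, p i) * ((∑ i, p i) * (1 - k₀)) ≤ 1 - k₀ := by
    rw [← mul_assoc]
    exact mul_le_of_le_one_left (by linarith) (mul_le_one₀ hp1 hS hp1)
  linarith [h c, h ω]

theorem abs_re_conj_mul_le {e u : ℂ} (he : ‖e‖ = 1) : |(conj e * u).re| ≤ ‖u‖ := by
  have h := Complex.abs_re_le_norm (conj e * u)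
  rwa [norm_mul, RCLike.norm_conj, he, one_mul] at h

theorem abs_amplitude_mul_le {e u : ℂ} {f A : ℝ} (he : ‖e‖ = 1) (h0 : 0 ≤ f) (hA : f ≤ A) :
    |f * (conj e * u).re| ≤ A * ‖u‖ := by
  rw [abs_mul, abs_of_nonneg h0]
  exact mul_le_mul hA (abs_re_conj_mul_le he) (abs_nonneg _) (h0.trans hA)

/-- The potential of one soliton is bounded by the square of its amplitude. -/
theorem abs_potential_le {b β B f A : ℝ} {e u : ℂ} (he : ‖e‖ = 1) (hb : |b| ≤ B) (hβ : |β| ≤ B)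
    (h0 : 0 ≤ f) (hA : f ≤ A) :
    |b * f ^ 2 * ‖u‖ ^ 2 + 2 * β * (f * (conj e * u).re) ^ 2| ≤ 3 * B * A ^ 2 * ‖u‖ ^ 2 := by
  have hB : 0 ≤ B := (abs_nonneg b).trans hb
  have hf : f ^ 2 ≤ A ^ 2 := pow_le_pow_left₀ h0 hA 2
  have h1 : |b * f ^ 2 * ‖u‖ ^ 2| ≤ B * A ^ 2 * ‖u‖ ^ 2 := by
    rw [abs_mul, abs_mul, abs_of_nonneg (sq_nonneg f), abs_of_nonneg (sq_nonneg ‖u‖)]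
    gcongr
  have h2 : (f * (conj e * u).re) ^ 2 ≤ A ^ 2 * ‖u‖ ^ 2 := by
    rw [← mul_pow, ← sq_abs]
    exact pow_le_pow_left₀ (abs_nonneg _) (abs_amplitude_mul_le he h0 hA) 2
  have h3 : |2 * β * (f * (conj e * u).re) ^ 2| ≤ 2 * B * (A ^ 2 * ‖u‖ ^ 2) := by
    rw [abs_mul, abs_mul, abs_of_nonneg (sq_nonneg (f * _)), abs_two]
    gcongr
  refine (abs_add_le _ _).trans ?_
  linarith

/-- The form of one soliton with a cutoff `z`, of derivative `z'`. -/
theorem solitonForm_cutoff_le {ω c v V z z' τ : ℝ} {e u ux : ℂ} (he : ‖e‖ = 1) (hω : |ω| ≤ 1)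
    (hc : |c| ≤ 1) (hv : |v| ≤ V) (hz0 : 0 ≤ z) (hz1 : z ≤ 1) (hτ : 0 < τ) (hτ1 : τ ≤ 1)
    (hz' : |z'| ≤ τ) :
    solitonForm ω c v e ((z : ℂ) * u) ((z : ℂ) * ux + (z' : ℂ) * u) ≤
      z ^ 2 * solitonForm ω c v e u ux + 9 * (1 + V) * τ * (‖u‖ ^ 2 + ‖ux‖ ^ 2) := by
  have h := solitonForm_add_le he hω hc hv ((z : ℂ) * u) ((z : ℂ) * ux) 0 ((z' : ℂ) * u) hτ
  have h1 : solitonForm ω c v e ((z : ℂ) * u) ((z : ℂ) * ux) = z ^ 2 * solitonForm ω c v e u ux := by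
    have e1 : Complex.I * (ω : ℂ) * ((z : ℂ) * u) + (c : ℂ) * ((z : ℂ) * ux) =
      (z : ℂ) * (Complex.I * (ω : ℂ) * u + (c : ℂ) * ux) := by ring
    have e2 : (conj e * ((z : ℂ) * u)).re = z * (conj e * u).re := by
      rw [show conj e * ((z : ℂ) * u) = (z : ℂ) * (conj e * u) by ring, Complex.re_ofReal_mul]
    rw [solitonForm, solitonForm, e1, e2, norm_mul, norm_mul, norm_mul, Complex.norm_real,
      Real.norm_eq_abs, mul_pow, mul_pow, mul_pow, sq_abs]
    ring
  rw [add_zero, h1] at h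
  refine h.trans ?_
  have hV0 : 0 ≤ V := (abs_nonneg _).trans hv
  have n1 : ‖(z : ℂ) * u‖ ^ 2 ≤ ‖u‖ ^ 2 := by
    rw [norm_mul, Complex.norm_real, Real.norm_eq_abs, abs_of_nonneg hz0]
    exact pow_le_pow_left₀ (by positivity) (mul_le_of_le_one_left (norm_nonneg _) hz1) 2
  have n2 : ‖(z : ℂ) * ux‖ ^ 2 ≤ ‖ux‖ ^ 2 := by
    rw [norm_mul, Complex.norm_real, Real.norm_eq_abs, abs_of_nonneg hz0]
    exact pow_le_pow_left₀ (by positivity) (mul_le_of_le_one_left (norm_nonneg _) hz1) 2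
  have n3 : ‖(z' : ℂ) * u‖ ^ 2 ≤ τ ^ 2 * ‖u‖ ^ 2 := by
    rw [norm_mul, Complex.norm_real, Real.norm_eq_abs, mul_pow]
    exact mul_le_mul_of_nonneg_right (pow_le_pow_left₀ (abs_nonneg _) hz' 2) (sq_nonneg _)
  have n4 : (1 + τ⁻¹) * ‖(z' : ℂ) * u‖ ^ 2 ≤ 2 * τ * ‖u‖ ^ 2 := by
    have : (1 + τ⁻¹) * τ ^ 2 = τ ^ 2 + τ := by field_simp
    calc (1 + τ⁻¹) * ‖(z' : ℂ) * u‖ ^ 2 ≤ (1 + τ⁻¹) * (τ ^ 2 * ‖u‖ ^ 2) := by gcongr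
      _ = (τ ^ 2 + τ) * ‖u‖ ^ 2 := by rw [← this]; ring
      _ ≤ 2 * τ * ‖u‖ ^ 2 := by gcongr; nlinarith
  rw [norm_zero]
  have n5 : τ * (‖(z : ℂ) * u‖ ^ 2 + ‖(z : ℂ) * ux‖ ^ 2) ≤ τ * (‖u‖ ^ 2 + ‖ux‖ ^ 2) :=
    mul_le_mul_of_nonneg_left (add_le_add n1 n2) hτ.le
  have n6 : τ * (‖(z : ℂ) * u‖ ^ 2 + ‖(z : ℂ) * ux‖ ^ 2) + (1 + τ⁻¹) * (0 ^ 2 +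
      ‖(z' : ℂ) * u‖ ^ 2) ≤ 3 * τ * (‖u‖ ^ 2 + ‖ux‖ ^ 2) := by
    have : 0 ≤ τ * ‖ux‖ ^ 2 := by positivity
    have e0 : (0 : ℝ) ^ 2 + ‖(z' : ℂ) * u‖ ^ 2 = ‖(z' : ℂ) * u‖ ^ 2 := by ring
    rw [e0]
    linarith
  have := mul_le_mul_of_nonneg_left n6 (by positivity : 0 ≤ 3 + 3 * V)
  linarith

set_option maxHeartbeats 400000 in
/-- Localization: on the support of the cutoff `z i` of a soliton the reduced density is that of
this soliton alone, elsewhere it is that of the linear equation, up to errors of the size `τ` of the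
tails and of the derivatives of the cutoffs. -/
theorem sum_solitonForm_le_reducedForm {ι : Type*} [Fintype ι] [DecidableEq ι]
    {α β k₀ A B τ : ℝ} {c ω p f z z' : ι → ℝ} {e : ι → ℂ} (hα : 0 ≤ α)
    (hk0 : 0 < k₀) (hk1 : k₀ ≤ 1) (hk : ∀ i, c i ^ 2 + ω i ^ 2 ≤ 1 - k₀)
    (hp0 : ∀ i, 0 ≤ p i) (hp1 : ∑ i, p i ≤ 1) (he : ∀ i, ‖e i‖ = 1)
    (hf0 : ∀ i, 0 ≤ f i) (hfA : ∀ i, f i ≤ A) (hA : 1 ≤ A) (hτ0 : 0 < τ) (hτ1 : τ ≤ 1)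
    (hB1 : ∀ i, |α / (1 - c i ^ 2) - β| ≤ B) (hB2 : |β| ≤ B) (hB3 : α / k₀ ≤ B)
    (hz0 : ∀ i, 0 ≤ z i) (hz1 : ∀ i, z i ≤ 1) (hz' : ∀ i, |z' i| ≤ τ)
    (hsep : ∀ i, z i ≠ 0 → p i = 1 ∧ ∀ j, j ≠ i → z j = 0) (hzz : ∀ i, z i = 0 → z' i = 0)
    (hfar : ∀ i, z i ≠ 1 → f i ≤ τ) (u ux : ℂ) :
    ∑ i, solitonForm (ω i) (c i) ((α / (1 - c i ^ 2) - β) * f i ^ 2) (e i) ((z i : ℂ) * u)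
        ((z i : ℂ) * ux + (z' i : ℂ) * u) +
      k₀ * ((1 - ∑ i, z i ^ 2) * (‖u‖ ^ 2 + ‖ux‖ ^ 2)) ≤
    reducedForm α β c (∑ i, p i * c i) (∑ i, p i * ω i) f e u ux +
      (3 * Fintype.card ι * B + 4 * B * Fintype.card ι ^ 2 * A + 3 * B + 9 * (1 + B * A ^ 2)) * τ *
        (‖u‖ ^ 2 + ‖ux‖ ^ 2) := by
  set n : ℝ := (Fintype.card ι : ℝ) with hn
  have hn0 : 0 ≤ n := Nat.cast_nonneg _
  have hcard : ∀ s : Finset ι, (s.card : ℝ) ≤ n := fun s => Nat.cast_le.2 (Finset.card_le_univ s)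
  clear_value n
  set C := ∑ i, p i * c i with hC
  set Ω := ∑ i, p i * ω i with hΩ
  set E := ‖u‖ ^ 2 + ‖ux‖ ^ 2 with hE
  have hE0 : 0 ≤ E := by positivity
  have huE : ‖u‖ ^ 2 ≤ E := by rw [hE]; linarith [sq_nonneg ‖ux‖]
  have hB0 : 0 ≤ B := (abs_nonneg _).trans hB2
  have hA0 : 0 ≤ A := zero_le_one.trans hA
  have hCΩ : C ^ 2 + Ω ^ 2 ≤ 1 - k₀ := sq_sum_add_sq_sum_le hk1 hp0 hp1 hk
  have hX : ‖Complex.I * (Ω : ℂ) * u + (C : ℂ) * ux‖ ^ 2 ≤ (1 - k₀) * E :=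
    (norm_lin_sq_le Ω C u ux).trans (mul_le_mul_of_nonneg_right (by linarith) hE0)
  have hC1 : k₀ ≤ 1 - C ^ 2 := by linarith [sq_nonneg Ω]
  have hαC : 2 * α / (1 - C ^ 2) ≤ 2 * B := by
    have : α / (1 - C ^ 2) ≤ α / k₀ := div_le_div_of_nonneg_left hα hk0 hC1
    rw [mul_div_assoc]
    linarith
  have hαC0 : 0 ≤ 2 * α / (1 - C ^ 2) := div_nonneg (by positivity) (by linarith)
  have hBn : ∀ i, |β - α / (1 - c i ^ 2)| ≤ B := fun i => by rw [abs_sub_comm]; exact hB1 i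
  have hτ2 : τ ^ 2 ≤ τ := pow_le_of_le_one hτ0.le hτ1 two_ne_zero
  set r : ι → ℝ := fun i => f i * (conj (e i) * u).re with hr
  set W : ι → ℝ := fun i => (β - α / (1 - c i ^ 2)) * f i ^ 2 * ‖u‖ ^ 2 +
      2 * β * (f i * (conj (e i) * u).re) ^ 2 with hW
  have hred : reducedForm α β c C Ω f e u ux = ‖ux‖ ^ 2 + ‖u‖ ^ 2 -
      ‖Complex.I * (Ω : ℂ) * u + (C : ℂ) * ux‖ ^ 2 + ∑ i, W i -
      2 * α / (1 - C ^ 2) * (∑ i, r i) ^ 2 := rfl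
  clear_value E C Ω
  -- sums over solitons that are far away
  have hWfar : ∀ s : Finset ι, (∀ i ∈ s, f i ≤ τ) → |∑ i ∈ s, W i| ≤ 3 * n * B * τ * ‖u‖ ^ 2 := by
    intro s hs
    have hcs := hcard s
    calc |∑ i ∈ s, W i| ≤ ∑ i ∈ s, |W i| := Finset.abs_sum_le_sum_abs _ _
      _ ≤ ∑ i ∈ s, 3 * B * τ ^ 2 * ‖u‖ ^ 2 := Finset.sum_le_sum fun i hi =>
          abs_potential_le (he i) (hBn i) hB2 (hf0 i) (hs i hi)
      _ = s.card * (3 * B * τ ^ 2 * ‖u‖ ^ 2) := by rw [Finset.sum_const, nsmul_eq_mul]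
      _ ≤ n * (3 * B * τ * ‖u‖ ^ 2) := by gcongr
      _ = _ := by ring
  have hrfar : ∀ (s : Finset ι) (a : ℝ), (∀ i ∈ s, f i ≤ a) → 0 ≤ a →
      |∑ i ∈ s, r i| ≤ n * a * ‖u‖ := by
    intro s a hs ha
    have hcs := hcard s
    calc |∑ i ∈ s, r i| ≤ ∑ i ∈ s, |r i| := Finset.abs_sum_le_sum_abs _ _
      _ ≤ ∑ i ∈ s, a * ‖u‖ := Finset.sum_le_sum fun i hi =>
          abs_amplitude_mul_le (he i) (hf0 i) (hs i hi)
      _ = s.card * (a * ‖u‖) := by rw [Finset.sum_const, nsmul_eq_mul]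
      _ ≤ n * (a * ‖u‖) := by gcongr
      _ = _ := by ring
  have hu0 := norm_nonneg u
  clear_value r W
  by_cases hex : ∃ i, z i ≠ 0
  · obtain ⟨i, hi⟩ := hex
    obtain ⟨hpi, hzj⟩ := hsep i hi
    have hpj : ∀ j, j ≠ i → p j = 0 := by
      intro j hj
      have h1 : p i + p j ≤ ∑ k, p k := by
        rw [← Finset.sum_pair hj.symm]
        exact Finset.sum_le_sum_of_subset_of_nonneg (Finset.subset_univ _) fun k _ _ => hp0 k
      linarith [hp0 j]
    have hCi : C = c i := by
      rw [hC, Finset.sum_eq_single i (fun j _ hj => by rw [hpj j hj, zero_mul]) (by simp), hpi,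
        one_mul]
    have hΩi : Ω = ω i := by
      rw [hΩ, Finset.sum_eq_single i (fun j _ hj => by rw [hpj j hj, zero_mul]) (by simp), hpi,
        one_mul]
    have hsum : ∑ j, solitonForm (ω j) (c j) ((α / (1 - c j ^ 2) - β) * f j ^ 2) (e j)
        ((z j : ℂ) * u) ((z j : ℂ) * ux + (z' j : ℂ) * u) =
        solitonForm (ω i) (c i) ((α / (1 - c i ^ 2) - β) * f i ^ 2) (e i)
        ((z i : ℂ) * u) ((z i : ℂ) * ux + (z' i : ℂ) * u) := by
      refine Finset.sum_eq_single i (fun j _ hj => ?_) (by simp)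
      simp [solitonForm, hzj j hj, hzz j (hzj j hj)]
    have hz2 : ∑ j, z j ^ 2 = z i ^ 2 :=
      Finset.sum_eq_single i (fun j _ hj => by rw [hzj j hj]; ring) (by simp)
    have hfj : ∀ j ∈ Finset.univ.erase i, f j ≤ τ := fun j hj =>
      hfar j (by rw [hzj j (Finset.ne_of_mem_erase hj)]; norm_num)
    have hci : |c i| ≤ 1 := by
      rw [← sq_le_one_iff_abs_le_one]; linarith [hk i, sq_nonneg (ω i)]
    have hωi : |ω i| ≤ 1 := by
      rw [← sq_le_one_iff_abs_le_one]; linarith [hk i, sq_nonneg (c i)]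
    have hvi : |(α / (1 - c i ^ 2) - β) * f i ^ 2| ≤ B * A ^ 2 := by
      rw [abs_mul, abs_of_nonneg (sq_nonneg (f i))]
      exact mul_le_mul (hB1 i) (pow_le_pow_left₀ (hf0 i) (hfA i) 2) (sq_nonneg _) hB0
    have hcut := solitonForm_cutoff_le (u := u) (ux := ux) (he i) hωi hci hvi (hz0 i) (hz1 i)
      hτ0 hτ1 (hz' i)
    rw [hsum, hz2]
    -- the density of soliton `i` alone
    set T := ‖ux‖ ^ 2 + ‖u‖ ^ 2 - ‖Complex.I * (Ω : ℂ) * u + (C : ℂ) * ux‖ ^ 2 with hT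
    have hT0 : k₀ * E ≤ T := by rw [hT]; linarith
    set P := W i - 2 * α / (1 - c i ^ 2) * r i ^ 2 with hP
    have hsol : solitonForm (ω i) (c i) ((α / (1 - c i ^ 2) - β) * f i ^ 2) (e i) u ux = T + P := by
      rw [solitonForm, hT, hP, hCi, hΩi, hW, hr]
      ring
    have hPz : -(3 * B * τ * E) ≤ (1 - z i ^ 2) * P := by
      by_cases hz1i : z i = 1
      · rw [hz1i]
        have : 0 ≤ 3 * B * τ * E := by positivity
        linarith
      · have hb := abs_potential_le (u := u) (he i) (hBn i) (hBn i) (hf0 i) (hfar i hz1i)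
        have hPeq : P = (β - α / (1 - c i ^ 2)) * f i ^ 2 * ‖u‖ ^ 2 +
            2 * (β - α / (1 - c i ^ 2)) * (f i * (conj (e i) * u).re) ^ 2 := by
          rw [hP, hW, hr]; ring
        rw [← hPeq] at hb
        have h1 : 0 ≤ 1 - z i ^ 2 := by linarith [pow_le_one₀ (hz0 i) (hz1 i) (n := 2)]
        have h2 : 1 - z i ^ 2 ≤ 1 := by linarith [sq_nonneg (z i)]
        have h3 : |(1 - z i ^ 2) * P| ≤ 3 * B * τ * E := by
          rw [abs_mul, abs_of_nonneg h1]
          calc (1 - z i ^ 2) * |P| ≤ 1 * (3 * B * τ ^ 2 * ‖u‖ ^ 2) :=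
                mul_le_mul h2 hb (abs_nonneg _) zero_le_one
            _ ≤ 3 * B * τ * E := by rw [one_mul]; gcongr
        linarith [(abs_le.1 h3).1]
    have hWsum : ∑ j, W j = W i + ∑ j ∈ Finset.univ.erase i, W j :=
      (Finset.add_sum_erase _ _ (Finset.mem_univ i)).symm
    have hrsum : ∑ j, r j = r i + ∑ j ∈ Finset.univ.erase i, r j :=
      (Finset.add_sum_erase _ _ (Finset.mem_univ i)).symm
    have hWe := (abs_le.1 (hWfar _ hfj)).1
    have hWe2 : 3 * n * B * τ * ‖u‖ ^ 2 ≤ 3 * n * B * τ * E := by gcongr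
    have hre : 2 * α / (1 - c i ^ 2) * (∑ j, r j) ^ 2 ≤
        2 * α / (1 - c i ^ 2) * r i ^ 2 + 4 * B * n ^ 2 * A * τ * E := by
      have h1 : |∑ j ∈ Finset.univ.erase i, r j| ≤ n * τ * ‖u‖ := hrfar _ τ hfj hτ0.le
      have h2 : |∑ j, r j| ≤ n * A * ‖u‖ := hrfar _ A (fun j _ => hfA j) hA0
      have h3 : |r i| ≤ n * A * ‖u‖ := by
        simpa using hrfar {i} A (fun j _ => hfA j) hA0
      have h4 : (∑ j, r j) ^ 2 - r i ^ 2 =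
          (∑ j ∈ Finset.univ.erase i, r j) * (∑ j, r j + r i) := by rw [hrsum]; ring
      have h5 : (∑ j, r j) ^ 2 - r i ^ 2 ≤ (n * τ * ‖u‖) * (2 * (n * A * ‖u‖)) := by
        rw [h4]
        refine (le_abs_self _).trans ?_
        rw [abs_mul]
        refine mul_le_mul h1 ((abs_add_le _ _).trans (by linarith)) (abs_nonneg _) (by positivity)
      have h6 : (n * τ * ‖u‖) * (2 * (n * A * ‖u‖)) ≤ 2 * n ^ 2 * A * τ * E := by
        calc (n * τ * ‖u‖) * (2 * (n * A * ‖u‖)) = 2 * n ^ 2 * A * τ * ‖u‖ ^ 2 := by ring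
          _ ≤ _ := by gcongr
      rw [hCi] at hαC hαC0
      calc 2 * α / (1 - c i ^ 2) * (∑ j, r j) ^ 2 = 2 * α / (1 - c i ^ 2) * r i ^ 2 +
            2 * α / (1 - c i ^ 2) * ((∑ j, r j) ^ 2 - r i ^ 2) := by ring
        _ ≤ 2 * α / (1 - c i ^ 2) * r i ^ 2 +
            2 * α / (1 - c i ^ 2) * (2 * n ^ 2 * A * τ * E) := by
            gcongr
            exact h5.trans h6
        _ ≤ 2 * α / (1 - c i ^ 2) * r i ^ 2 + 2 * B * (2 * n ^ 2 * A * τ * E) := by gcongr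
        _ = _ := by ring
    have hTz : k₀ * ((1 - z i ^ 2) * E) ≤ (1 - z i ^ 2) * T := by
      have h1 : 0 ≤ 1 - z i ^ 2 := by linarith [pow_le_one₀ (hz0 i) (hz1 i) (n := 2)]
      linarith [mul_le_mul_of_nonneg_left hT0 h1]
    rw [hsol, ← hE] at hcut
    rw [← hCi] at hre hP
    rw [hred, hWsum]
    clear_value T P
    linarith
  · push Not at hex
    have hsum : ∑ j, solitonForm (ω j) (c j) ((α / (1 - c j ^ 2) - β) * f j ^ 2) (e j)
        ((z j : ℂ) * u) ((z j : ℂ) * ux + (z' j : ℂ) * u) = 0 :=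
      Finset.sum_eq_zero fun j _ => by simp [solitonForm, hex j, hzz j (hex j)]
    have hz2 : ∑ j, z j ^ 2 = 0 := Finset.sum_eq_zero fun j _ => by rw [hex j]; ring
    have hfj : ∀ j ∈ Finset.univ, f j ≤ τ := fun j _ => hfar j (by rw [hex j]; norm_num)
    have hWe := (abs_le.1 (hWfar _ hfj)).1
    have hWe2 : 3 * n * B * τ * ‖u‖ ^ 2 ≤ 3 * n * B * τ * E := by gcongr
    have hr2 : (∑ j, r j) ^ 2 ≤ n ^ 2 * τ * E := by
      have h1 := hrfar _ τ hfj hτ0.le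
      calc (∑ j, r j) ^ 2 = |∑ j, r j| ^ 2 := (sq_abs _).symm
        _ ≤ (n * τ * ‖u‖) ^ 2 := pow_le_pow_left₀ (abs_nonneg _) h1 2
        _ = n ^ 2 * τ ^ 2 * ‖u‖ ^ 2 := by ring
        _ ≤ n ^ 2 * τ * E := by gcongr
    have hr3 : 2 * α / (1 - C ^ 2) * (∑ j, r j) ^ 2 ≤ 4 * B * n ^ 2 * A * τ * E := by
      calc 2 * α / (1 - C ^ 2) * (∑ j, r j) ^ 2 ≤ 2 * B * (n ^ 2 * τ * E) :=
            mul_le_mul hαC hr2 (sq_nonneg _) (by positivity)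
        _ = 2 * B * n ^ 2 * 1 * τ * E := by ring
        _ ≤ 4 * B * n ^ 2 * A * τ * E := by
            have g0 : 0 ≤ B * n ^ 2 * τ * E := by positivity
            linarith [mul_le_mul_of_nonneg_left hA g0]
    have h9 : 0 ≤ (3 * B + 9 * (1 + B * A ^ 2)) * τ * E := by positivity
    rw [hsum, hz2, hred]
    linarith

/-! ### Coercivity around one soliton with a cutoff -/

theorem exists_cutoff : ∃ Z Z' : ℝ → ℝ, ∃ M, 0 ≤ M ∧ ContDiff ℝ (⊤ : ℕ∞) Z ∧
    (∀ x, HasDerivAt Z (Z' x) x) ∧ Continuous Z' ∧ (∀ x, 0 ≤ Z x) ∧ (∀ x, Z x ≤ 1) ∧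
    (∀ x, |x| ≤ 1 → Z x = 1) ∧ (∀ x, 2 ≤ |x| → Z x = 0) ∧ (∀ x, Z x = 0 → Z' x = 0) ∧
    ∀ x, |Z' x| ≤ M := by
  let b : ContDiffBump (0 : ℝ) := ⟨1, 2, by norm_num, by norm_num⟩
  have hb : ContDiff ℝ (⊤ : ℕ∞) b := b.contDiff
  have hd : ∀ x, HasDerivAt b (deriv b x) x := fun x =>
    (hb.differentiable (by simp) x).hasDerivAt
  have hc : Continuous (deriv b) := hb.continuous_deriv (by simp)
  obtain ⟨M, hM⟩ := hc.bounded_above_of_compact_support b.hasCompactSupport.deriv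
  refine ⟨b, deriv b, M, (norm_nonneg _).trans (hM 0), hb, hd, hc, fun x => b.nonneg,
    fun x => b.le_one, fun x hx => b.one_of_mem_closedBall (by simpa [b] using hx),
    fun x hx => b.zero_of_le_dist (by simpa [b] using hx), fun x hx => ?_, hM⟩
  exact IsLocalMin.deriv_eq_zero (Eventually.of_forall fun y => by rw [hx]; exact b.nonneg)

/-- The product rule for weak derivatives. -/
theorem HasWeakDeriv.smooth_mul {u u' : ℝ → ℂ} (h : HasWeakDeriv u u') (hu : MemLp u 2)
    (hu' : MemLp u' 2) {z z' : ℝ → ℝ} (hz : ContDiff ℝ (⊤ : ℕ∞) z)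
    (hz' : ∀ x, HasDerivAt z (z' x) x) :
    HasWeakDeriv (fun x => (z x : ℂ) * u x) (fun x => (z x : ℂ) * u' x + (z' x : ℂ) * u x) := by
  intro χ hχ hχs
  have e : deriv z = z' := funext fun x => (hz' x).deriv
  have hcz' : Continuous z' := e ▸ hz.continuous_deriv (by simp)
  have hcz : Continuous z := hz.continuous
  have hcχ : Continuous χ := hχ.continuous
  have hcχ' : Continuous (deriv χ) := hχ.continuous_deriv (by simp)
  have hd : ∀ x, deriv (fun x => χ x * z x) x = deriv χ x * z x + χ x * z' x := fun x =>
    ((hχ.differentiable (by simp) x).hasDerivAt.fun_mul (hz' x)).deriv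
  have key := h (fun x => χ x * z x) (hχ.mul hz) hχs.mul_right
  have int : ∀ {a b : ℝ → ℝ} {v : ℝ → ℂ}, Continuous a → Continuous b → HasCompactSupport a →
      MemLp v 2 → Integrable fun x => (a x : ℂ) * ((b x : ℂ) * v x) := by
    intro a b v ha hb has hv
    have hs : HasCompactSupport fun x => (a x : ℂ) * (b x : ℂ) := by
      refine HasCompactSupport.mul_right ?_
      exact has.comp_left (g := fun r : ℝ => (r : ℂ)) Complex.ofReal_zero
    have := (memLp_of_continuous_hasCompactSupport (by fun_prop) hs).integrable_mul hv
    refine this.congr (ae_of_all _ fun x => ?_)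
    simp only [Pi.mul_apply]
    ring
  have i1 := int hcχ' hcz hχs.deriv hu
  have i2 := int hcχ hcz' hχs hu
  have i3 := int hcχ hcz hχs hu'
  have l : ∫ x, ((deriv (fun x => χ x * z x) x : ℝ) : ℂ) * u x =
      (∫ x, ((deriv χ x : ℝ) : ℂ) * ((z x : ℂ) * u x)) + ∫ x, (χ x : ℂ) * ((z' x : ℂ) * u x) := by
    rw [← integral_add i1 i2]
    congr 1
    ext x
    rw [hd]
    push_cast
    ring
  have r : ∫ x, ((χ x * z x : ℝ) : ℂ) * u' x = ∫ x, (χ x : ℂ) * ((z x : ℂ) * u' x) := by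
    congr 1
    ext x
    push_cast
    ring
  have s : ∫ x, (χ x : ℂ) * ((z x : ℂ) * u' x + (z' x : ℂ) * u x) =
      (∫ x, (χ x : ℂ) * ((z x : ℂ) * u' x)) + ∫ x, (χ x : ℂ) * ((z' x : ℂ) * u x) := by
    rw [← integral_add i3 i2]
    congr 1
    ext x
    ring
  rw [l, r] at key
  rw [s, neg_add, ← key]
  ring

/-- A cutoff that equals one where the weight `F` is not small hardly disturbs orthogonality. -/
theorem sq_integral_cutoff_le {g F z s : ℝ → ℝ} {τ : ℝ} (hτ : 0 ≤ τ) (hg : MemLp g 2)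
    (hF : Continuous F) (hF2 : MemLp F 2) (hFs : ∀ x, |F x| ≤ s x) (hs : Integrable s)
    (hz : Continuous z) (hz0 : ∀ x, 0 ≤ z x) (hz1 : ∀ x, z x ≤ 1)
    (hfar : ∀ x, z x ≠ 1 → s x ≤ τ) (h0 : ∫ x, g x * F x = 0) :
    (∫ x, z x * g x * F x) ^ 2 ≤ (∫ x, g x ^ 2) * (τ * ∫ x, s x) := by
  have hz2 : ∀ x, |z x - 1| ≤ 1 := fun x => abs_le.2 ⟨by linarith [hz0 x], by linarith [hz1 x]⟩
  have m : MemLp (fun x => (z x - 1) * F x) 2 :=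
    hF2.of_le_mul (c := 1) (by fun_prop) (ae_of_all _ fun x => by
      rw [norm_mul, Real.norm_eq_abs]
      exact mul_le_mul_of_nonneg_right (hz2 x) (norm_nonneg _))
  have i1 : Integrable fun x => g x * ((z x - 1) * F x) := hg.integrable_mul m
  have i2 : Integrable fun x => g x * F x := hg.integrable_mul hF2
  have e : ∫ x, z x * g x * F x = ∫ x, g x * ((z x - 1) * F x) := by
    rw [← add_zero (∫ x, g x * ((z x - 1) * F x)), ← h0, ← integral_add i1 i2]
    congr 1
    ext x
    ring
  rw [e]
  refine (sq_integral_mul_le hg m).trans ?_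
  refine mul_le_mul_of_nonneg_left ?_ (integral_nonneg fun x => sq_nonneg _)
  rw [← integral_const_mul]
  refine integral_mono m.integrable_sq (hs.const_mul τ) fun x => ?_
  have hs0 : 0 ≤ s x := (abs_nonneg _).trans (hFs x)
  show ((z x - 1) * F x) ^ 2 ≤ τ * s x
  by_cases hx : z x = 1
  · rw [hx, sub_self, zero_mul, zero_pow two_ne_zero]
    positivity
  · have h1 : |(z x - 1) * F x| ≤ s x := by
      rw [abs_mul]
      exact (mul_le_of_le_one_left (abs_nonneg _) (hz2 x)).trans (hFs x)
    rw [← sq_abs]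
    nlinarith [abs_nonneg ((z x - 1) * F x), hfar x hx]

theorem soliton_coercive_cutoff {ω c : ℝ} (h : 0 < 1 - c ^ 2 - ω ^ 2) :
    ∃ k, 0 < k ∧ ∃ D, 0 ≤ D ∧ ∀ᶠ ω' in 𝓝 ω, ∀ γ t y τ : ℝ, ∀ u ux : ℝ → ℂ, ∀ z z' : ℝ → ℝ,
      0 < τ → τ ≤ 1 → MemLp u 2 → MemLp ux 2 → HasWeakDeriv u ux →
      ContDiff ℝ (⊤ : ℕ∞) z → (∀ x, HasDerivAt z (z' x) x) →
      (∀ x, 0 ≤ z x) → (∀ x, z x ≤ 1) → (∀ x, |z' x| ≤ τ) →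
      (∀ x, z x ≠ 1 → sech (invWidth ω c / 2 * (x - y)) ≤ τ) →
      (∫ x, (conj (phase ω c γ t x) * u x).re * sech (invWidth ω c * (x - y)) ^ 2 = 0) →
      (∫ x, (conj (phase ω c γ t x) * u x).re * (sech (invWidth ω' c * (x - y)) *
            Real.tanh (invWidth ω' c * (x - y))) = 0) →
      (∫ x, (conj (phase ω c γ t x) * u x).im * sech (invWidth ω' c * (x - y)) = 0) →
      k * ∫ x, z x ^ 2 * (‖u x‖ ^ 2 + ‖ux x‖ ^ 2) ≤
        (∫ x, solitonForm ω' c (2 * invWidth ω' c ^ 2 * (1 - c ^ 2) *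
          sech (invWidth ω' c * (x - y)) ^ 2) (phase ω c γ t x) ((z x : ℂ) * u x)
          ((z x : ℂ) * ux x + (z' x : ℂ) * u x)) +
        D * τ * ∫ x, (‖u x‖ ^ 2 + ‖ux x‖ ^ 2) := by
  obtain ⟨k, hk, C, hC, hev⟩ := soliton_coercive h
  have hκ : 0 < invWidth ω c := invWidth_pos h
  set κ₀ := invWidth ω c / 2 with hκ₀
  have hκ0 : 0 < κ₀ := by positivity
  have iS : Integrable fun x => sech (κ₀ * x) := integrable_sech_mul hκ0
  set S := ∫ x, sech (κ₀ * x) with hS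
  have hS0 : 0 ≤ S := integral_nonneg fun x => (sech_pos _).le
  have ev2 : ∀ᶠ ω' in 𝓝 ω, κ₀ < invWidth ω' c :=
    ((continuous_invWidth c).tendsto ω).eventually (lt_mem_nhds (by rw [hκ₀]; linarith))
  refine ⟨k / 2, by positivity, k + 3 * C * S, by positivity, ?_⟩
  filter_upwards [hev, ev2] with ω' hω' hκ' γ t y τ u ux z z' hτ0 hτ1 hu hux hw hz hzz' hz0 hz1
    hz'τ hfar o1 o2 o3
  have hcz : Continuous z := hz.continuous
  have hcz' : Continuous z' :=
    (funext fun x => (hzz' x).deriv : deriv z = z') ▸ hz.continuous_deriv (by simp)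
  have hκ'0 : 0 < invWidth ω' c := hκ0.trans hκ'
  have bz : ∀ x, ‖(z x : ℂ)‖ ≤ 1 := fun x => by
    rw [Complex.norm_real, Real.norm_eq_abs, abs_of_nonneg (hz0 x)]; exact hz1 x
  have bz' : ∀ x, ‖(z' x : ℂ)‖ ≤ τ := fun x => by
    rw [Complex.norm_real, Real.norm_eq_abs]; exact hz'τ x
  have mU : MemLp (fun x => (z x : ℂ) * u x) 2 := memLp_continuous_mul (by fun_prop) bz hu
  have mUx : MemLp (fun x => (z x : ℂ) * ux x) 2 := memLp_continuous_mul (by fun_prop) bz hux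
  have mz'u : MemLp (fun x => (z' x : ℂ) * u x) 2 := memLp_continuous_mul (by fun_prop) bz' hu
  have mU' : MemLp (fun x => (z x : ℂ) * ux x + (z' x : ℂ) * u x) 2 := mUx.add mz'u
  have key := hω' γ t y _ _ mU mU' (hw.smooth_mul hu hux hz hzz')
  set e : ℝ → ℂ := phase ω c γ t with he
  have hec : Continuous e := continuous_phase ω c γ t
  have mg : MemLp (fun x => conj (e x) * u x) 2 :=
    memLp_continuous_mul (M := 1) (by fun_prop) (fun x => by simp [he, norm_phase]) hu
  have iu := hu.integrable_norm_pow (p := 2) (by norm_num)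
  have iux := hux.integrable_norm_pow (p := 2) (by norm_num)
  have iE : Integrable fun x => ‖u x‖ ^ 2 + ‖ux x‖ ^ 2 := iu.add iux
  set E := ∫ x, (‖u x‖ ^ 2 + ‖ux x‖ ^ 2) with hE
  have hE0 : 0 ≤ E := integral_nonneg fun x => by positivity
  have hgn : ∀ x, ‖conj (e x) * u x‖ = ‖u x‖ := fun x => by
    rw [norm_mul, RCLike.norm_conj, he, norm_phase, one_mul]
  have gre : ∫ x, (conj (e x) * u x).re ^ 2 ≤ E := integral_mono mg.re.integrable_sq iE fun x => by
    have := Complex.abs_re_le_norm (conj (e x) * u x)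
    rw [hgn] at this
    have h2 := pow_le_pow_left₀ (abs_nonneg _) this 2
    rw [sq_abs] at h2
    show (conj (e x) * u x).re ^ 2 ≤ ‖u x‖ ^ 2 + ‖ux x‖ ^ 2
    linarith [sq_nonneg ‖ux x‖]
  have gim : ∫ x, (conj (e x) * u x).im ^ 2 ≤ E := integral_mono mg.im.integrable_sq iE fun x => by
    have := Complex.abs_im_le_norm (conj (e x) * u x)
    rw [hgn] at this
    have h2 := pow_le_pow_left₀ (abs_nonneg _) this 2
    rw [sq_abs] at h2
    show (conj (e x) * u x).im ^ 2 ≤ ‖u x‖ ^ 2 + ‖ux x‖ ^ 2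
    linarith [sq_nonneg ‖ux x‖]
  have iSy : Integrable fun x => sech (κ₀ * (x - y)) := iS.comp_sub_right y
  have hSy : ∫ x, sech (κ₀ * (x - y)) = S := integral_sub_right_eq_self (fun x => sech (κ₀ * x)) y
  -- the orthogonality conditions hold for `z u` up to errors of size `τ`
  have orth : ∀ {g F : ℝ → ℝ}, MemLp g 2 → Continuous F → MemLp F 2 →
      (∀ x, |F x| ≤ sech (κ₀ * (x - y))) → ∫ x, g x * F x = 0 → ∫ x, g x ^ 2 ≤ E →
      (∫ x, z x * g x * F x) ^ 2 ≤ E * (τ * S) := by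
    intro g F hg hF hF2 hFs h0 hgE
    refine (sq_integral_cutoff_le hτ0.le hg hF hF2 hFs iSy hcz hz0 hz1 hfar h0).trans ?_
    rw [hSy]
    exact mul_le_mul_of_nonneg_right hgE (by positivity)
  have hκκ : ∀ x, sech (invWidth ω c * (x - y)) ≤ sech (κ₀ * (x - y)) := fun x =>
    sech_mul_le hκ0 (by rw [hκ₀]; linarith) _
  have hκκ' : ∀ x, sech (invWidth ω' c * (x - y)) ≤ sech (κ₀ * (x - y)) := fun x =>
    sech_mul_le hκ0 hκ'.le _
  have a1 := orth mg.re (by fun_prop)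
    (memLp_two_comp_mul_sub (f := fun x => sech x ^ 2) (by fun_prop) abs_sech_sq_le hκ y)
    (fun x => (abs_sech_sq_le _).trans (by rw [one_mul]; exact hκκ x)) o1 gre
  have a2 := orth mg.re (by fun_prop)
    (memLp_two_comp_mul_sub (f := fun x => sech x * Real.tanh x) (by fun_prop)
      abs_sech_mul_tanh_le hκ'0 y)
    (fun x => (abs_sech_mul_tanh_le _).trans (by rw [one_mul]; exact hκκ' x)) o2 gre
  have a3 := orth mg.im (by fun_prop)
    (memLp_two_comp_mul_sub (f := sech) (by fun_prop)
      (fun x => by rw [one_mul, abs_of_pos (sech_pos x)]) hκ'0 y)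
    (fun x => by rw [abs_of_pos (sech_pos _)]; exact hκκ' x) o3 gim
  have r1 : ∀ x, (conj (e x) * ((z x : ℂ) * u x)).re = z x * (conj (e x) * u x).re := fun x => by
    rw [show conj (e x) * ((z x : ℂ) * u x) = (z x : ℂ) * (conj (e x) * u x) by ring,
      Complex.re_ofReal_mul]
  have r2 : ∀ x, (conj (e x) * ((z x : ℂ) * u x)).im = z x * (conj (e x) * u x).im := fun x => by
    rw [show conj (e x) * ((z x : ℂ) * u x) = (z x : ℂ) * (conj (e x) * u x) by ring,
      Complex.im_ofReal_mul]
  simp only [r1, r2] at key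
  have low : 1 / 2 * (∫ x, z x ^ 2 * (‖u x‖ ^ 2 + ‖ux x‖ ^ 2)) - τ * E ≤
      ∫ x, (‖(z x : ℂ) * u x‖ ^ 2 + ‖(z x : ℂ) * ux x + (z' x : ℂ) * u x‖ ^ 2) := by
    have iz : Integrable fun x => z x ^ 2 * (‖u x‖ ^ 2 + ‖ux x‖ ^ 2) :=
      iE.bdd_mul (c := 1) (by fun_prop) (ae_of_all _ fun x => by
        rw [Real.norm_eq_abs, abs_of_nonneg (sq_nonneg _)]
        exact pow_le_one₀ (hz0 x) (hz1 x))
    rw [← integral_const_mul, hE, ← integral_const_mul, ← integral_sub (iz.const_mul _)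
      (iE.const_mul _)]
    refine integral_mono ((iz.const_mul _).sub (iE.const_mul _))
      ((mU.integrable_norm_pow (by norm_num)).add (mU'.integrable_norm_pow (by norm_num)))
      fun x => ?_
    show 1 / 2 * (z x ^ 2 * (‖u x‖ ^ 2 + ‖ux x‖ ^ 2)) - τ * (‖u x‖ ^ 2 + ‖ux x‖ ^ 2) ≤
      ‖(z x : ℂ) * u x‖ ^ 2 + ‖(z x : ℂ) * ux x + (z' x : ℂ) * u x‖ ^ 2
    have n1 : ‖(z x : ℂ) * u x‖ ^ 2 = z x ^ 2 * ‖u x‖ ^ 2 := by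
      rw [norm_mul, Complex.norm_real, Real.norm_eq_abs, mul_pow, sq_abs]
    have n2 : ‖(z x : ℂ) * ux x‖ ^ 2 = z x ^ 2 * ‖ux x‖ ^ 2 := by
      rw [norm_mul, Complex.norm_real, Real.norm_eq_abs, mul_pow, sq_abs]
    have n3 : ‖(z' x : ℂ) * u x‖ ^ 2 ≤ τ * ‖u x‖ ^ 2 := by
      rw [norm_mul, Complex.norm_real, Real.norm_eq_abs, mul_pow]
      refine mul_le_mul_of_nonneg_right ?_ (sq_nonneg _)
      exact (pow_le_pow_left₀ (abs_nonneg _) (hz'τ x) 2).trans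
        (pow_le_of_le_one hτ0.le hτ1 two_ne_zero)
    have n4 : ‖(z x : ℂ) * ux x‖ ^ 2 ≤ 2 * (‖(z x : ℂ) * ux x + (z' x : ℂ) * u x‖ ^ 2 +
        ‖(z' x : ℂ) * u x‖ ^ 2) := by
      have t1 := norm_sub_le ((z x : ℂ) * ux x + (z' x : ℂ) * u x) ((z' x : ℂ) * u x)
      rw [add_sub_cancel_right] at t1
      exact (pow_le_pow_left₀ (norm_nonneg _) t1 2).trans add_sq_le
    rw [n1]
    rw [n2] at n4
    have p1 : 0 ≤ z x ^ 2 * ‖u x‖ ^ 2 := by positivity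
    have p2 : 0 ≤ τ * ‖ux x‖ ^ 2 := by positivity
    linarith
  have hkl := mul_le_mul_of_nonneg_left low hk.le
  have hCa := mul_le_mul_of_nonneg_left (add_le_add (add_le_add a1 a2) a3) hC
  have fin := hkl.trans (key.trans (add_le_add_right hCa _))
  linarith

/-! ### Coercivity of the integrated density -/

/-- The density of the quadratic form at a point, for solitons of phase factors `e i`, amplitudes
`f i`, speeds `c i` and frequencies `ω i`, with localization weights `p i`. -/
def density {ι : Type*} [Fintype ι] (α β : ℝ) (c ω p f : ι → ℝ) (e : ι → ℂ) (u ux ρ : ℂ)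
    (v n : ℝ) : ℝ :=
  ‖ux‖ ^ 2 + ‖u‖ ^ 2 + ‖ρ‖ ^ 2 + α / 2 * v ^ 2 + α / 2 * n ^ 2 +
    (∑ i, ((β - α / (1 - c i ^ 2)) * f i ^ 2 * ‖u‖ ^ 2 +
      2 * β * (f i * (conj (e i) * u).re) ^ 2) +
      2 * α * (∑ i, f i * (conj (e i) * u).re) * v) +
    (α * (∑ i, p i * c i) * (v * n) - 2 * (∑ i, p i * ω i) * (conj u * ρ).im -
      2 * (∑ i, p i * c i) * (ux * conj ρ).re)

/-- Pointwise requirements, with constants, on the localization weights `p i`, the amplitudes `f i`,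
the phase factors `e i`, and cutoffs `z i` with derivatives `z' i` around the solitons: the supports
of the `z i` are disjoint, `p i = 1` on the support of `z i`, and `τ` bounds the `z' i` as well as
the amplitudes `f i` where `z i ≠ 1`. -/
structure IsSeparated {ι : Type*} [Fintype ι] (α β k₀ A B τ : ℝ) (c ω p f z z' : ι → ℝ)
    (e : ι → ℂ) : Prop where
  subluminal : ∀ i, c i ^ 2 + ω i ^ 2 ≤ 1 - k₀
  weight_nonneg : ∀ i, 0 ≤ p i
  sum_weight_le : ∑ i, p i ≤ 1
  norm_phase : ∀ i, ‖e i‖ = 1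
  amplitude_nonneg : ∀ i, 0 ≤ f i
  amplitude_le : ∀ i, f i ≤ A
  abs_coeff_le : ∀ i, |α / (1 - c i ^ 2) - β| ≤ B
  abs_le : |β| ≤ B
  div_le : α / k₀ ≤ B
  cutoff_nonneg : ∀ i, 0 ≤ z i
  cutoff_le : ∀ i, z i ≤ 1
  abs_deriv_le : ∀ i, |z' i| ≤ τ
  separated : ∀ i, z i ≠ 0 → p i = 1 ∧ ∀ j, j ≠ i → z j = 0
  deriv_eq_zero : ∀ i, z i = 0 → z' i = 0
  amplitude_far : ∀ i, z i ≠ 1 → f i ≤ τ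

/-- The constant of the localization error. -/
def errConst (n A B : ℝ) : ℝ :=
  3 * n * B + 4 * B * n ^ 2 * A + 3 * B + 9 * (1 + B * A ^ 2)

/-- The constant in the lower bound of the density by the last three components. -/
def lossConst (n α k₀ A B : ℝ) : ℝ :=
  2 + 8 * α / k₀ * (n * A) ^ 2 + 3 * n * B * A ^ 2

theorem IsSeparated.sum_sq_le {ι : Type*} [Fintype ι] {α β k₀ A B τ : ℝ}
    {c ω p f z z' : ι → ℝ} {e : ι → ℂ} (h : IsSeparated α β k₀ A B τ c ω p f z z' e) :
    ∑ i, z i ^ 2 ≤ 1 := by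
  by_cases hex : ∃ i, z i ≠ 0
  · obtain ⟨i, hi⟩ := hex
    rw [Finset.sum_eq_single i (fun j _ hj => by rw [(h.separated i hi).2 j hj]; ring) (by simp)]
    exact pow_le_one₀ (h.cutoff_nonneg i) (h.cutoff_le i)
  · push Not at hex
    rw [Finset.sum_eq_zero fun j _ => by rw [hex j]; ring]
    exact zero_le_one

/-- An interpolation of the two lower bounds of the density: the first one controls the first
component after localization, the second one controls the other components. -/
theorem IsSeparated.le_density {ι : Type*} [Fintype ι] {α β k₀ A B τ : ℝ}
    {c ω p f z z' : ι → ℝ} {e : ι → ℂ} (h : IsSeparated α β k₀ A B τ c ω p f z z' e) (hα : 0 < α)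
    (hk0 : 0 < k₀) (hk1 : k₀ ≤ 1) (hA : 1 ≤ A) (hτ0 : 0 < τ) (hτ1 : τ ≤ 1) {s : ℝ} (hs0 : 0 ≤ s)
    (hs1 : s ≤ 1) (u ux ρ : ℂ) (v n : ℝ) :
    (1 - s) * (∑ i, solitonForm (ω i) (c i) ((α / (1 - c i ^ 2) - β) * f i ^ 2) (e i)
        ((z i : ℂ) * u) ((z i : ℂ) * ux + (z' i : ℂ) * u) +
      k₀ * ((1 - ∑ i, z i ^ 2) * (‖u‖ ^ 2 + ‖ux‖ ^ 2)) -
      errConst (Fintype.card ι) A B * τ * (‖u‖ ^ 2 + ‖ux‖ ^ 2)) +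
    s * (min (1 / 2) (α * k₀ / 8) * (‖ρ‖ ^ 2 + v ^ 2 + n ^ 2) -
      lossConst (Fintype.card ι) α k₀ A B * (‖u‖ ^ 2 + ‖ux‖ ^ 2)) ≤
    density α β c ω p f e u ux ρ v n := by
  classical
  have hA0 : 0 ≤ A := zero_le_one.trans hA
  have hB0 : 0 ≤ B := (abs_nonneg _).trans h.abs_le
  have hCΩ := sq_sum_add_sq_sum_le hk1 h.weight_nonneg h.sum_weight_le h.subluminal
  have h1 := sum_solitonForm_le_reducedForm hα.le hk0 hk1 h.subluminal h.weight_nonneg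
    h.sum_weight_le h.norm_phase h.amplitude_nonneg h.amplitude_le hA hτ0 hτ1 h.abs_coeff_le
    h.abs_le h.div_le h.cutoff_nonneg h.cutoff_le h.abs_deriv_le h.separated h.deriv_eq_zero
    h.amplitude_far u ux
  have h2 : reducedForm α β c (∑ i, p i * c i) (∑ i, p i * ω i) f e u ux ≤
      density α β c ω p f e u ux ρ v n :=
    reduced_le_density hα.le (by linarith [sq_nonneg (∑ i, p i * ω i)])
  have hr : |∑ i, f i * (conj (e i) * u).re| ≤ (Fintype.card ι * A) * ‖u‖ := by
    calc |∑ i, f i * (conj (e i) * u).re| ≤ ∑ i, |f i * (conj (e i) * u).re| :=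
          Finset.abs_sum_le_sum_abs _ _
      _ ≤ ∑ i : ι, A * ‖u‖ := Finset.sum_le_sum fun i _ =>
          abs_amplitude_mul_le (h.norm_phase i) (h.amplitude_nonneg i) (h.amplitude_le i)
      _ = _ := by rw [Finset.sum_const, nsmul_eq_mul, Finset.card_univ]; ring
  have hw : |∑ i, ((β - α / (1 - c i ^ 2)) * f i ^ 2 * ‖u‖ ^ 2 +
      2 * β * (f i * (conj (e i) * u).re) ^ 2)| ≤ (3 * Fintype.card ι * B * A ^ 2) * ‖u‖ ^ 2 := by
    calc |∑ i, ((β - α / (1 - c i ^ 2)) * f i ^ 2 * ‖u‖ ^ 2 +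
      2 * β * (f i * (conj (e i) * u).re) ^ 2)| ≤ ∑ i, |(β - α / (1 - c i ^ 2)) * f i ^ 2 *
        ‖u‖ ^ 2 + 2 * β * (f i * (conj (e i) * u).re) ^ 2| := Finset.abs_sum_le_sum_abs _ _
      _ ≤ ∑ i : ι, 3 * B * A ^ 2 * ‖u‖ ^ 2 := Finset.sum_le_sum fun i _ =>
          abs_potential_le (h.norm_phase i) (by rw [abs_sub_comm]; exact h.abs_coeff_le i) h.abs_le
            (h.amplitude_nonneg i) (h.amplitude_le i)
      _ = _ := by rw [Finset.sum_const, nsmul_eq_mul, Finset.card_univ]; ring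
  have h3 : min (1 / 2) (α * k₀ / 8) * (‖ρ‖ ^ 2 + v ^ 2 + n ^ 2) -
      lossConst (Fintype.card ι) α k₀ A B * (‖u‖ ^ 2 + ‖ux‖ ^ 2) ≤
      density α β c ω p f e u ux ρ v n :=
    KGZ.le_density hα hk0 (by positivity) hCΩ hr hw
  have h4 : (∑ i, solitonForm (ω i) (c i) ((α / (1 - c i ^ 2) - β) * f i ^ 2) (e i)
        ((z i : ℂ) * u) ((z i : ℂ) * ux + (z' i : ℂ) * u) +
      k₀ * ((1 - ∑ i, z i ^ 2) * (‖u‖ ^ 2 + ‖ux‖ ^ 2)) -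
      errConst (Fintype.card ι) A B * τ * (‖u‖ ^ 2 + ‖ux‖ ^ 2)) ≤
      density α β c ω p f e u ux ρ v n := by
    rw [errConst]
    linarith
  have h5 := mul_le_mul_of_nonneg_left h4 (sub_nonneg.2 hs1)
  have h6 := mul_le_mul_of_nonneg_left h3 hs0
  linarith

/-- The integrated lower bound, from the coercivity of each soliton on the support of its cutoff. -/
theorem le_integral_density {ι : Type*} [Fintype ι] {α β k₀ A B τ : ℝ} {c ω : ι → ℝ}
    {p f z z' : ι → ℝ → ℝ} {e : ι → ℝ → ℂ} (h : ∀ x, IsSeparated α β k₀ A B τ c ω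
      (fun i => p i x) (fun i => f i x) (fun i => z i x) (fun i => z' i x) (fun i => e i x))
    (hα : 0 < α) (hk0 : 0 < k₀) (hk1 : k₀ ≤ 1) (hA : 1 ≤ A) (hτ0 : 0 < τ) (hτ1 : τ ≤ 1) {s : ℝ}
    (hs0 : 0 ≤ s) (hs1 : s ≤ 1) (hf : ∀ i, Continuous (f i)) (hz : ∀ i, Continuous (z i))
    (hz' : ∀ i, Continuous (z' i)) (he : ∀ i, Continuous (e i)) (ε : Energy) {k D : ℝ} (hkk : k ≤ k₀)
    (hD : Integrable fun x => density α β c ω (fun i => p i x) (fun i => f i x) (fun i => e i x)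
      (ε.u x) (ε.ux x) (ε.ρ x) (ε.v x) (ε.n x))
    (hcoer : ∀ i, k * ∫ x, z i x ^ 2 * (‖ε.u x‖ ^ 2 + ‖ε.ux x‖ ^ 2) ≤
      (∫ x, solitonForm (ω i) (c i) ((α / (1 - c i ^ 2) - β) * f i x ^ 2) (e i x)
        ((z i x : ℂ) * ε.u x) ((z i x : ℂ) * ε.ux x + (z' i x : ℂ) * ε.u x)) +
      D * τ * ∫ x, (‖ε.u x‖ ^ 2 + ‖ε.ux x‖ ^ 2)) :
    (1 - s) * ((k - (Fintype.card ι * D + errConst (Fintype.card ι) A B) * τ) *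
        ∫ x, (‖ε.u x‖ ^ 2 + ‖ε.ux x‖ ^ 2)) +
      s * (min (1 / 2) (α * k₀ / 8) * (∫ x, (‖ε.ρ x‖ ^ 2 + ε.v x ^ 2 + ε.n x ^ 2)) -
        lossConst (Fintype.card ι) α k₀ A B * ∫ x, (‖ε.u x‖ ^ 2 + ‖ε.ux x‖ ^ 2)) ≤
    ∫ x, density α β c ω (fun i => p i x) (fun i => f i x) (fun i => e i x)
      (ε.u x) (ε.ux x) (ε.ρ x) (ε.v x) (ε.n x) := by
  have hB0 : 0 ≤ B := (abs_nonneg _).trans (h 0).abs_le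
  have iE : Integrable fun x => ‖ε.u x‖ ^ 2 + ‖ε.ux x‖ ^ 2 :=
    (ε.memLp_u.integrable_norm_pow (by norm_num)).add
      (ε.memLp_ux.integrable_norm_pow (by norm_num))
  have iF : Integrable fun x => ‖ε.ρ x‖ ^ 2 + ε.v x ^ 2 + ε.n x ^ 2 :=
    ((ε.memLp_ρ.integrable_norm_pow (by norm_num)).add ε.memLp_v.integrable_sq).add
      ε.memLp_n.integrable_sq
  have izE : ∀ i, Integrable fun x => z i x ^ 2 * (‖ε.u x‖ ^ 2 + ‖ε.ux x‖ ^ 2) := fun i =>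
    iE.bdd_mul (c := 1) (by have := hz i; fun_prop) (ae_of_all _ fun x => by
      rw [Real.norm_eq_abs, abs_of_nonneg (sq_nonneg _)]
      exact pow_le_one₀ ((h x).cutoff_nonneg i) ((h x).cutoff_le i))
  have iq : ∀ i, Integrable fun x => solitonForm (ω i) (c i) ((α / (1 - c i ^ 2) - β) * f i x ^ 2)
      (e i x) ((z i x : ℂ) * ε.u x) ((z i x : ℂ) * ε.ux x + (z' i x : ℂ) * ε.u x) := by
    intro i
    have c1 := hz i
    have c2 := hz' i
    have c3 := hf i
    have bz : ∀ x, ‖(z i x : ℂ)‖ ≤ 1 := fun x => by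
      rw [Complex.norm_real, Real.norm_eq_abs, abs_of_nonneg ((h x).cutoff_nonneg i)]
      exact (h x).cutoff_le i
    have bz' : ∀ x, ‖(z' i x : ℂ)‖ ≤ τ := fun x => by
      rw [Complex.norm_real, Real.norm_eq_abs]
      exact (h x).abs_deriv_le i
    have m1 : MemLp (fun x => (z i x : ℂ) * ε.u x) 2 :=
      memLp_continuous_mul (by fun_prop) bz ε.memLp_u
    have m2 : MemLp (fun x => (z i x : ℂ) * ε.ux x) 2 :=
      memLp_continuous_mul (by fun_prop) bz ε.memLp_ux
    have m3 : MemLp (fun x => (z' i x : ℂ) * ε.u x) 2 :=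
      memLp_continuous_mul (by fun_prop) bz' ε.memLp_u
    refine integrable_solitonForm (V := B * A ^ 2) (by fun_prop) (fun x => ?_) (he i)
      (fun x => (h x).norm_phase i) m1 (m2.add m3)
    rw [abs_mul, abs_of_nonneg (sq_nonneg (f i x))]
    exact mul_le_mul ((h x).abs_coeff_le i)
      (pow_le_pow_left₀ ((h x).amplitude_nonneg i) ((h x).amplitude_le i) 2) (sq_nonneg _) hB0
  have iq' := integrable_finsetSum Finset.univ fun i _ => iq i
  have izE' := integrable_finsetSum Finset.univ fun i _ => izE i
  have iG : Integrable fun x => k * ((‖ε.u x‖ ^ 2 + ‖ε.ux x‖ ^ 2) -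
      ∑ i, z i x ^ 2 * (‖ε.u x‖ ^ 2 + ‖ε.ux x‖ ^ 2)) := (iE.sub izE').const_mul k
  set Λ := errConst (Fintype.card ι) A B * τ
  set Γ := lossConst (Fintype.card ι) α k₀ A B
  set m := min (1 / 2) (α * k₀ / 8)
  have iL1 : Integrable fun x => (∑ i, solitonForm (ω i) (c i) ((α / (1 - c i ^ 2) - β) * f i x ^ 2)
      (e i x) ((z i x : ℂ) * ε.u x) ((z i x : ℂ) * ε.ux x + (z' i x : ℂ) * ε.u x)) +
      k * ((‖ε.u x‖ ^ 2 + ‖ε.ux x‖ ^ 2) - ∑ i, z i x ^ 2 * (‖ε.u x‖ ^ 2 + ‖ε.ux x‖ ^ 2)) -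
      Λ * (‖ε.u x‖ ^ 2 + ‖ε.ux x‖ ^ 2) := (iq'.add iG).sub (iE.const_mul Λ)
  have iL2 : Integrable fun x => m * (‖ε.ρ x‖ ^ 2 + ε.v x ^ 2 + ε.n x ^ 2) -
      Γ * (‖ε.u x‖ ^ 2 + ‖ε.ux x‖ ^ 2) := (iF.const_mul m).sub (iE.const_mul Γ)
  have iL := (iL1.const_mul (1 - s)).add (iL2.const_mul s)
  have mono := integral_mono iL hD fun x => by
    refine le_trans ?_ ((h x).le_density hα hk0 hk1 hA hτ0 hτ1 hs0 hs1 (ε.u x) (ε.ux x) (ε.ρ x)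
      (ε.v x) (ε.n x))
    simp only [Pi.add_apply]
    refine add_le_add_left (mul_le_mul_of_nonneg_left ?_ (sub_nonneg.2 hs1)) _
    refine sub_le_sub_right (add_le_add_right ?_ _) _
    rw [← Finset.sum_mul, ← one_sub_mul]
    exact mul_le_mul_of_nonneg_right hkk (mul_nonneg (sub_nonneg.2 (h x).sum_sq_le)
      (by positivity))
  have eL1 : ∫ x, ((∑ i, solitonForm (ω i) (c i) ((α / (1 - c i ^ 2) - β) * f i x ^ 2)
      (e i x) ((z i x : ℂ) * ε.u x) ((z i x : ℂ) * ε.ux x + (z' i x : ℂ) * ε.u x)) +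
      k * ((‖ε.u x‖ ^ 2 + ‖ε.ux x‖ ^ 2) - ∑ i, z i x ^ 2 * (‖ε.u x‖ ^ 2 + ‖ε.ux x‖ ^ 2)) -
      Λ * (‖ε.u x‖ ^ 2 + ‖ε.ux x‖ ^ 2)) =
      (∑ i, ∫ x, solitonForm (ω i) (c i) ((α / (1 - c i ^ 2) - β) * f i x ^ 2)
      (e i x) ((z i x : ℂ) * ε.u x) ((z i x : ℂ) * ε.ux x + (z' i x : ℂ) * ε.u x)) +
      k * ((∫ x, (‖ε.u x‖ ^ 2 + ‖ε.ux x‖ ^ 2)) -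
        ∑ i, ∫ x, z i x ^ 2 * (‖ε.u x‖ ^ 2 + ‖ε.ux x‖ ^ 2)) -
      Λ * ∫ x, (‖ε.u x‖ ^ 2 + ‖ε.ux x‖ ^ 2) := by
    rw [integral_sub (by exact iq'.add iG) (iE.const_mul Λ), integral_add iq' iG,
      integral_const_mul, integral_const_mul, integral_sub iE izE',
      integral_finsetSum _ fun i _ => iq i, integral_finsetSum _ fun i _ => izE i]
  have eL2 : ∫ x, (m * (‖ε.ρ x‖ ^ 2 + ε.v x ^ 2 + ε.n x ^ 2) -
      Γ * (‖ε.u x‖ ^ 2 + ‖ε.ux x‖ ^ 2)) = m * (∫ x, (‖ε.ρ x‖ ^ 2 + ε.v x ^ 2 + ε.n x ^ 2)) -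
      Γ * ∫ x, (‖ε.u x‖ ^ 2 + ‖ε.ux x‖ ^ 2) := by
    rw [integral_sub (iF.const_mul m) (iE.const_mul Γ), integral_const_mul, integral_const_mul]
  refine le_trans ?_ mono
  rw [integral_add' (iL1.const_mul (1 - s)) (iL2.const_mul s), integral_const_mul,
    integral_const_mul, eL1, eL2]
  have hsum := Finset.sum_le_sum fun i (_ : i ∈ Finset.univ) => hcoer i
  rw [← Finset.mul_sum, Finset.sum_add_distrib, Finset.sum_const, nsmul_eq_mul,
    Finset.card_univ] at hsum
  refine add_le_add_left (mul_le_mul_of_nonneg_left ?_ (sub_nonneg.2 hs1)) _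
  linarith

/-- The quadratic form is the integral of the density. -/
theorem integral_density_eq {ι : Type*} [Fintype ι] {α β A : ℝ} {c ω : ι → ℝ}
    {p f : ι → ℝ → ℝ} {e : ι → ℝ → ℂ} (hf : ∀ i, Continuous (f i)) (hfA : ∀ i x, |f i x| ≤ A)
    (he : ∀ i, Continuous (e i)) (he1 : ∀ i x, ‖e i x‖ = 1) (hp : ∀ i, Continuous (p i))
    (hp1 : ∀ i x, |p i x| ≤ 1) (ε : Energy) :
    (Integrable fun x => density α β c ω (fun i => p i x) (fun i => f i x) (fun i => e i x)
      (ε.u x) (ε.ux x) (ε.ρ x) (ε.v x) (ε.n x)) ∧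
    ∫ x, density α β c ω (fun i => p i x) (fun i => f i x) (fun i => e i x)
      (ε.u x) (ε.ux x) (ε.ρ x) (ε.v x) (ε.n x) =
    (∫ x, (‖ε.ux x‖ ^ 2 + ‖ε.u x‖ ^ 2 + ‖ε.ρ x‖ ^ 2 + α / 2 * ε.v x ^ 2 + α / 2 * ε.n x ^ 2)) +
    ∑ j, (α * (∫ x, -(f j x ^ 2 / (1 - c j ^ 2)) * ‖ε.u x‖ ^ 2) +
      2 * α * (∫ x, (e j x * (f j x : ℂ) * conj (ε.u x)).re * ε.v x) +
      β * (∫ x, ‖e j x * (f j x : ℂ)‖ ^ 2 * ‖ε.u x‖ ^ 2) +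
      2 * β * (∫ x, (e j x * (f j x : ℂ) * conj (ε.u x)).re ^ 2)) +
    ∑ j, (α * c j * (∫ x, ε.v x * ε.n x * p j x) -
      2 * ω j * (∫ x, (conj (ε.u x) * ε.ρ x).im * p j x) -
      2 * c j * (∫ x, (ε.ux x * conj (ε.ρ x)).re * p j x)) := by
  have iu := ε.memLp_u.integrable_norm_pow (p := 2) (by norm_num)
  have i0 : Integrable fun x =>
      ‖ε.ux x‖ ^ 2 + ‖ε.u x‖ ^ 2 + ‖ε.ρ x‖ ^ 2 + α / 2 * ε.v x ^ 2 + α / 2 * ε.n x ^ 2 :=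
    ((((ε.memLp_ux.integrable_norm_pow (by norm_num)).add iu).add
      (ε.memLp_ρ.integrable_norm_pow (by norm_num))).add
      (ε.memLp_v.integrable_sq.const_mul _)).add (ε.memLp_n.integrable_sq.const_mul _)
  have hre : ∀ j x, (e j x * (f j x : ℂ) * conj (ε.u x)).re = f j x * (conj (e j x) * ε.u x).re := by
    intro j x
    simp only [Complex.mul_re, Complex.mul_im, Complex.ofReal_re, Complex.ofReal_im,
      Complex.conj_re, Complex.conj_im]
    ring
  have hnorm : ∀ j x, ‖e j x * (f j x : ℂ)‖ ^ 2 = f j x ^ 2 := by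
    intro j x
    rw [norm_mul, he1, one_mul, Complex.norm_real, Real.norm_eq_abs, sq_abs]
  have hf2 : ∀ j x, |f j x ^ 2| ≤ A ^ 2 := fun j x => by
    rw [abs_pow]; exact pow_le_pow_left₀ (abs_nonneg _) (hfA j x) 2
  have mR : ∀ j, MemLp (fun x => (e j x * (f j x : ℂ) * conj (ε.u x)).re) 2 := by
    intro j
    have c1 := he j
    have c2 := hf j
    exact (memLp_continuous_mul (M := A) (g := fun x => e j x * (f j x : ℂ)) (by fun_prop)
      (fun x => by rw [norm_mul, he1, one_mul, Complex.norm_real]; exact hfA j x)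
      ε.memLp_u.star).re
  have i1 : ∀ j, Integrable fun x => -(f j x ^ 2 / (1 - c j ^ 2)) * ‖ε.u x‖ ^ 2 := by
    intro j
    have c2 := hf j
    refine iu.bdd_mul (c := A ^ 2 / |1 - c j ^ 2|) (by fun_prop) (ae_of_all _ fun x => ?_)
    rw [norm_neg, norm_div, Real.norm_eq_abs, Real.norm_eq_abs]
    exact div_le_div_of_nonneg_right (hf2 j x) (abs_nonneg _)
  have i2 : ∀ j, Integrable fun x => (e j x * (f j x : ℂ) * conj (ε.u x)).re * ε.v x := fun j =>
    (mR j).integrable_mul ε.memLp_v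
  have i3 : ∀ j, Integrable fun x => ‖e j x * (f j x : ℂ)‖ ^ 2 * ‖ε.u x‖ ^ 2 := by
    intro j
    have c1 := he j
    have c2 := hf j
    refine iu.bdd_mul (c := A ^ 2) (by fun_prop) (ae_of_all _ fun x => ?_)
    rw [hnorm]
    exact hf2 j x
  have i4 : ∀ j, Integrable fun x => (e j x * (f j x : ℂ) * conj (ε.u x)).re ^ 2 := fun j =>
    (mR j).integrable_sq
  have bp : ∀ j, ∀ᵐ x, ‖p j x‖ ≤ 1 := fun j => ae_of_all _ (hp1 j)
  have sp : ∀ j, AEStronglyMeasurable (p j) := fun j => (hp j).aestronglyMeasurable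
  have i5 : ∀ j, Integrable fun x => ε.v x * ε.n x * p j x := fun j =>
    (ε.memLp_v.integrable_mul ε.memLp_n).mul_bdd (c := 1) (sp j) (bp j)
  have i6 : ∀ j, Integrable fun x => (conj (ε.u x) * ε.ρ x).im * p j x := fun j => by
    have : Integrable fun x => conj (ε.u x) * ε.ρ x := ε.memLp_u.star.integrable_mul ε.memLp_ρ
    exact this.im.mul_bdd (c := 1) (sp j) (bp j)
  have i7 : ∀ j, Integrable fun x => (ε.ux x * conj (ε.ρ x)).re * p j x := fun j => by
    have : Integrable fun x => ε.ux x * conj (ε.ρ x) := ε.memLp_ux.integrable_mul ε.memLp_ρ.star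
    exact this.re.mul_bdd (c := 1) (sp j) (bp j)
  have iG : ∀ j, Integrable fun x => α * (-(f j x ^ 2 / (1 - c j ^ 2)) * ‖ε.u x‖ ^ 2) +
      2 * α * ((e j x * (f j x : ℂ) * conj (ε.u x)).re * ε.v x) +
      β * (‖e j x * (f j x : ℂ)‖ ^ 2 * ‖ε.u x‖ ^ 2) +
      2 * β * (e j x * (f j x : ℂ) * conj (ε.u x)).re ^ 2 := fun j =>
    ((((i1 j).const_mul _).add ((i2 j).const_mul _)).add ((i3 j).const_mul _)).add
      ((i4 j).const_mul _)
  have iH : ∀ j, Integrable fun x => α * c j * (ε.v x * ε.n x * p j x) -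
      2 * ω j * ((conj (ε.u x) * ε.ρ x).im * p j x) -
      2 * c j * ((ε.ux x * conj (ε.ρ x)).re * p j x) := fun j =>
    (((i5 j).const_mul _).sub ((i6 j).const_mul _)).sub ((i7 j).const_mul _)
  have eG : ∀ j, ∫ x, (α * (-(f j x ^ 2 / (1 - c j ^ 2)) * ‖ε.u x‖ ^ 2) +
      2 * α * ((e j x * (f j x : ℂ) * conj (ε.u x)).re * ε.v x) +
      β * (‖e j x * (f j x : ℂ)‖ ^ 2 * ‖ε.u x‖ ^ 2) +
      2 * β * (e j x * (f j x : ℂ) * conj (ε.u x)).re ^ 2) =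
      α * (∫ x, -(f j x ^ 2 / (1 - c j ^ 2)) * ‖ε.u x‖ ^ 2) +
      2 * α * (∫ x, (e j x * (f j x : ℂ) * conj (ε.u x)).re * ε.v x) +
      β * (∫ x, ‖e j x * (f j x : ℂ)‖ ^ 2 * ‖ε.u x‖ ^ 2) +
      2 * β * (∫ x, (e j x * (f j x : ℂ) * conj (ε.u x)).re ^ 2) := fun j => by
    rw [integral_add (by exact ((((i1 j).const_mul _).add ((i2 j).const_mul _)).add
      ((i3 j).const_mul _))) ((i4 j).const_mul _),
      integral_add (by exact ((i1 j).const_mul _).add ((i2 j).const_mul _)) ((i3 j).const_mul _),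
      integral_add ((i1 j).const_mul _) ((i2 j).const_mul _),
      integral_const_mul, integral_const_mul, integral_const_mul, integral_const_mul]
  have eH : ∀ j, ∫ x, (α * c j * (ε.v x * ε.n x * p j x) -
      2 * ω j * ((conj (ε.u x) * ε.ρ x).im * p j x) -
      2 * c j * ((ε.ux x * conj (ε.ρ x)).re * p j x)) =
      α * c j * (∫ x, ε.v x * ε.n x * p j x) -
      2 * ω j * (∫ x, (conj (ε.u x) * ε.ρ x).im * p j x) -
      2 * c j * (∫ x, (ε.ux x * conj (ε.ρ x)).re * p j x) := fun j => by
    rw [integral_sub (by exact ((i5 j).const_mul _).sub ((i6 j).const_mul _))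
      ((i7 j).const_mul _),
      integral_sub ((i5 j).const_mul _) ((i6 j).const_mul _),
      integral_const_mul, integral_const_mul, integral_const_mul]
  have pt : ∀ x, density α β c ω (fun i => p i x) (fun i => f i x) (fun i => e i x)
      (ε.u x) (ε.ux x) (ε.ρ x) (ε.v x) (ε.n x) =
      (‖ε.ux x‖ ^ 2 + ‖ε.u x‖ ^ 2 + ‖ε.ρ x‖ ^ 2 + α / 2 * ε.v x ^ 2 + α / 2 * ε.n x ^ 2) +
      ∑ j, (α * (-(f j x ^ 2 / (1 - c j ^ 2)) * ‖ε.u x‖ ^ 2) +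
      2 * α * ((e j x * (f j x : ℂ) * conj (ε.u x)).re * ε.v x) +
      β * (‖e j x * (f j x : ℂ)‖ ^ 2 * ‖ε.u x‖ ^ 2) +
      2 * β * (e j x * (f j x : ℂ) * conj (ε.u x)).re ^ 2) +
      ∑ j, (α * c j * (ε.v x * ε.n x * p j x) -
      2 * ω j * ((conj (ε.u x) * ε.ρ x).im * p j x) -
      2 * c j * ((ε.ux x * conj (ε.ρ x)).re * p j x)) := by
    intro x
    rw [density]
    congr 1
    · congr 1
      rw [Finset.mul_sum, Finset.sum_mul, ← Finset.sum_add_distrib]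
      refine Finset.sum_congr rfl fun j _ => ?_
      rw [hre, hnorm]
      ring
    · simp only [Finset.mul_sum, Finset.sum_mul, ← Finset.sum_sub_distrib]
      refine Finset.sum_congr rfl fun j _ => ?_
      ring
  have iG' := integrable_finsetSum Finset.univ fun j _ => iG j
  have iH' := integrable_finsetSum Finset.univ fun j _ => iH j
  simp only [pt]
  refine ⟨(i0.add iG').add iH', ?_⟩
  rw [integral_add (by exact i0.add iG') iH', integral_add i0 iG', integral_finsetSum _ fun j _ => iG j,
    integral_finsetSum _ fun j _ => iH j]
  simp only [eG, eH]

/-! ### The orthogonality conditions -/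

theorem realInner_eq {f g : ℝ → ℂ} (hf : MemLp f 2) (hg : MemLp g 2) :
    realInner f g = ∫ x, (f x * conj (g x)).re := by
  have h : Integrable fun x => f x * conj (g x) := hf.integrable_mul hg.star
  exact (integral_re h).symm

theorem hasDerivAt_profile (α β ω c x : ℝ) : HasDerivAt (profile α β ω c)
    (-(Real.sqrt (2 * (1 - c ^ 2 - ω ^ 2) / (α - β * (1 - c ^ 2))) * invWidth ω c *
      (sech (invWidth ω c * x) * Real.tanh (invWidth ω c * x)))) x := by
  have h1 : HasDerivAt (fun x => invWidth ω c * x) (invWidth ω c) x := by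
    simpa using (hasDerivAt_id x).const_mul (invWidth ω c)
  have h2 := ((hasDerivAt_sech (invWidth ω c * x)).comp x h1).const_mul
    (Real.sqrt (2 * (1 - c ^ 2 - ω ^ 2) / (α - β * (1 - c ^ 2))))
  have e : profile α β ω c = fun x =>
      Real.sqrt (2 * (1 - c ^ 2 - ω ^ 2) / (α - β * (1 - c ^ 2))) *
        (sech ∘ fun x => invWidth ω c * x) x := funext fun x => profile_eq α β ω c x
  rw [e]
  exact h2.congr_deriv (by ring)

theorem continuous_profile (α β ω c : ℝ) : Continuous (profile α β ω c) :=
  continuous_iff_continuousAt.2 fun x => (hasDerivAt_profile α β ω c x).continuousAt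

/-- The orthogonality conditions in terms of the real and imaginary parts of `ε₁`, after removal
of the phase. Orthogonality to `i R` is used to remove the contribution of the derivative of the
phase from orthogonality to `∂ₓ R`. -/
theorem integral_eq_zero_of_orthogonal {α β ω c ω' x' γ t : ℝ} {Ψ : ℝ → ℝ} {u : ℝ → ℂ}
    (hu : MemLp u 2) (h : 0 < 1 - c ^ 2 - ω ^ 2) (h' : 0 < 1 - c ^ 2 - ω' ^ 2)
    (hβ : 0 < α - β * (1 - c ^ 2)) (hΨ : IsNegEigenfunction α β ω c Ψ)
    (o1 : realInner u (deriv (soliton₁ α β ω c ω' x' γ t)) = 0)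
    (o2 : realInner u (fun x => Complex.I * soliton₁ α β ω c ω' x' γ t x) = 0)
    (o3 : realInner u (negDir Ψ ω c x' γ t) = 0) :
    (∫ x, (conj (phase ω c γ t x) * u x).re * sech (invWidth ω c * (x - (c * t + x'))) ^ 2 = 0) ∧
    (∫ x, (conj (phase ω c γ t x) * u x).re * (sech (invWidth ω' c * (x - (c * t + x'))) *
      Real.tanh (invWidth ω' c * (x - (c * t + x')))) = 0) ∧
    ∫ x, (conj (phase ω c γ t x) * u x).im * sech (invWidth ω' c * (x - (c * t + x'))) = 0 := by
  have hκ : 0 < invWidth ω c := invWidth_pos h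
  have hκ' : 0 < invWidth ω' c := invWidth_pos h'
  set κ := invWidth ω c
  set κ' := invWidth ω' c with hκ'd
  set a := Real.sqrt (2 * (1 - c ^ 2 - ω' ^ 2) / (α - β * (1 - c ^ 2))) with ha
  have ha0 : 0 < a := Real.sqrt_pos.2 (by positivity)
  set y := c * t + x' with hy
  have hxy : ∀ x : ℝ, x - c * t - x' = x - y := fun x => by rw [hy, sub_sub]
  set e : ℝ → ℂ := phase ω c γ t with he
  set θ : ℝ := ω * c / (1 - c ^ 2) with hθ
  have hec : Continuous e := continuous_phase ω c γ t
  have he1 : ∀ x, ‖e x‖ ≤ 1 := fun x => (norm_phase ω c γ t x).le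
  have m1 : MemLp (fun x => sech (κ * (x - y)) ^ 2) 2 :=
    memLp_two_comp_mul_sub (f := fun x => sech x ^ 2) (by fun_prop) abs_sech_sq_le hκ y
  have m2 : MemLp (fun x => sech (κ' * (x - y)) * Real.tanh (κ' * (x - y))) 2 :=
    memLp_two_comp_mul_sub (f := fun x => sech x * Real.tanh x) (by fun_prop)
      abs_sech_mul_tanh_le hκ' y
  have m3 : MemLp (fun x => sech (κ' * (x - y))) 2 :=
    memLp_two_comp_mul_sub (f := sech) (by fun_prop)
      (fun x => by rw [one_mul, abs_of_pos (sech_pos x)]) hκ' y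
  have hw : MemLp (fun x => conj (e x) * u x) 2 :=
    memLp_continuous_mul (M := 1) (by fun_prop) (fun x => by simpa using he1 x) hu
  have i2 : Integrable fun x => (conj (e x) * u x).re *
      (sech (κ' * (x - y)) * Real.tanh (κ' * (x - y))) := hw.re.integrable_mul m2
  have i3 : Integrable fun x => (conj (e x) * u x).im * sech (κ' * (x - y)) :=
    hw.im.integrable_mul m3
  have hR : ∀ x, soliton₁ α β ω c ω' x' γ t x = e x * ((a * sech (κ' * (x - y)) : ℝ) : ℂ) := by
    intro x
    rw [soliton₁, hxy, profile_eq]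
  have hR' : ∀ x, deriv (soliton₁ α β ω c ω' x' γ t) x = e x *
      ((-(a * κ' * (sech (κ' * (x - y)) * Real.tanh (κ' * (x - y)))) : ℝ) +
        Complex.I * ((θ * (a * sech (κ' * (x - y))) : ℝ) : ℂ)) := by
    intro x
    have d1 : HasDerivAt (fun x => profile α β ω' c (x - c * t - x'))
        (-(a * κ' * (sech (κ' * (x - y)) * Real.tanh (κ' * (x - y))))) x := by
      have := (hasDerivAt_profile α β ω' c (x - c * t - x')).comp x
        (((hasDerivAt_id x).sub_const (c * t)).sub_const x')
      exact this.congr_deriv (by rw [mul_one, hxy])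
    have d2 := (hasDerivAt_phase ω c γ t x).fun_mul d1.ofReal_comp
    have d3 : HasDerivAt (soliton₁ α β ω c ω' x' γ t) _ x := d2
    rw [d3.deriv, hxy, profile_eq, ← hθ, ← ha, ← hκ'd, ← he]
    push_cast
    ring
  have z3 : ∫ x, (conj (e x) * u x).im * sech (κ' * (x - y)) = 0 := by
    rw [realInner_eq hu] at o2
    · have : ∀ x, (u x * conj (Complex.I * soliton₁ α β ω c ω' x' γ t x)).re =
          a * ((conj (e x) * u x).im * sech (κ' * (x - y))) := by
        intro x
        rw [hR]
        simp only [Complex.mul_re, Complex.mul_im, Complex.I_re, Complex.I_im, Complex.ofReal_re,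
          Complex.ofReal_im, Complex.conj_re, Complex.conj_im]
        ring
      simp only [this] at o2
      rw [integral_const_mul] at o2
      exact (mul_eq_zero.1 o2).resolve_left ha0.ne'
    · simp only [hR]
      exact (memLp_continuous_mul hec he1 ((m3.const_mul a).ofReal)).const_mul Complex.I
  refine ⟨?_, ?_, z3⟩
  · obtain ⟨p, hp, hpΨ⟩ := hΨ.eq_sech_sq h hβ
    have hN : ∀ x, negDir Ψ ω c x' γ t x = e x * ((p * sech (κ * (x - y)) ^ 2 : ℝ) : ℂ) := by
      intro x
      rw [negDir, hxy, hpΨ]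
    rw [realInner_eq hu] at o3
    · have : ∀ x, (u x * conj (negDir Ψ ω c x' γ t x)).re =
          p * ((conj (e x) * u x).re * sech (κ * (x - y)) ^ 2) := by
        intro x
        rw [hN]
        simp only [Complex.mul_re, Complex.mul_im, Complex.ofReal_re,
          Complex.ofReal_im, Complex.conj_re, Complex.conj_im]
        ring
      simp only [this] at o3
      rw [integral_const_mul] at o3
      exact (mul_eq_zero.1 o3).resolve_left hp
    · rw [show negDir Ψ ω c x' γ t = _ from funext hN]
      exact memLp_continuous_mul hec he1 ((m1.const_mul p).ofReal)
  · rw [realInner_eq hu] at o1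
    · have : ∀ x, (u x * conj (deriv (soliton₁ α β ω c ω' x' γ t) x)).re =
          -(a * κ') * ((conj (e x) * u x).re * (sech (κ' * (x - y)) * Real.tanh (κ' * (x - y)))) +
          θ * a * ((conj (e x) * u x).im * sech (κ' * (x - y))) := by
        intro x
        rw [hR']
        simp only [Complex.mul_re, Complex.mul_im, Complex.add_re, Complex.add_im, Complex.I_re,
          Complex.I_im, Complex.ofReal_re, Complex.ofReal_im, Complex.conj_re, Complex.conj_im]
        ring
      simp only [this] at o1
      rw [integral_add (i2.const_mul _) (i3.const_mul _), integral_const_mul, integral_const_mul,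
        z3, mul_zero, add_zero] at o1
      exact (mul_eq_zero.1 o1).resolve_left (neg_ne_zero.2 (by positivity))
    · rw [show deriv (soliton₁ α β ω c ω' x' γ t) = _ from funext hR']
      have q1 : MemLp (fun x => -(a * κ' * (sech (κ' * (x - y)) * Real.tanh (κ' * (x - y))))) 2 :=
        (m2.const_mul (a * κ')).neg
      have q2 : MemLp (fun x => θ * (a * sech (κ' * (x - y)))) 2 := (m3.const_mul a).const_mul θ
      have q3 := q1.ofReal (K := ℂ)
      have q4 := (q2.ofReal (K := ℂ)).const_mul Complex.I
      exact memLp_continuous_mul hec he1 (q3.add q4)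

/-! ### The localization functions -/

theorem IsCutoff.mem_Icc {ψ : ℝ → ℝ} (h : IsCutoff ψ) (s : ℝ) : ψ s ∈ Icc (0 : ℝ) 1 := by
  obtain ⟨-, h0, h1, h2⟩ := h
  rcases lt_or_ge s (-1) with hs | hs
  · rw [h0 s hs]; simp
  rcases lt_or_ge 1 s with hs' | hs'
  · rw [h2 s hs']; simp
  · exact h1 s ⟨hs, hs'⟩

section Localization

variable {N : ℕ} {ψ : ℝ → ℝ} {c : Fin N → ℝ} {t : ℝ}

theorem continuous_step (h : IsCutoff ψ) (j : ℕ) : Continuous (step ψ c j t) := by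
  have hψ : Continuous ψ := h.1.continuous
  by_cases h0 : j = 0
  · have : step ψ c j t = fun _ => 1 := funext fun x => by rw [step, if_pos h0]
    rw [this]
    exact continuous_const
  by_cases hN : j < N
  · have : step ψ c j t = fun x => ψ ((x - (c ⟨j - 1, lt_of_le_of_lt (Nat.sub_le j 1) hN⟩ +
        c ⟨j, hN⟩) / 2 * t) / Real.sqrt t) := funext fun x => by
      rw [step, if_neg h0, dif_pos hN]
    rw [this]
    fun_prop
  · have : step ψ c j t = fun _ => 0 := funext fun x => by rw [step, if_neg h0, dif_neg hN]
    rw [this]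
    exact continuous_const

theorem continuous_loc (h : IsCutoff ψ) (j : Fin N) : Continuous (loc ψ c j t) :=
  (continuous_step h _).sub (continuous_step h _)

theorem step_mem_Icc (h : IsCutoff ψ) (j : ℕ) (x : ℝ) : step ψ c j t x ∈ Icc (0 : ℝ) 1 := by
  rw [step]
  split_ifs
  · simp
  · exact h.mem_Icc _
  · simp

/-- The localization functions form a partition of unity, or the empty sum when `N = 0`. -/
theorem sum_loc_le (h : IsCutoff ψ) (x : ℝ) : ∑ j, loc ψ c j t x ≤ 1 := by
  have h1 : ∑ j : Fin N, loc ψ c j t x =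
      ∑ j ∈ Finset.range N, (step ψ c j t x - step ψ c (j + 1) t x) :=
    Fin.sum_univ_eq_sum_range (fun j => step ψ c j t x - step ψ c (j + 1) t x) N
  rw [h1, Finset.sum_range_sub']
  linarith [(step_mem_Icc (c := c) (t := t) h 0 x).2, (step_mem_Icc (c := c) (t := t) h N x).1]

variable {σ : ℝ}

/-- The transition of the step `i` takes place half-way between the solitons `i - 1` and `i`, so the
step equals one from a point to the left of the soliton `i` on. -/
theorem step_eq_one (h : IsCutoff ψ) (ht : 0 < t) (hs : Real.sqrt t < 2 * (σ * t))
    (hg : ∀ i j, i < j → c i + 8 * σ ≤ c j) (i : Fin N) {x : ℝ} (hx : c i * t - 2 * (σ * t) ≤ x) :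
    step ψ c i t x = 1 := by
  rw [step]
  split_ifs with h0 hN
  · rfl
  · have hlt : (⟨i - 1, lt_of_le_of_lt (Nat.sub_le _ 1) hN⟩ : Fin N) < i := by
      rw [Fin.lt_def]
      exact Nat.sub_lt (Nat.pos_of_ne_zero h0) one_pos
    have hc := mul_le_mul_of_nonneg_right (hg _ _ hlt) ht.le
    refine h.2.2.2 _ ?_
    rw [lt_div_iff₀ (Real.sqrt_pos.2 ht), one_mul]
    have hi : c ⟨i, hN⟩ = c i := rfl
    rw [hi]
    linarith
  · exact absurd i.2 hN

/-- The step `i + 1` vanishes up to a point to the right of the soliton `i`. -/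
theorem step_succ_eq_zero (h : IsCutoff ψ) (ht : 0 < t)
    (hs : Real.sqrt t < 2 * (σ * t)) (hg : ∀ i j, i < j → c i + 8 * σ ≤ c j) (i : Fin N) {x : ℝ}
    (hx : x ≤ c i * t + 2 * (σ * t)) : step ψ c (i + 1) t x = 0 := by
  rw [step, if_neg (Nat.succ_ne_zero _)]
  split_ifs with hN
  · have hlt : i < ⟨i + 1, hN⟩ := by
      rw [Fin.lt_def]
      exact Nat.lt_succ_self _
    have hc := mul_le_mul_of_nonneg_right (hg _ _ hlt) ht.le
    refine h.2.1 _ ?_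
    rw [div_lt_iff₀ (Real.sqrt_pos.2 ht)]
    have hi : c ⟨i + 1 - 1, lt_of_le_of_lt (Nat.sub_le _ 1) hN⟩ = c i := rfl
    rw [hi]
    linarith
  · rfl

theorem loc_eq_one (h : IsCutoff ψ) (ht : 0 < t) (hs : Real.sqrt t < 2 * (σ * t))
    (hg : ∀ i j, i < j → c i + 8 * σ ≤ c j) (i : Fin N) {x : ℝ} (hx : |x - c i * t| ≤ 2 * (σ * t)) :
    loc ψ c i t x = 1 := by
  obtain ⟨h1, h2⟩ := abs_le.1 hx
  rw [loc, step_eq_one h ht hs hg i (by linarith), step_succ_eq_zero h ht hs hg i (by linarith),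
    sub_zero]

theorem loc_nonneg (h : IsCutoff ψ) (hσ : 0 < σ) (ht : 0 < t) (hs : Real.sqrt t < 2 * (σ * t))
    (hg : ∀ i j, i < j → c i + 8 * σ ≤ c j) (i : Fin N) (x : ℝ) : 0 ≤ loc ψ c i t x := by
  rw [loc]
  rcases le_total (c i * t) x with hx | hx
  · rw [step_eq_one h ht hs hg i (by nlinarith)]
    linarith [(step_mem_Icc (c := c) (t := t) h (i + 1) x).2]
  · rw [step_succ_eq_zero h ht hs hg i (by nlinarith)]
    linarith [(step_mem_Icc (c := c) (t := t) h i x).1]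

end Localization

/-! ### Choice of the constants and of the time -/

theorem exists_pos_forall_le {ι : Type*} [Finite ι] {a : ι → ℝ} (h : ∀ i, 0 < a i) :
    ∃ r, 0 < r ∧ ∀ i, r ≤ a i := by
  have h1 : ∀ᶠ r in 𝓝[>] (0 : ℝ), ∀ i, r ≤ a i := eventually_all.2 fun i =>
    (eventually_le_nhds (h i)).filter_mono nhdsWithin_le_nhds
  obtain ⟨r, hr, hr0⟩ := (h1.and self_mem_nhdsWithin).exists
  exact ⟨r, hr0, hr⟩

/-- The coercivity of one soliton with a cutoff, in terms of its profile and of the orthogonality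
conditions as they are given. -/
theorem soliton_coercive_of_orthogonal {α β ω c : ℝ} {Ψ : ℝ → ℝ} (h : 0 < 1 - c ^ 2 - ω ^ 2)
    (hβ : 0 < α - β * (1 - c ^ 2)) (hΨ : IsNegEigenfunction α β ω c Ψ) :
    ∃ k, 0 < k ∧ ∃ D, 0 ≤ D ∧ ∀ᶠ ω' in 𝓝 ω, ∀ γ t x' τ : ℝ, ∀ u ux : ℝ → ℂ, ∀ z z' : ℝ → ℝ,
      0 < τ → τ ≤ 1 → MemLp u 2 → MemLp ux 2 → HasWeakDeriv u ux →
      ContDiff ℝ (⊤ : ℕ∞) z → (∀ x, HasDerivAt z (z' x) x) →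
      (∀ x, 0 ≤ z x) → (∀ x, z x ≤ 1) → (∀ x, |z' x| ≤ τ) →
      (∀ x, z x ≠ 1 → sech (invWidth ω c / 2 * (x - c * t - x')) ≤ τ) →
      realInner u (deriv (soliton₁ α β ω c ω' x' γ t)) = 0 →
      realInner u (fun x => Complex.I * soliton₁ α β ω c ω' x' γ t x) = 0 →
      realInner u (negDir Ψ ω c x' γ t) = 0 →
      k * ∫ x, z x ^ 2 * (‖u x‖ ^ 2 + ‖ux x‖ ^ 2) ≤
        (∫ x, solitonForm ω' c ((α / (1 - c ^ 2) - β) * profile α β ω' c (x - c * t - x') ^ 2)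
          (phase ω c γ t x) ((z x : ℂ) * u x) ((z x : ℂ) * ux x + (z' x : ℂ) * u x)) +
        D * τ * ∫ x, (‖u x‖ ^ 2 + ‖ux x‖ ^ 2) := by
  obtain ⟨k, hk, D, hD, hev⟩ := soliton_coercive_cutoff h
  refine ⟨k, hk, D, hD, ?_⟩
  filter_upwards [hev, eventually_one_sub_sq_sub_sq_pos h] with ω' hω' h' γ t x' τ u ux z z' hτ0
    hτ1 hu hux hw hz hzz' hz0 hz1 hz'τ hfar o1 o2 o3
  obtain ⟨p1, p2, p3⟩ := integral_eq_zero_of_orthogonal hu h h' hβ hΨ o1 o2 o3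
  have hc := one_sub_sq_pos h
  have key := hω' γ t (c * t + x') τ u ux z z' hτ0 hτ1 hu hux hw hz hzz' hz0 hz1 hz'τ
    (fun x hx => by rw [← sub_sub]; exact hfar x hx) p1 p2 p3
  have hv : ∀ x, 2 * invWidth ω' c ^ 2 * (1 - c ^ 2) *
      sech (invWidth ω' c * (x - (c * t + x'))) ^ 2 =
      (α / (1 - c ^ 2) - β) * profile α β ω' c (x - c * t - x') ^ 2 := by
    intro x
    rw [profile_sq h' hβ, ← sub_sub, ← invWidth_sq h']
    have h1 := hc.ne'
    have h2 : α - (1 - c ^ 2) * β ≠ 0 := by rw [mul_comm]; exact hβ.ne'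
    rw [mul_comm β]
    field_simp
  simp only [hv] at key
  exact key

theorem Energy.normSq_eq (ε : Energy) : ε.normSq =
    (∫ x, (‖ε.u x‖ ^ 2 + ‖ε.ux x‖ ^ 2)) + ∫ x, (‖ε.ρ x‖ ^ 2 + ε.v x ^ 2 + ε.n x ^ 2) := by
  have i1 : Integrable fun x => ‖ε.u x‖ ^ 2 + ‖ε.ux x‖ ^ 2 :=
    (ε.memLp_u.integrable_norm_pow (by norm_num)).add
      (ε.memLp_ux.integrable_norm_pow (by norm_num))
  have i2 : Integrable fun x => ‖ε.ρ x‖ ^ 2 + ε.v x ^ 2 + ε.n x ^ 2 :=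
    ((ε.memLp_ρ.integrable_norm_pow (by norm_num)).add ε.memLp_v.integrable_sq).add
      ε.memLp_n.integrable_sq
  rw [Energy.normSq, ← integral_add i1 i2]
  congr 1
  ext x
  ring

theorem Energy.normSq_nonneg (ε : Energy) : 0 ≤ ε.normSq :=
  integral_nonneg fun x => by positivity

theorem Energy.norm_sq (ε : Energy) : ε.norm ^ 2 = ε.normSq :=
  Real.sq_sqrt ε.normSq_nonneg

theorem eventually_mul_sech_le (A : ℝ) {κ τ : ℝ} (hκ : 0 < κ) (hτ : 0 < τ) :
    ∀ᶠ s in atTop, A * sech (κ * s) ≤ τ := by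
  have h1 : Tendsto (fun s : ℝ => 1 + (κ * s) ^ 2) atTop atTop :=
    tendsto_atTop_add_const_left _ _
      ((tendsto_pow_atTop two_ne_zero).comp (tendsto_id.const_mul_atTop hκ))
  have h2 : Tendsto (fun s : ℝ => sech (κ * s)) atTop (𝓝 0) := by
    have := h1.inv_tendsto_atTop.const_mul 2
    rw [mul_zero] at this
    exact squeeze_zero (fun s => (sech_pos _).le) (fun s => sech_le_inv (κ * s)) this
  have h3 := h2.const_mul A
  rw [mul_zero] at h3
  exact (h3.eventually (gt_mem_nhds hτ)).mono fun _ h => h.le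

set_option maxHeartbeats 1000000 in
/-- Coercivity of the quadratic form for large times. The range `δ` of the modulated frequencies
comes from the coercivity of the single solitons; the range `X` of the shifts is arbitrary, since
only the time depends on it. -/
theorem le_quadForm {N : ℕ} {α β : ℝ} {ω c : Fin N → ℝ} {Ψ : Fin N → ℝ → ℝ} (hα : 0 < α)
    (hω : ∀ j, 0 < 1 - c j ^ 2 - ω j ^ 2) (hβ : ∀ j, 0 < α - β * (1 - c j ^ 2))
    (hc : StrictMono c) (hΨ : ∀ j, IsNegEigenfunction α β (ω j) (c j) (Ψ j)) :
    ∃ K : ℝ, 0 < K ∧ ∃ δ : ℝ, 0 < δ ∧ ∀ ψ : ℝ → ℝ, IsCutoff ψ → ∀ (x₀ : Fin N → ℝ) (X : ℝ),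
      ∃ T₀ : ℝ, ∀ t : ℝ, T₀ ≤ t → ∀ ω' x' γ' : Fin N → ℝ,
        (∀ j, |ω' j - ω j| < δ) → (∀ j, |x' j - x₀ j| ≤ X) →
        ∀ ε : Energy, Orthogonal α β ω c Ψ ω' x' γ' t ε →
          K * ε.normSq ≤ quadForm α β ω c ψ ω' x' γ' t ε := by
  classical
  choose k' hk' D' hD' hev using fun j => soliton_coercive_of_orthogonal (hω j) (hβ j) (hΨ j)
  have hcpos : ∀ j, 0 < 1 - c j ^ 2 := fun j => one_sub_sq_pos (hω j)
  -- constants that depend on the solitons only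
  obtain ⟨k₁, hk₁, hk₁'⟩ := exists_pos_forall_le (a := fun j => (1 - c j ^ 2 - ω j ^ 2) / 2)
    fun j => half_pos (hω j)
  obtain ⟨k₂, hk₂, hk₂'⟩ := exists_pos_forall_le hk'
  obtain ⟨κ₀, hκ₀, hκ₀'⟩ := exists_pos_forall_le (a := fun j => invWidth (ω j) (c j) / 2)
    fun j => half_pos (invWidth_pos (hω j))
  obtain ⟨σ, hσ, hσ'⟩ := exists_pos_forall_le
    (a := fun q : {q : Fin N × Fin N // q.1 < q.2} => (c q.1.2 - c q.1.1) / 8)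
    fun q => div_pos (sub_pos.2 (hc q.2)) (by norm_num)
  have hgap : ∀ i j, i < j → c i + 8 * σ ≤ c j := fun i j hij => by
    have := hσ' ⟨(i, j), hij⟩
    simp only at this
    linarith
  set k₀ := min 1 k₁ with hk₀
  have hk00 : 0 < k₀ := lt_min one_pos hk₁
  set k := min k₀ k₂ with hk
  have hk0 : 0 < k := lt_min hk00 hk₂
  set D := ∑ j, D' j with hD
  have hDj : ∀ j, D' j ≤ D := fun j =>
    Finset.single_le_sum (fun i _ => hD' i) (Finset.mem_univ j)
  have hD0 : 0 ≤ D := Finset.sum_nonneg fun i _ => hD' i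
  set A := 1 + ∑ j, Real.sqrt (2 / (α - β * (1 - c j ^ 2))) with hA
  have hAj : ∀ j, Real.sqrt (2 / (α - β * (1 - c j ^ 2))) ≤ A := fun j => by
    have := Finset.single_le_sum (f := fun j => Real.sqrt (2 / (α - β * (1 - c j ^ 2))))
      (fun i _ => Real.sqrt_nonneg _) (Finset.mem_univ j)
    linarith
  have hA1 : 1 ≤ A := by
    have := Finset.sum_nonneg (s := Finset.univ)
      (f := fun j => Real.sqrt (2 / (α - β * (1 - c j ^ 2)))) fun i _ => Real.sqrt_nonneg _
    linarith
  set B := |β| + α / k₀ + ∑ j, |α / (1 - c j ^ 2) - β| with hB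
  have hBs : 0 ≤ ∑ j, |α / (1 - c j ^ 2) - β| := Finset.sum_nonneg fun i _ => abs_nonneg _
  have hB2 : |β| ≤ B := by
    have : 0 ≤ α / k₀ := by positivity
    linarith
  have hB3 : α / k₀ ≤ B := by linarith [abs_nonneg β]
  have hB1 : ∀ j, |α / (1 - c j ^ 2) - β| ≤ B := fun j => by
    have h1 := Finset.single_le_sum (f := fun j => |α / (1 - c j ^ 2) - β|)
      (fun i _ => abs_nonneg _) (Finset.mem_univ j)
    have : 0 ≤ α / k₀ := by positivity
    linarith [abs_nonneg β]
  have hB0 : 0 ≤ B := (abs_nonneg β).trans hB2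
  set n : ℝ := (Fintype.card (Fin N) : ℝ) with hn
  have hn0 : 0 ≤ n := Nat.cast_nonneg _
  set M := n * D + errConst n A B with hM
  have hM0 : 0 ≤ M := by rw [hM, errConst]; positivity
  set Γ := lossConst n α k₀ A B with hΓ
  have hΓ0 : 0 < Γ := by rw [hΓ, lossConst]; positivity
  -- the localization errors, of total size `M τ`, are absorbed by half of the coercivity constant
  set τ := min 1 (k / (2 * (M + 1))) with hτ
  have hτ0 : 0 < τ := lt_min one_pos (by positivity)
  have hτ1 : τ ≤ 1 := min_le_left _ _
  have hMτ : M * τ ≤ k / 2 := by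
    have h1 : (M + 1) * τ ≤ (M + 1) * (k / (2 * (M + 1))) :=
      mul_le_mul_of_nonneg_left (min_le_right _ _) (by positivity)
    have h2 : (M + 1) * (k / (2 * (M + 1))) = k / 2 := by field_simp
    linarith
  -- the share `s` of the bound by the last three components costs `s Γ` in the first one
  set s := min (1 / 2) (k / (8 * Γ)) with hs
  have hs0 : 0 < s := lt_min (by norm_num) (by positivity)
  have hs1 : s ≤ 1 / 2 := min_le_left _ _
  have hsΓ : s * Γ ≤ k / 8 := by
    have h1 : s * Γ ≤ k / (8 * Γ) * Γ := mul_le_mul_of_nonneg_right (min_le_right _ _) hΓ0.le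
    have h2 : k / (8 * Γ) * Γ = k / 8 := by field_simp
    linarith
  set m := min (1 / 2) (α * k₀ / 8) with hm
  have hm0 : 0 < m := lt_min (by norm_num) (by positivity)
  -- the admissible range of the frequencies
  have evA : ∀ j, ∀ᶠ ω' in 𝓝 (ω j), c j ^ 2 + ω' ^ 2 ≤ 1 - k₀ ∧ κ₀ ≤ invWidth ω' (c j) := by
    intro j
    have h1 : c j ^ 2 + ω j ^ 2 < 1 - k₀ := by
      linarith [hk₁' j, hω j, min_le_right 1 k₁]
    have h2 : κ₀ < invWidth (ω j) (c j) := by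
      linarith [hκ₀' j, invWidth_pos (hω j)]
    filter_upwards [(by fun_prop : Continuous fun ω' : ℝ =>
      c j ^ 2 + ω' ^ 2).continuousAt.eventually (gt_mem_nhds h1),
      ((continuous_invWidth (c j)).tendsto (ω j)).eventually (lt_mem_nhds h2)] with ω' a1 a2
    exact ⟨a1.le, a2.le⟩
  have ev := fun j => Metric.eventually_nhds_iff.1 ((evA j).and (hev j))
  choose r hr hrev using ev
  obtain ⟨δ, hδ, hδr⟩ := exists_pos_forall_le hr
  obtain ⟨Z, Z', MZ, hMZ, hZ, hZZ', -, hZ0, hZ1, hZin, hZout, hZZ0, hZM⟩ := exists_cutoff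
  refine ⟨min (k / 8) (s * m), lt_min (by positivity) (by positivity), δ, hδ,
    fun ψ hψ x₀ X => ?_⟩
  -- the time after which the solitons are well separated
  have lim : Tendsto (fun t : ℝ => σ * t) atTop atTop := tendsto_id.const_mul_atTop hσ
  have e1 : ∀ᶠ t : ℝ in atTop, ∀ j, |x₀ j| + X ≤ σ * t / 2 := eventually_all.2 fun j => by
    filter_upwards [lim.eventually_ge_atTop (2 * (|x₀ j| + X))] with t ht
    linarith
  have e2 : ∀ᶠ t : ℝ in atTop, MZ / τ ≤ σ * t := lim.eventually_ge_atTop _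
  have e3 : ∀ᶠ t : ℝ in atTop, 0 < t := eventually_gt_atTop 0
  have e4 : ∀ᶠ t : ℝ in atTop, Real.sqrt t < 2 * (σ * t) := by
    filter_upwards [lim.eventually_gt_atTop σ⁻¹, e3] with t ht ht0
    rw [Real.sqrt_lt' (by positivity)]
    have h1 : 1 < σ * (σ * t) := by
      have := mul_lt_mul_of_pos_left ht hσ
      rwa [mul_inv_cancel₀ hσ.ne'] at this
    nlinarith
  have e5 : ∀ᶠ t : ℝ in atTop, A * sech (κ₀ * (σ * t / 2)) ≤ τ :=
    (lim.atTop_div_const two_pos).eventually (eventually_mul_sech_le A hκ₀ hτ0)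
  obtain ⟨T₀, hT₀⟩ := eventually_atTop.1 (e1.and (e2.and (e3.and (e4.and e5))))
  refine ⟨T₀, fun t ht ω' x' γ' hω' hx' ε hO => ?_⟩
  obtain ⟨t1, t2, t0, t4, hfar0⟩ := hT₀ t ht
  have hσt : 0 < σ * t := by positivity
  have hq : ∀ j, dist (ω' j) (ω j) < r j := fun j => by
    rw [Real.dist_eq]; exact (hω' j).trans_le (hδr j)
  have q1 := fun j => (hrev j (hq j)).1.1
  have q3 := fun j => (hrev j (hq j)).1.2
  have q4 := fun j => (hrev j (hq j)).2
  -- the cutoffs around the solitons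
  set z : Fin N → ℝ → ℝ := fun j x => Z ((x - c j * t) / (σ * t)) with hz
  set z' : Fin N → ℝ → ℝ := fun j x => Z' ((x - c j * t) / (σ * t)) / (σ * t) with hz'
  set f : Fin N → ℝ → ℝ := fun j x => profile α β (ω' j) (c j) (x - c j * t - x' j) with hf
  have hzC : ∀ j, ContDiff ℝ (⊤ : ℕ∞) (z j) := fun j => by
    rw [hz]
    exact hZ.comp (by fun_prop)
  have hzd : ∀ j x, HasDerivAt (z j) (z' j x) x := fun j x => by
    have h1 : HasDerivAt (fun x => (x - c j * t) / (σ * t)) (1 / (σ * t)) x :=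
      ((hasDerivAt_id x).sub_const (c j * t)).div_const (σ * t)
    exact ((hZZ' _).comp x h1).congr_deriv (by simp only [hz']; ring)
  have hz'τ : ∀ j x, |z' j x| ≤ τ := fun j x => by
    simp only [hz']
    rw [abs_div, abs_of_pos hσt, div_le_iff₀ hσt]
    refine (hZM _).trans ?_
    rwa [div_le_iff₀' hτ0] at t2
  have hznear : ∀ j x, z j x ≠ 0 → |x - c j * t| < 2 * (σ * t) := fun j x hx => by
    by_contra hcon
    refine hx (hZout _ ?_)
    rw [abs_div, abs_of_pos hσt, le_div_iff₀ hσt]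
    exact not_lt.1 hcon
  have hdist : ∀ j x, z j x ≠ 1 → σ * t / 2 ≤ |x - c j * t - x' j| := fun j x hx => by
    have h1 : σ * t < |x - c j * t| := by
      by_contra hcon
      refine hx (hZin _ ?_)
      rw [abs_div, abs_of_pos hσt, div_le_one hσt]
      exact not_lt.1 hcon
    have h2 := abs_sub_abs_le_abs_sub (x - c j * t) (x' j)
    have h3 := abs_sub_abs_le_abs_sub (x' j) (x₀ j)
    linarith [t1 j, hx' j]
  have hsechfar : ∀ j x, z j x ≠ 1 → A * sech (κ₀ * (x - c j * t - x' j)) ≤ τ := fun j x hx => by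
    refine le_trans ?_ hfar0
    refine mul_le_mul_of_nonneg_left (sech_le_sech ?_) (by linarith)
    rw [abs_mul, abs_mul, abs_of_pos hκ₀, abs_of_pos (half_pos hσt)]
    exact mul_le_mul_of_nonneg_left (hdist j x hx) hκ₀.le
  have hf0 : ∀ j x, 0 ≤ f j x := fun j x => by
    simp only [hf]
    rw [profile_eq]
    exact mul_nonneg (Real.sqrt_nonneg _) (sech_pos _).le
  have hfs : ∀ j x, f j x ≤ A * sech (κ₀ * (x - c j * t - x' j)) := fun j x => by
    simp only [hf]
    rw [profile_eq]
    refine mul_le_mul ((Real.sqrt_le_sqrt ?_).trans (hAj j)) (sech_mul_le hκ₀ (q3 j) _)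
      (sech_pos _).le (by linarith)
    exact div_le_div_of_nonneg_right (by linarith [sq_nonneg (c j), sq_nonneg (ω' j)]) (hβ j).le
  have hfA : ∀ j x, f j x ≤ A := fun j x =>
    (hfs j x).trans (mul_le_of_le_one_right (by linarith) (sech_le_one _))
  have hsep : ∀ x, IsSeparated α β k₀ A B τ c ω' (fun j => loc ψ c j t x) (fun j => f j x)
      (fun j => z j x) (fun j => z' j x) (fun j => phase (ω j) (c j) (γ' j) t x) := fun x =>
    { subluminal := q1
      weight_nonneg := fun j => loc_nonneg hψ hσ t0 t4 hgap j x
      sum_weight_le := sum_loc_le hψ x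
      norm_phase := fun j => norm_phase _ _ _ _ _
      amplitude_nonneg := fun j => hf0 j x
      amplitude_le := fun j => hfA j x
      abs_coeff_le := hB1
      abs_le := hB2
      div_le := hB3
      cutoff_nonneg := fun j => hZ0 _
      cutoff_le := fun j => hZ1 _
      abs_deriv_le := fun j => hz'τ j x
      separated := fun i hi => by
        have h1 := hznear i x hi
        refine ⟨loc_eq_one hψ t0 t4 hgap i h1.le, fun j hj => ?_⟩
        by_contra hcon
        obtain ⟨a1, a2⟩ := abs_lt.1 h1
        obtain ⟨b1, b2⟩ := abs_lt.1 (hznear j x hcon)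
        rcases lt_or_gt_of_ne hj with hlt | hlt
        · have := mul_le_mul_of_nonneg_right (hgap _ _ hlt) t0.le
          linarith
        · have := mul_le_mul_of_nonneg_right (hgap _ _ hlt) t0.le
          linarith
      deriv_eq_zero := fun j hj => by
        show Z' _ / _ = 0
        rw [hZZ0 _ hj, zero_div]
      amplitude_far := fun j hj => (hfs j x).trans (hsechfar j x hj) }
  have hfc : ∀ j, Continuous (f j) := fun j =>
    (continuous_profile α β (ω' j) (c j)).comp (by fun_prop)
  have hzc : ∀ j, Continuous (z j) := fun j => (hzC j).continuous
  have hz'c : ∀ j, Continuous (z' j) := fun j =>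
    (funext fun x => (hzd j x).deriv : deriv (z j) = z' j) ▸ (hzC j).continuous_deriv (by simp)
  have hec : ∀ j, Continuous (phase (ω j) (c j) (γ' j) t) := fun j => continuous_phase _ _ _ _
  obtain ⟨hint, heq⟩ := integral_density_eq (α := α) (β := β) (A := A) (c := c) (ω := ω')
    (p := fun j => loc ψ c j t) (f := f) (e := fun j => phase (ω j) (c j) (γ' j) t) hfc
    (fun j x => by rw [abs_of_nonneg (hf0 j x)]; exact hfA j x) hec
    (fun j x => norm_phase _ _ _ _ _) (fun j => continuous_loc hψ j)
    (fun j x => by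
      rw [abs_of_nonneg (loc_nonneg hψ hσ t0 t4 hgap j x)]
      exact (Finset.single_le_sum (f := fun j => loc ψ c j t x)
        (fun i _ => loc_nonneg hψ hσ t0 t4 hgap i x) (Finset.mem_univ j)).trans (sum_loc_le hψ x))
    ε
  set E := ∫ x, (‖ε.u x‖ ^ 2 + ‖ε.ux x‖ ^ 2) with hE
  have hE0 : 0 ≤ E := integral_nonneg fun x => by positivity
  set F := ∫ x, (‖ε.ρ x‖ ^ 2 + ε.v x ^ 2 + ε.n x ^ 2) with hF
  have hF0 : 0 ≤ F := integral_nonneg fun x => by positivity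
  have hcoer : ∀ j, k * ∫ x, z j x ^ 2 * (‖ε.u x‖ ^ 2 + ‖ε.ux x‖ ^ 2) ≤
      (∫ x, solitonForm (ω' j) (c j) ((α / (1 - c j ^ 2) - β) * f j x ^ 2)
        (phase (ω j) (c j) (γ' j) t x) ((z j x : ℂ) * ε.u x)
        ((z j x : ℂ) * ε.ux x + (z' j x : ℂ) * ε.u x)) + D * τ * E := fun j => by
    obtain ⟨o1, o2, o3⟩ := hO j
    have h1 := q4 j (γ' j) t (x' j) τ ε.u ε.ux (z j) (z' j) hτ0 hτ1 ε.memLp_u ε.memLp_ux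
      ε.weakDeriv (hzC j) (hzd j) (fun x => hZ0 _) (fun x => hZ1 _) (hz'τ j)
      (fun x hx => ((sech_mul_le hκ₀ (hκ₀' j) _).trans
        (le_mul_of_one_le_left (sech_pos _).le hA1)).trans (hsechfar j x hx)) o1 o2 o3
    have h2 : k * ∫ x, z j x ^ 2 * (‖ε.u x‖ ^ 2 + ‖ε.ux x‖ ^ 2) ≤
        k' j * ∫ x, z j x ^ 2 * (‖ε.u x‖ ^ 2 + ‖ε.ux x‖ ^ 2) :=
      mul_le_mul_of_nonneg_right ((min_le_right _ _).trans (hk₂' j))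
        (integral_nonneg fun x => by positivity)
    have h3 : D' j * τ * E ≤ D * τ * E := by
      have := hDj j
      gcongr
    exact h2.trans (h1.trans (add_le_add_right h3 _))
  have key := le_integral_density hsep hα hk00 (min_le_left _ _) hA1 hτ0 hτ1 hs0.le
    (hs1.trans (by norm_num)) hfc hzc hz'c hec ε (min_le_left _ _) hint hcoer
  have hquad : quadForm α β ω c ψ ω' x' γ' t ε = _ := heq.symm
  rw [hquad, Energy.normSq_eq]
  refine le_trans ?_ key
  have g1 : k / 4 * E ≤ (1 - s) * ((k - M * τ) * E) := by
    have h1 : k / 2 * E ≤ (k - M * τ) * E := mul_le_mul_of_nonneg_right (by linarith) hE0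
    have h2 : 0 ≤ (k - M * τ) * E := le_trans (by positivity) h1
    have h3 : 1 / 2 * ((k - M * τ) * E) ≤ (1 - s) * ((k - M * τ) * E) :=
      mul_le_mul_of_nonneg_right (by linarith) h2
    linarith
  have g2 : s * Γ * E ≤ k / 8 * E := mul_le_mul_of_nonneg_right hsΓ hE0
  have g3 : min (k / 8) (s * m) * E ≤ k / 8 * E := mul_le_mul_of_nonneg_right (min_le_left _ _) hE0
  have g4 : min (k / 8) (s * m) * F ≤ s * m * F := mul_le_mul_of_nonneg_right (min_le_right _ _) hF0
  rw [mul_add]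
  linarith

end KGZ

end

theorem proposition3p5 {N : ℕ} (α β : ℝ) (ω c : Fin N → ℝ) (Ψ : Fin N → ℝ → ℝ)
    (hα : 0 < α)
    (hω : ∀ j, 0 < 1 - c j ^ 2 - ω j ^ 2)
    (hβ : ∀ j, 0 < α - β * (1 - c j ^ 2))
    (hc : StrictMono c)
    (hΨ : ∀ j, KGZ.IsNegEigenfunction α β (ω j) (c j) (Ψ j)) :
    ∃ K : ℝ, 0 < K ∧ ∃ δ : ℝ, 0 < δ ∧
      ∀ ψ : ℝ → ℝ, KGZ.IsCutoff ψ → ∀ x₀ : Fin N → ℝ,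
        ∃ T₀ : ℝ, ∀ t : ℝ, T₀ ≤ t →
          ∀ ω' x' γ' : Fin N → ℝ,
            (∀ j, |ω' j - ω j| ≤ δ) → (∀ j, |x' j - x₀ j| ≤ δ) →
            ∀ ε : KGZ.Energy, KGZ.Orthogonal α β ω c Ψ ω' x' γ' t ε →
              K * ε.norm ^ 2 ≤ KGZ.quadForm α β ω c ψ ω' x' γ' t ε ∧
              (0 ≤ β ∨ ε.norm ≤ δ →
                K * ε.norm ^ 2 ≤ KGZ.locForm α β ω c ψ ω' x' γ' t ε) := by
  obtain ⟨K, hK, δ, hδ, H⟩ := KGZ.le_quadForm hα hω hβ hc hΨ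
  -- `|β| d² ≤ K / 2`, so that the quartic term is absorbed by half of the quadratic one
  set d := min (δ / 2) (min 1 (K / (2 * (|β| + 1)))) with hd
  have hd0 : 0 < d := lt_min (half_pos hδ) (lt_min one_pos (by positivity))
  have hdδ : d < δ := (min_le_left _ _).trans_lt (half_lt_self hδ)
  have hd1 : d ≤ 1 := (min_le_right _ _).trans (min_le_left _ _)
  have hd2 : |β| * d ^ 2 ≤ K / 2 := by
    have h1 : d ≤ K / (2 * (|β| + 1)) := (min_le_right _ _).trans (min_le_right _ _)
    have h2 : d ^ 2 ≤ K / (2 * (|β| + 1)) := (pow_le_of_le_one hd0.le hd1 two_ne_zero).trans h1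
    calc |β| * d ^ 2 ≤ (|β| + 1) * (K / (2 * (|β| + 1))) :=
          mul_le_mul (by linarith) h2 (sq_nonneg _) (by positivity)
      _ = K / 2 := by field_simp
  refine ⟨K / 2, half_pos hK, d, hd0, fun ψ hψ x₀ => ?_⟩
  obtain ⟨T₀, hT₀⟩ := H ψ hψ x₀ d
  refine ⟨T₀, fun t ht ω' x' γ' hω' hx' ε hO => ?_⟩
  have hq := hT₀ t ht ω' x' γ' (fun j => (hω' j).trans_lt hdδ) hx' ε hO
  have hn0 := ε.normSq_nonneg
  rw [ε.norm_sq]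
  have hKn : 0 ≤ K / 2 * ε.normSq := by positivity
  refine ⟨by linarith, fun hor => ?_⟩
  have h4 : 0 ≤ ∫ x, ‖ε.u x‖ ^ 4 := integral_nonneg fun x => by positivity
  rw [KGZ.locForm]
  rcases hor with hβ0 | hsmall
  · have : 0 ≤ β / 2 * ∫ x, ‖ε.u x‖ ^ 4 := by positivity
    linarith
  · have hS : ε.normSq ≤ d ^ 2 := by
      rw [← ε.norm_sq]
      exact pow_le_pow_left₀ (Real.sqrt_nonneg _) hsmall 2
    have i1 := ε.memLp_u.integrable_norm_pow (p := 2) (by norm_num)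
    have i2 := ε.memLp_ux.integrable_norm_pow (p := 2) (by norm_num)
    have hF0 : 0 ≤ ∫ x, (‖ε.ρ x‖ ^ 2 + ε.v x ^ 2 + ε.n x ^ 2) :=
      integral_nonneg fun x => by positivity
    have hE : ∫ x, (‖ε.u x‖ ^ 2 + ‖ε.ux x‖ ^ 2) ≤ ε.normSq := by
      rw [ε.normSq_eq]
      linarith
    have hU : ∫ x, ‖ε.u x‖ ^ 2 ≤ ε.normSq :=
      (integral_mono i1 (i1.add i2) fun x => le_add_of_nonneg_right (sq_nonneg _)).trans hE
    have hq4 : ∫ x, ‖ε.u x‖ ^ 4 ≤ 2 * d ^ 2 * ε.normSq := by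
      refine (KGZ.integral_norm_pow_four_le ε.memLp_u ε.memLp_ux ε.weakDeriv).trans ?_
      exact mul_le_mul (by linarith) hU (integral_nonneg fun x => sq_nonneg _) (by positivity)
    have h5 : |β / 2 * ∫ x, ‖ε.u x‖ ^ 4| ≤ K / 2 * ε.normSq := by
      rw [abs_mul, abs_of_nonneg h4, abs_div, abs_two]
      calc |β| / 2 * ∫ x, ‖ε.u x‖ ^ 4 ≤ |β| / 2 * (2 * d ^ 2 * ε.normSq) := by gcongr
        _ = |β| * d ^ 2 * ε.normSq := by ring
        _ ≤ K / 2 * ε.normSq := mul_le_mul_of_nonneg_right hd2 hn0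
    linarith [(abs_le.1 h5).1]
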